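/- Let $V:\mathbb{R}^3\to\mathbb{R}$ be smooth and rapidly decreasing (Schwartz class) and let $g\in\mathbb{R}\setminus\{0\}$. Assume that the operator $-\Delta+V$ on $L^2(\mathbb{R}^3)$, with domain $H^2$, has exactly two eigenvalues $E_{0\star}<E_{1\star}<0$, that $\psi_{0\star}>0$ is an $L^2$-normalized eigenfunction for $E_{0\star}$, that $E_{1\star}$ has multiplicity $N\ge1$ with linearly independent eigenfunctions $\xi_{1\star},\dots,\xi_{N\star}$ spanning its eigenspace, and that $2E_{1\star}-E_{0\star}>0$. Let $E\mapsto\psi_E$ be a branch of nonlinear ground states bifurcating from $(0,E_{0\star})$: $\psi_{E_{0\star}}=0$ and, for some $\delta_0>0$ and all $E$ with $0<|E-E_{0\star}|\le\delta_0$ and $g(E-E_{0\star})>0$, $\psi_E\in H^2(\mathbb{R}^3)$ is a positive solution of $(-\Delta+V)\psi_E+g\psi_E^3=E\psi_E$ with $$\psi_E=\rho(E)\bigl(\psi_{0\star}+\mathcal{O}(\rho(E)^2)\bigr)\ \text{in } H^2,\qquad \rho(E)=|E_{0\star}-E|^{1/2}\Bigl(|g|\int\psi_{0\star}^4\Bigr)^{-1/2}.$$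 Let $L_+(E)=-\Delta-E+V+3g\psi_E^2$, $L_-(E)=-\Delta-E+V+g\psi_E^2$ and $$L(E)=\begin{pmatrix}0&L_-(E)\\-L_+(E)&0\end{pmatrix}=JH(E),\quad J=\begin{pmatrix}0&1\\-1&0\end{pmatrix},\quad H(E)=\begin{pmatrix}L_+(E)&0\\0&L_-(E)\end{pmatrix},$$ on $L^2\times L^2$ (complex valued). All limits $E\to E_{0\star}$ below are taken on the side $g(E-E_{0\star})>0$. Then: 1. $\pm i(E_{1\star}-E_{0\star})$ are eigenvalues of $L(E_{0\star})$, each of (geometric and algebraic) multiplicity $N$. 2. There are $\delta\in(0,\delta_0]$ and $\varepsilon>0$ and, for $0<|E-E_{0\star}|<\delta$ with $g(E-E_{0\star})>0$, real numbers $\beta_1(E),\dots,\beta_N(E)$ and real-valued functions $\xi_n=\xi_n(E)$, $\eta_n=\eta_n(E)$, $1\le n\le N$, such that $(\xi_n,\pm i\eta_n)$ is an eigenvector of $L(E)$ with eigenvalue $\pm i\beta_n(E)$, and $\beta_n(E)\to E_{1\star}-E_{0\star}$ as $E\to E_{0\star}$. For each sign and every $\mu\in\mathbb{C}$ with $|\mu\mp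 i(E_{1\star}-E_{0\star})|<\varepsilon$, both the eigenspace and the generalized eigenspace of $L(E)$ at $\mu$ are spanned by those $(\xi_n,\pm i\eta_n)$ for which $\pm i\beta_n(E)=\mu$. 3. For these $E$, the map $E\mapsto\psi_E\in L^2$ is differentiable at $E$ and, for all $m,n$, $$\langle\xi_m,\eta_n\rangle=\delta_{m,n},\qquad \langle\xi_m,\psi_E\rangle=\langle\eta_m,\partial_E\psi_E\rangle=0.$$ 4. For each $n$, $\displaystyle 0\ne\lim_{E\to E_{0\star}}\xi_n=\lim_{E\to E_{0\star}}\eta_n\in\mathrm{span}\{\xi_{1\star},\dots,\xi_{N\star}\}$, with convergence in $H^k$ for every $k>0$. 5. For each $n$, $2\beta_n(E)+E\to2E_{1\star}-E_{0\star}>0$ as $E\to E_{0\star}$, and $2\beta_n(E)+E>0$ for all $E$ as in 2. -/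

import Mathlib

open MeasureTheory TemperedDistribution Laplacian Filter Topology
open scoped SchwartzMap ENNReal

noncomputable section

namespace NLSGP

/-! ### Eigenspaces of unbounded operators -/

section Eigenspaces

variable {M : Type*} [AddCommGroup M] [Module ℂ M]

/-- The eigenspace `ker (A - μ)` of an unbounded operator `A`. -/
def eigenspace (A : M →ₗ.[ℂ] M) (μ : ℂ) : Submodule ℂ M where
  carrier := {x | ∃ h : x ∈ A.domain, A ⟨x, h⟩ = μ • x}
  zero_mem' := ⟨A.domain.zero_mem, by
    have h0 : A ⟨0, A.domain.zero_mem⟩ = 0 := A.map_zero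
    rw [h0, smul_zero]⟩
  add_mem' := by
    rintro x y ⟨hx, ex⟩ ⟨hy, ey⟩
    refine ⟨A.domain.add_mem hx hy, ?_⟩
    have := A.map_add ⟨x, hx⟩ ⟨y, hy⟩
    rw [ex, ey] at this
    rw [smul_add]
    exact this
  smul_mem' := by
    rintro c x ⟨hx, ex⟩
    refine ⟨A.domain.smul_mem c hx, ?_⟩
    have := A.map_smul c ⟨x, hx⟩
    rw [ex] at this
    rw [smul_comm]
    exact this

/-- `{x ∈ D(A) | (A - μ) x ∈ S}`. -/
def shiftPreimage (A : M →ₗ.[ℂ] M) (μ : ℂ) (S : Submodule ℂ M) : Submodule ℂ M where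
  carrier := {x | ∃ h : x ∈ A.domain, A ⟨x, h⟩ - μ • x ∈ S}
  zero_mem' := ⟨A.domain.zero_mem, by
    have h0 : A ⟨0, A.domain.zero_mem⟩ = 0 := A.map_zero
    rw [h0, smul_zero, sub_zero]
    exact S.zero_mem⟩
  add_mem' := by
    rintro x y ⟨hx, ex⟩ ⟨hy, ey⟩
    refine ⟨A.domain.add_mem hx hy, ?_⟩
    have h : A ⟨x + y, A.domain.add_mem hx hy⟩ = A ⟨x, hx⟩ + A ⟨y, hy⟩ :=
      A.map_add ⟨x, hx⟩ ⟨y, hy⟩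
    have e : A ⟨x, hx⟩ + A ⟨y, hy⟩ - μ • (x + y)
        = (A ⟨x, hx⟩ - μ • x) + (A ⟨y, hy⟩ - μ • y) := by rw [smul_add]; abel
    rw [h, e]
    exact S.add_mem ex ey
  smul_mem' := by
    rintro c x ⟨hx, ex⟩
    refine ⟨A.domain.smul_mem c hx, ?_⟩
    have h : A ⟨c • x, A.domain.smul_mem c hx⟩ = c • A ⟨x, hx⟩ := A.map_smul c ⟨x, hx⟩
    have e : c • A ⟨x, hx⟩ - μ • (c • x) = c • (A ⟨x, hx⟩ - μ • x) := by
      rw [smul_sub, smul_comm]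
    rw [h, e]
    exact S.smul_mem c ex

/-- `ker (A - μ) ^ k`, with the domain of `A ^ k` taken into account. -/
def genEigenspace (A : M →ₗ.[ℂ] M) (μ : ℂ) : ℕ → Submodule ℂ M
  | 0 => ⊥
  | k + 1 => shiftPreimage A μ (genEigenspace A μ k)

/-- The generalized eigenspace (root space) of `A` at `μ`; its dimension is the algebraic
multiplicity of `μ`. -/
def rootSpace (A : M →ₗ.[ℂ] M) (μ : ℂ) : Submodule ℂ M := ⨆ k, genEigenspace A μ k

end Eigenspaces

/-! ### Schrödinger operators on `L²(ℝ³)` -/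

/-- The physical space `ℝ³`. -/
abbrev Space : Type := EuclideanSpace ℝ (Fin 3)

/-- `L²(ℝ³; ℂ)`. -/
abbrev L2C : Type := Lp ℂ 2 (volume : Measure Space)

/-- `L²(ℝ³; ℝ)`. -/
abbrev L2R : Type := Lp ℝ 2 (volume : Measure Space)

/-- A real-valued `L²` function regarded as a complex-valued one. -/
def toC (u : L2R) : L2C := Complex.ofRealCLM.compLp u

/-- The tempered distribution defined by an `L²` function. -/
abbrev toDist (u : L2C) : 𝓢'(Space, ℂ) := Lp.toTemperedDistribution u

/-- The `H^s` norm of an `L²` function, i.e. the `L²` norm of its Bessel potential of order `s`,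
and `∞` if the function is not in `H^s`. -/
def sobolevNorm (s : ℝ) (u : L2C) : ℝ≥0∞ :=
  ⨅ (f : L2C) (_ : besselPotential Space ℂ s (toDist u) = toDist f), ‖f‖ₑ

theorem toDist_add (u v : L2C) : toDist (u + v) = toDist u + toDist v := by
  simp only [toDist, ← Lp.toTemperedDistributionCLM_apply, map_add]

theorem toDist_smul (c : ℂ) (u : L2C) : toDist (c • u) = c • toDist u := by
  simp only [toDist, ← Lp.toTemperedDistributionCLM_apply, map_smul]

theorem toDist_zero : toDist 0 = 0 := by
  simp only [toDist, ← Lp.toTemperedDistributionCLM_apply, map_zero]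

theorem toDist_injective : Function.Injective toDist := by
  have h := Lp.ker_toTemperedDistributionCLM_eq_bot (F := ℂ) (p := 2)
    (μ := (volume : Measure Space))
  intro u v huv
  refine LinearMap.ker_eq_bot.mp h ?_
  exact huv

/-- The Sobolev space `H²(ℝ³)` as a subspace of `L²(ℝ³; ℂ)`. -/
def H2 : Submodule ℂ L2C where
  carrier := {u | MemSobolev 2 2 (toDist u)}
  zero_mem' := by
    change MemSobolev 2 2 (toDist 0)
    rw [toDist_zero]
    exact memSobolev_fun_zero Space ℂ 2 2
  add_mem' := by
    intro u v hu hv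
    change MemSobolev 2 2 (toDist (u + v))
    rw [toDist_add]
    exact hu.add hv
  smul_mem' := by
    intro c u hu
    change MemSobolev 2 2 (toDist (c • u))
    rw [toDist_smul]
    exact hu.smul c

theorem exists_laplacian (u : H2) : ∃ f : L2C, toDist f = -Δ (toDist (u : L2C)) := by
  have h : MemSobolev (2 - 2) 2 (Δ (toDist (u : L2C))) := MemSobolev.laplacian u.2
  rw [sub_self, memSobolev_zero_iff] at h
  obtain ⟨f, hf⟩ := h
  refine ⟨-f, ?_⟩
  rw [hf]
  simp only [toDist, ← Lp.toTemperedDistributionCLM_apply, map_neg]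

/-- The operator `-Δ` (distributional Laplacian) on `L²(ℝ³; ℂ)` with domain `H²(ℝ³)`. -/
def negLaplacian : L2C →ₗ.[ℂ] L2C where
  domain := H2
  toFun :=
    { toFun := fun u => (exists_laplacian u).choose
      map_add' := by
        intro u v
        apply toDist_injective
        rw [toDist_add, (exists_laplacian _).choose_spec, (exists_laplacian _).choose_spec,
          (exists_laplacian _).choose_spec, Submodule.coe_add, toDist_add, ← laplacianCLM_apply,
          map_add, laplacianCLM_apply, laplacianCLM_apply, neg_add]
      map_smul' := by
        intro c u
        apply toDist_injective
        rw [RingHom.id_apply, toDist_smul, (exists_laplacian _).choose_spec,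
          (exists_laplacian _).choose_spec, Submodule.coe_smul, toDist_smul,
          ← laplacianCLM_apply, map_smul, laplacianCLM_apply, smul_neg] }

/-- The natural domain `{u ∈ L² | W u ∈ L²}` of multiplication by `W`. -/
def mulDomain (W : Space → ℝ) : Submodule ℂ L2C where
  carrier := {u | MemLp (fun x => (W x : ℂ) * u x) 2 volume}
  zero_mem' := by
    refine (memLp_congr_ae ?_).mpr (MemLp.zero (ε := ℂ) (p := 2))
    filter_upwards [Lp.coeFn_zero ℂ 2 (volume : Measure Space)] with x hx
    rw [hx]
    simp
  add_mem' := by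
    intro u v hu hv
    refine (memLp_congr_ae ?_).mpr (MemLp.add hu hv)
    filter_upwards [Lp.coeFn_add u v] with x hx
    rw [hx, Pi.add_apply, Pi.add_apply, mul_add]
  smul_mem' := by
    intro c u hu
    refine (memLp_congr_ae ?_).mpr (MemLp.const_smul hu c)
    filter_upwards [Lp.coeFn_smul c u] with x hx
    rw [hx, Pi.smul_apply, Pi.smul_apply, smul_eq_mul, smul_eq_mul, mul_left_comm]

theorem memLp_mul {W : Space → ℝ} (u : mulDomain W) :
    MemLp (fun x => (W x : ℂ) * (u : L2C) x) 2 (volume : Measure Space) := u.2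

/-- The operator of multiplication by the real function `W` on `L²(ℝ³; ℂ)`, with its natural
domain. -/
def mulOp (W : Space → ℝ) : L2C →ₗ.[ℂ] L2C where
  domain := mulDomain W
  toFun :=
    { toFun := fun u => (memLp_mul u).toLp
      map_add' := by
        intro u v
        rw [← MemLp.toLp_add, MemLp.toLp_eq_toLp_iff]
        filter_upwards [Lp.coeFn_add (u : L2C) (v : L2C)] with x hx
        rw [Submodule.coe_add, hx, Pi.add_apply, Pi.add_apply, mul_add]
      map_smul' := by
        intro c u
        rw [RingHom.id_apply, ← MemLp.toLp_const_smul, MemLp.toLp_eq_toLp_iff]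
        filter_upwards [Lp.coeFn_smul c (u : L2C)] with x hx
        rw [Submodule.coe_smul, hx, Pi.smul_apply, Pi.smul_apply, smul_eq_mul, smul_eq_mul,
          mul_left_comm] }

/-- The Schrödinger operator `-Δ + W` on `L²(ℝ³; ℂ)`; its domain is `H²(ℝ³)` when `W` is
bounded. -/
def schrodinger (W : Space → ℝ) : L2C →ₗ.[ℂ] L2C := negLaplacian + mulOp W

/-! ### The linearized operator -/

/-- `L₊(E) = -Δ - E + V + 3 g ψ²`. -/
def Lplus (V : Space → ℝ) (g E : ℝ) (ψ : L2R) : L2C →ₗ.[ℂ] L2C :=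
  schrodinger fun x => -E + V x + 3 * g * (ψ x) ^ 2

/-- `L₋(E) = -Δ - E + V + g ψ²`. -/
def Lminus (V : Space → ℝ) (g E : ℝ) (ψ : L2R) : L2C →ₗ.[ℂ] L2C :=
  schrodinger fun x => -E + V x + g * (ψ x) ^ 2

/-- The diagonal operator `diag (A, B)` on `L² × L²`. -/
def diagOp (A B : L2C →ₗ.[ℂ] L2C) : (L2C × L2C) →ₗ.[ℂ] (L2C × L2C) where
  domain := A.domain.prod B.domain
  toFun :=
    { toFun := fun w => (A ⟨w.1.1, w.2.1⟩, B ⟨w.1.2, w.2.2⟩)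
      map_add' := by
        intro w z
        exact Prod.ext (A.map_add ⟨w.1.1, w.2.1⟩ ⟨z.1.1, z.2.1⟩)
          (B.map_add ⟨w.1.2, w.2.2⟩ ⟨z.1.2, z.2.2⟩)
      map_smul' := by
        intro c w
        exact Prod.ext (A.map_smul c ⟨w.1.1, w.2.1⟩) (B.map_smul c ⟨w.1.2, w.2.2⟩) }

/-- The symplectic matrix `J = (0 1; -1 0)` acting on `L² × L²`. -/
def J : (L2C × L2C) →ₗ[ℂ] (L2C × L2C) :=
  (LinearMap.snd ℂ L2C L2C).prod (-LinearMap.fst ℂ L2C L2C)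

/-- The linearized operator `L(E) = J H(E)`, `H(E) = diag (L₊(E), L₋(E))`, about the state `ψ`,
so that `L(E) (u, v) = (L₋ v, -L₊ u)`. -/
def linearizedOp (V : Space → ℝ) (g E : ℝ) (ψ : L2R) : (L2C × L2C) →ₗ.[ℂ] (L2C × L2C) :=
  J.compPMap (diagOp (Lplus V g E ψ) (Lminus V g E ψ))

/-! ### The linear ground state and the bifurcating branch -/

/-- `ψ₀` is a positive, `L²`-normalized eigenfunction of `-Δ + V` with eigenvalue `E₀`. -/
structure IsGroundState (V : Space → ℝ) (E₀ : ℝ) (ψ₀ : L2R) : Prop where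
  pos : ∀ᵐ x, 0 < ψ₀ x
  norm_eq_one : ‖ψ₀‖ = 1
  eigen : toC ψ₀ ∈ eigenspace (schrodinger V) (E₀ : ℂ)

/-- The amplitude `ρ(E) = |E₀ - E|^{1/2} (|g| ∫ ψ₀⁴)^{-1/2}`. -/
def amplitude (g E₀ : ℝ) (ψ₀ : L2R) (E : ℝ) : ℝ :=
  √|E₀ - E| * (√(|g| * ∫ x, (ψ₀ x) ^ 4))⁻¹

/-- `ψ` is a branch `E ↦ ψ_E` of positive bound states of
`(-Δ + V) ψ_E + g ψ_E³ = E ψ_E`, bifurcating from the zero solution at `E = E₀` in the direction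
of the linear ground state `ψ₀`, and defined for `0 < |E - E₀| ≤ δ₀` on the side `g (E - E₀) > 0`
(`E < E₀` for attractive `g < 0`, `E > E₀` for repulsive `g > 0`), with
`ψ_E = ρ(E) (ψ₀ + O(ρ(E)²))` in `H²`. -/
structure IsBranch (V : Space → ℝ) (g E₀ : ℝ) (ψ₀ : L2R) (δ₀ : ℝ) (ψ : ℝ → L2R) : Prop where
  zero : ψ E₀ = 0
  pos : ∀ E, 0 < g * (E - E₀) → |E - E₀| ≤ δ₀ → ∀ᵐ x, 0 < ψ E x
  solves : ∀ E, 0 < g * (E - E₀) → |E - E₀| ≤ δ₀ →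
    toC (ψ E) ∈ eigenspace (schrodinger fun x => V x + g * (ψ E x) ^ 2) (E : ℂ)
  expansion : ∃ C : ℝ, ∀ E, 0 < g * (E - E₀) → |E - E₀| ≤ δ₀ →
    sobolevNorm 2 (toC (ψ E - amplitude g E₀ ψ₀ E • ψ₀)) ≤
      ENNReal.ofReal (C * amplitude g E₀ ψ₀ E ^ 3)

end NLSGP

end

/-!
All operators are expressed through the free resolvent `resR 1 = (-Δ + 1)⁻¹`, whose range is `H²`:
the relation `HasSch W u f` says that `u ∈ H²` and `(-Δ + W) u = f`, and `schrodinger_iff`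
identifies it with the unbounded operator. Compactness of a potential relative to `-Δ`
(`isCompactOperator_mulL_comp_resC`) makes `-Δ + V - l`, `l < 0`, invertible up to its finite
dimensional kernel (`exists_reduced_resolvent`), and positivity of the heat kernel makes the
eigenvalue `E₀` simple (`eq_zero_of_inner_groundState`).

Write `t = E - E₀`. With `c = ∫ ψ₀⁴` the amplitude satisfies `g ρ² = t / c`, so in terms of
`φ = ψ_E / ρ` the nonlinear equation involves only `t`, not `√|t|`. Its solutions which stay within
a bounded multiple of `t` of `ψ₀`, as those of the given branch do, lie on one curve analytic at
`t = 0` (`exists_analytic_profile`, by the implicit function theorem). Hence `g ψ_E² = t φ² / c`, as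
a multiplication operator `F t`, extends to a family analytic at `t = 0` with `F 0 = 0`
(`exists_branch_family`).

The eigenvalue problem `L₊ ξ = b η`, `L₋ η = b ξ` is an analytic perturbation of
`diag (-Δ + V - E₀, -(-Δ + V - E₀))` in the variables `p = (ξ + η) / 2`, `q = (ξ - η) / 2`. The
unperturbed operator has the eigenvalue `E₁ - E₀` with eigenspace `ker (-Δ + V - E₁) × 0`, because
`2 E₀ - E₁ < E₀` is not an eigenvalue of `-Δ + V`. The eigenspace continues analytically to an
invariant subspace (`exists_analytic_invariant`, `exists_mode_frame`). The reduced operator is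
symmetric for the form `⟨p, p'⟩ - ⟨q, q'⟩`, which is positive definite on this subspace near
`t = 0`, so Rellich's theorem (`exists_analytic_eigenvectors`) gives eigenvectors continuous up to
`t = 0`. These are the modes (`exists_modes`). They are biorthogonal, `⟨ξ_m, η_n⟩ = δ_{mn}`, since
the form is `(⟨ξ, η'⟩ + ⟨η, ξ'⟩) / 2` and the two summands agree for eigenvectors with `b + b' ≠ 0`.
Their orthogonality to `ψ_E` and `∂_E ψ_E` follows from `L₋ ψ = 0` and `L₊ ∂_E ψ = ψ`
(`inner_mode_branch_eq_zero`).

The modes exhaust the spectrum near `± i (E₁ - E₀)`: each has a dual eigenfunctional, so it suffices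
that no eigenvector is annihilated by all of them (`eigenspace_eq_span_of_dual`); such a vector
would be small compared to itself (`exists_mode_bound`, `exists_spectral_accounting`). The case
`t = 0` gives the multiplicities at `E₀`. Finally the free resolvent gains two derivatives and `H^s`
is an algebra for `s ≥ 2` (`exists_sobolevNorm_mul_le`), so convergence in `H²` improves to
convergence in every `H^s` (`sobolevSmall_modes`).
-/

noncomputable section

namespace NLSGP

section

open FourierTransform

/-! ### The Fourier side -/

/-- Multiplication of a tempered distribution by `m`, tested on Schwartz functions, is pointwise
multiplication when both sides are `L²` functions. -/
theorem smulLeftCLM_toDist_iff {m : Space → ℂ} (hm : m.HasTemperateGrowth) (v h : L2C) :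
    smulLeftCLM ℂ m (toDist v) = toDist h ↔ h =ᵐ[volume] fun ξ => m ξ * v ξ := by
  constructor
  · intro H
    have hv : LocallyIntegrable (fun ξ => m ξ * v ξ) volume := by
      have h1 : LocallyIntegrable (v : Space → ℂ) volume :=
        (Lp.memLp v).locallyIntegrable (by norm_num)
      rw [← locallyIntegrableOn_univ] at h1 ⊢
      exact h1.continuousOn_mul hm.1.continuous.continuousOn isOpen_univ.isLocallyClosed
    have hh : LocallyIntegrable (h : Space → ℂ) volume :=
        (Lp.memLp h).locallyIntegrable (by norm_num)
    refine ae_eq_of_integral_contDiff_smul_eq hh hv ?_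
    intro g hg hgs
    have hgC : ContDiff ℝ ((⊤ : ℕ∞) : WithTop ℕ∞) (fun x => (g x : ℂ)) :=
      Complex.ofRealCLM.contDiff.comp hg
    have hgCs : HasCompactSupport (fun x => (g x : ℂ)) :=
      hgs.comp_left (g := fun x : ℝ => (x : ℂ)) (by simp)
    let G : 𝓢(Space, ℂ) := hgCs.toSchwartzMap hgC
    have H' := congrArg (fun T : 𝓢'(Space, ℂ) => T G) H
    simp only [smulLeftCLM_apply_apply, Lp.toTemperedDistribution_apply] at H'
    have e : ∀ x, G x = (g x : ℂ) := fun x => rfl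
    rw [show (∫ x, g x • h x) = ∫ x, G x • h x from by
      simp [e], ← H']
    refine integral_congr_ae (Eventually.of_forall fun x => ?_)
    simp only [SchwartzMap.smulLeftCLM_apply_apply hm, e, smul_eq_mul, Complex.real_smul]
    ring
  · intro H
    ext G
    simp only [smulLeftCLM_apply_apply, Lp.toTemperedDistribution_apply]
    refine integral_congr_ae ?_
    filter_upwards [H] with x hx
    simp only [SchwartzMap.smulLeftCLM_apply_apply hm, smul_eq_mul, hx]
    ring

/-- A Fourier multiplier acts on `L²` functions by multiplication of the `L²` Fourier transform. -/
theorem fourierMultiplier_toDist_iff {m : Space → ℂ} (hm : m.HasTemperateGrowth) (u f : L2C) :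
    TemperedDistribution.fourierMultiplierCLM ℂ m (toDist u) = toDist f ↔
      (𝓕 f : L2C) =ᵐ[volume] fun ξ => m ξ * (𝓕 u : L2C) ξ := by
  rw [← smulLeftCLM_toDist_iff hm, TemperedDistribution.fourierMultiplierCLM_apply]
  change _ ↔ smulLeftCLM ℂ m (Lp.toTemperedDistribution _) = Lp.toTemperedDistribution _
  rw [← Lp.fourier_toTemperedDistribution_eq, ← Lp.fourier_toTemperedDistribution_eq]
  constructor
  · intro H
    have H' := congrArg 𝓕 H
    rw [fourier_fourierInv_eq] at H'
    exact H'
  · intro H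
    rw [H, fourierInv_fourier_eq]

/-- The Fourier weight `(1 + |ξ|²)^{s/2}`. -/
def weight (s : ℝ) (ξ : Space) : ℝ := (1 + ‖ξ‖ ^ 2) ^ (s / 2)

theorem weight_pos (s : ℝ) (ξ : Space) : 0 < weight s ξ := by unfold weight; positivity

theorem weight_mono {s t : ℝ} (h : s ≤ t) (ξ : Space) : weight s ξ ≤ weight t ξ :=
  Real.rpow_le_rpow_of_exponent_le (by nlinarith [sq_nonneg ‖ξ‖]) (by linarith)

theorem continuous_weight (s : ℝ) : Continuous (weight s) := by
  unfold weight
  refine Continuous.rpow_const (by fun_prop) fun x => Or.inl (by positivity)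

theorem weight_add (s t : ℝ) (ξ : Space) : weight (s + t) ξ = weight s ξ * weight t ξ := by
  unfold weight
  rw [← Real.rpow_add (by positivity)]; ring_nf

theorem weight_zero (ξ : Space) : weight 0 ξ = 1 := by simp [weight]

theorem weight_two (ξ : Space) : weight 2 ξ = 1 + ‖ξ‖ ^ 2 := by simp [weight]

theorem weight_hasTemperateGrowth (s : ℝ) :
    (fun ξ : Space => ((weight s ξ : ℝ) : ℂ)).HasTemperateGrowth := by
  unfold weight; fun_prop

theorem besselPotential_toDist_iff (s : ℝ) (u f : L2C) :
    besselPotential Space ℂ s (toDist u) = toDist f ↔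
      (𝓕 f : L2C) =ᵐ[volume] fun ξ => (weight s ξ : ℂ) * (𝓕 u : L2C) ξ :=
  fourierMultiplier_toDist_iff (weight_hasTemperateGrowth s) u f

/-- The `H^s` norm on the Fourier side. -/
theorem sobolevNorm_eq (s : ℝ) (u : L2C) :
    sobolevNorm s u = eLpNorm (fun ξ => (weight s ξ : ℂ) * (𝓕 u : L2C) ξ) 2 volume := by
  have hmeas : AEStronglyMeasurable (fun ξ => (weight s ξ : ℂ) * (𝓕 u : L2C) ξ) volume :=
    (Complex.continuous_ofReal.comp (continuous_weight s)).aestronglyMeasurable.mul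
      (Lp.aestronglyMeasurable _)
  unfold sobolevNorm
  simp only [besselPotential_toDist_iff]
  refine le_antisymm ?_ ?_
  · by_cases h : eLpNorm (fun ξ => (weight s ξ : ℂ) * (𝓕 u : L2C) ξ) 2 volume = ⊤
    · rw [h]; exact le_top
    · have hm : MemLp (fun ξ => (weight s ξ : ℂ) * (𝓕 u : L2C) ξ) 2 volume :=
        ⟨hmeas, lt_top_iff_ne_top.2 h⟩
      refine iInf₂_le_of_le (𝓕⁻ hm.toLp) ?_ ?_
      · rw [fourier_fourierInv_eq]; exact hm.coeFn_toLp
      · have h1 : ‖(𝓕⁻ hm.toLp : L2C)‖ = ‖hm.toLp‖ := by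
          rw [← Lp.norm_fourier_eq, fourier_fourierInv_eq]
        rw [← ofReal_norm, h1, ofReal_norm, Lp.enorm_toLp]
  · refine le_iInf₂ fun f hf => ?_
    rw [← eLpNorm_congr_ae hf, ← Lp.enorm_def, ← ofReal_norm, Lp.norm_fourier_eq, ofReal_norm]

/-- `u ∈ H²` means that `(1 + |ξ|²) û` is square integrable. -/
theorem mem_H2_iff (u : L2C) :
    u ∈ H2 ↔ MemLp (fun ξ => (weight 2 ξ : ℂ) * (𝓕 u : L2C) ξ) 2 volume := by
  change (∃ f' : L2C, _ = toDist f') ↔ _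
  simp only [besselPotential_toDist_iff]
  constructor
  · rintro ⟨f, hf⟩
    exact (memLp_congr_ae hf).1 (Lp.memLp _)
  · intro hm
    refine ⟨𝓕⁻ hm.toLp, ?_⟩
    rw [fourier_fourierInv_eq]; exact hm.coeFn_toLp

/-- On its domain, `-Δ` is multiplication by `4π²|ξ|²` on the Fourier side. -/
theorem negLaplacian_eq_iff (u : negLaplacian.domain) (f : L2C) :
    negLaplacian u = f ↔
      (𝓕 f : L2C) =ᵐ[volume]
        fun ξ => (((2 * Real.pi) ^ 2 * ‖ξ‖ ^ 2 : ℝ) : ℂ) * (𝓕 (u : L2C) : L2C) ξ := by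
  have hs := (exists_laplacian u).choose_spec
  have hgr : (fun ξ : Space => (((2 * Real.pi) ^ 2 * ‖ξ‖ ^ 2 : ℝ) : ℂ)).HasTemperateGrowth := by
    fun_prop
  have hgr' : (fun ξ : Space => ((‖ξ‖ ^ 2 : ℝ) : ℂ)).HasTemperateGrowth := by
    fun_prop
  have key : -Δ (toDist (u : L2C)) = TemperedDistribution.fourierMultiplierCLM ℂ
      (fun ξ : Space => (((2 * Real.pi) ^ 2 * ‖ξ‖ ^ 2 : ℝ) : ℂ)) (toDist (u : L2C)) := by
    rw [TemperedDistribution.laplacian_eq_fourierMultiplierCLM, neg_smul, neg_neg]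
    have : (fun ξ : Space => (((2 * Real.pi) ^ 2 * ‖ξ‖ ^ 2 : ℝ) : ℂ)) =
        (((2 * Real.pi) ^ 2 : ℝ) : ℂ) • fun ξ : Space => ((‖ξ‖ ^ 2 : ℝ) : ℂ) := by
      ext ξ; simp
    rw [this, TemperedDistribution.fourierMultiplierCLM_smul hgr']
    simp only [smul_apply]
    rw [Complex.coe_smul]
  change (exists_laplacian u).choose = f ↔ _
  rw [← fourierMultiplier_toDist_iff hgr]
  constructor
  · intro h
    rw [← key, ← h]; exact hs.symm
  · intro h
    exact toDist_injective (hs.trans (key.trans h))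

end

section

open FourierTransform

/-! ### Multiplication by bounded functions -/

/-- Multiplication of `L²` functions by `L^∞` functions. -/
def mulL (𝕜 : Type*) [RCLike 𝕜] : Lp 𝕜 ∞ (volume : Measure Space) →L[𝕜]
    Lp 𝕜 2 (volume : Measure Space) →L[𝕜] Lp 𝕜 2 (volume : Measure Space) :=
  (ContinuousLinearMap.mul 𝕜 𝕜).holderL volume ∞ 2 2

theorem coeFn_mulL {𝕜 : Type*} [RCLike 𝕜] (m : Lp 𝕜 ∞ (volume : Measure Space))
    (f : Lp 𝕜 2 (volume : Measure Space)) :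
    mulL 𝕜 m f =ᵐ[volume] fun x => m x * f x :=
  ContinuousLinearMap.coeFn_holder (ContinuousLinearMap.mul 𝕜 𝕜) m f

/-! ### The free resolvent -/

/-- The symbol `(κ + 4π²|ξ|²)⁻¹` of the resolvent `(-Δ + κ)⁻¹`. -/
def resSymbol (κ : ℝ) (ξ : Space) : ℝ := (κ + (2 * Real.pi) ^ 2 * ‖ξ‖ ^ 2)⁻¹

theorem resSymbol_pos {κ : ℝ} (hκ : 0 < κ) (ξ : Space) : 0 < resSymbol κ ξ := by
  unfold resSymbol; positivity

theorem resSymbol_le {κ : ℝ} (hκ : 0 < κ) (ξ : Space) : resSymbol κ ξ ≤ κ⁻¹ := by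
  unfold resSymbol
  gcongr
  nlinarith [sq_nonneg (2 * Real.pi * ‖ξ‖)]

theorem continuous_resSymbol {κ : ℝ} (hκ : 0 < κ) : Continuous (resSymbol κ) := by
  unfold resSymbol
  refine Continuous.inv₀ (by fun_prop) fun ξ => by positivity

theorem resSymbol_le_weight {κ : ℝ} (hκ : 0 < κ) (ξ : Space) :
    resSymbol κ ξ ≤ max κ⁻¹ 1 * weight (-2) ξ := by
  have h1 : weight (-2) ξ = (1 + ‖ξ‖ ^ 2)⁻¹ := by
    simp [weight, Real.rpow_neg_one]
  have h2 : 1 + ‖ξ‖ ^ 2 ≤ max κ⁻¹ 1 * (κ + (2 * Real.pi) ^ 2 * ‖ξ‖ ^ 2) := by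
    have a1 : 1 ≤ max κ⁻¹ 1 * κ := by
      calc (1 : ℝ) = κ⁻¹ * κ := by field_simp
        _ ≤ _ := by gcongr; exact le_max_left _ _
    have a2 : 1 * ‖ξ‖ ^ 2 ≤ max κ⁻¹ 1 * ((2 * Real.pi) ^ 2 * ‖ξ‖ ^ 2) := by
      have : (1 : ℝ) ≤ (2 * Real.pi) ^ 2 := by nlinarith [Real.pi_gt_three]
      calc 1 * ‖ξ‖ ^ 2 ≤ 1 * ((2 * Real.pi) ^ 2 * ‖ξ‖ ^ 2) := by nlinarith [sq_nonneg ‖ξ‖]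
        _ ≤ _ := by gcongr; exact le_max_right _ _
    nlinarith
  rw [h1]; unfold resSymbol
  have p1 : 0 < κ + (2 * Real.pi) ^ 2 * ‖ξ‖ ^ 2 := by positivity
  rw [inv_le_iff_one_le_mul₀ p1, mul_assoc, mul_comm (1 + ‖ξ‖ ^ 2)⁻¹, ← mul_assoc,
    ← div_eq_mul_inv, le_div_iff₀ (by positivity)]
  linarith

theorem memLp_resSymbol_top {κ : ℝ} (hκ : 0 < κ) :
    MemLp (fun ξ => (resSymbol κ ξ : ℂ)) ∞ (volume : Measure Space) := by
  refine memLp_top_of_bound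
    (Complex.continuous_ofReal.comp (continuous_resSymbol hκ)).aestronglyMeasurable κ⁻¹
    (Eventually.of_forall fun ξ => ?_)
  rw [Complex.norm_real, Real.norm_of_nonneg (resSymbol_pos hκ ξ).le]
  exact resSymbol_le hκ ξ

/-- The weight `(1 + |ξ|²)⁻¹` is square integrable in dimension three. -/
theorem memLp_weight_neg_two :
    MemLp (weight (-2)) 2 (volume : Measure Space) := by
  refine (memLp_two_iff_integrable_sq (continuous_weight _).aestronglyMeasurable).2 ?_
  have h := integrable_rpow_neg_one_add_norm_sq (E := Space) (μ := volume) (r := 4)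
    (by simp; norm_num)
  refine h.congr (Eventually.of_forall fun ξ => ?_)
  simp only [weight]
  rw [← Real.rpow_mul_natCast (by positivity)]
  norm_num

theorem memLp_resSymbol_two {κ : ℝ} (hκ : 0 < κ) :
    MemLp (fun ξ => (resSymbol κ ξ : ℂ)) 2 (volume : Measure Space) := by
  refine (memLp_weight_neg_two.const_mul (max κ⁻¹ 1)).mono
    (Complex.continuous_ofReal.comp (continuous_resSymbol hκ)).aestronglyMeasurable
    (Eventually.of_forall fun ξ => ?_)
  rw [Complex.norm_real, Real.norm_of_nonneg (resSymbol_pos hκ ξ).le]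
  exact (resSymbol_le_weight hκ ξ).trans (le_abs_self _)

/-- The free resolvent `(-Δ + κ)⁻¹`, `κ > 0`, on `L²(ℝ³; ℂ)`. -/
def resC (κ : ℝ) (hκ : 0 < κ) : L2C →L[ℂ] L2C :=
  ((Lp.fourierTransformₗᵢ Space ℂ).symm.toContinuousLinearEquiv : L2C →L[ℂ] L2C) ∘L
    (mulL ℂ (memLp_resSymbol_top hκ).toLp) ∘L
    ((Lp.fourierTransformₗᵢ Space ℂ).toContinuousLinearEquiv : L2C →L[ℂ] L2C)

theorem fourier_resC {κ : ℝ} (hκ : 0 < κ) (f : L2C) :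
    (𝓕 (resC κ hκ f) : L2C) =ᵐ[volume] fun ξ => (resSymbol κ ξ : ℂ) * (𝓕 f : L2C) ξ := by
  have h : (𝓕 (resC κ hκ f) : L2C) = mulL ℂ (memLp_resSymbol_top hκ).toLp (𝓕 f) :=
    fourier_fourierInv_eq (E := L2C) _
  rw [h]
  filter_upwards [coeFn_mulL (memLp_resSymbol_top hκ).toLp (𝓕 f),
    (memLp_resSymbol_top hκ).coeFn_toLp] with ξ h1 h2
  rw [h1, h2]

theorem fourier_ext {u v : L2C} (h : (𝓕 u : L2C) =ᵐ[volume] (𝓕 v : L2C)) : u = v :=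
  (Lp.fourierTransformₗᵢ Space ℂ).injective (Lp.ext h)

theorem coeFn_fourier_sub (u v : L2C) :
    (𝓕 (u - v) : L2C) =ᵐ[volume] fun ξ => (𝓕 u : L2C) ξ - (𝓕 v : L2C) ξ := by
  have : (𝓕 (u - v) : L2C) = 𝓕 u - 𝓕 v := map_sub (Lp.fourierTransformₗᵢ Space ℂ) u v
  rw [this]; exact Lp.coeFn_sub _ _

theorem coeFn_fourier_smul (c : ℂ) (u : L2C) :
    (𝓕 (c • u) : L2C) =ᵐ[volume] fun ξ => c * (𝓕 u : L2C) ξ := by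
  have : (𝓕 (c • u) : L2C) = c • 𝓕 u := map_smul (Lp.fourierTransformₗᵢ Space ℂ) c u
  rw [this]; exact Lp.coeFn_smul _ _

theorem coeFn_fourier_add (u v : L2C) :
    (𝓕 (u + v) : L2C) =ᵐ[volume] fun ξ => (𝓕 u : L2C) ξ + (𝓕 v : L2C) ξ := by
  have : (𝓕 (u + v) : L2C) = 𝓕 u + 𝓕 v := map_add (Lp.fourierTransformₗᵢ Space ℂ) u v
  rw [this]; exact Lp.coeFn_add _ _

theorem resC_mem_H2 {κ : ℝ} (hκ : 0 < κ) (f : L2C) : resC κ hκ f ∈ H2 := by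
  rw [mem_H2_iff]
  have hb : MemLp (fun ξ => ((weight 2 ξ * resSymbol κ ξ : ℝ) : ℂ)) ∞
      (volume : Measure Space) := by
    refine memLp_top_of_bound (Complex.continuous_ofReal.comp ((continuous_weight 2).mul
      (continuous_resSymbol hκ))).aestronglyMeasurable (max κ⁻¹ 1)
      (Eventually.of_forall fun ξ => ?_)
    rw [Complex.norm_real, Real.norm_of_nonneg
      (mul_pos (weight_pos _ _) (resSymbol_pos hκ ξ)).le]
    have h := mul_le_mul_of_nonneg_left (resSymbol_le_weight hκ ξ) (weight_pos 2 ξ).le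
    have e : weight 2 ξ * weight (-2) ξ = 1 := by
      rw [← weight_add]; simp [weight_zero]
    calc _ ≤ _ := h
      _ = max κ⁻¹ 1 * (weight 2 ξ * weight (-2) ξ) := by ring
      _ = _ := by rw [e, mul_one]
  refine (memLp_congr_ae ?_).1 (Lp.memLp (mulL ℂ hb.toLp (𝓕 f)))
  filter_upwards [coeFn_mulL hb.toLp (𝓕 f), hb.coeFn_toLp, fourier_resC hκ f] with ξ h1 h2 h3
  rw [h1, h2, h3]; push_cast; ring

theorem negLaplacian_resC {κ : ℝ} (hκ : 0 < κ) (f : L2C) (h : resC κ hκ f ∈ negLaplacian.domain) :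
    negLaplacian ⟨resC κ hκ f, h⟩ = f - (κ : ℂ) • resC κ hκ f := by
  rw [negLaplacian_eq_iff]
  filter_upwards [coeFn_fourier_sub f ((κ : ℂ) • resC κ hκ f),
    coeFn_fourier_smul (κ : ℂ) (resC κ hκ f), fourier_resC hκ f] with ξ h1 h2 h3
  rw [h1, h2, h3]
  have : (κ + (2 * Real.pi) ^ 2 * ‖ξ‖ ^ 2 : ℝ) * resSymbol κ ξ = 1 := by
    unfold resSymbol
    exact mul_inv_cancel₀ (by positivity)
  have h' := congrArg (fun r : ℝ => (r : ℂ)) this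
  push_cast at h' ⊢
  linear_combination (-(𝓕 f : L2C) ξ) * h'

theorem resC_negLaplacian {κ : ℝ} (hκ : 0 < κ) (u : negLaplacian.domain) :
    resC κ hκ (negLaplacian u + (κ : ℂ) • (u : L2C)) = u := by
  apply fourier_ext
  have h0 := (negLaplacian_eq_iff u _).1 rfl
  filter_upwards [fourier_resC hκ (negLaplacian u + (κ : ℂ) • (u : L2C)),
    coeFn_fourier_add (negLaplacian u) ((κ : ℂ) • (u : L2C)),
    coeFn_fourier_smul (κ : ℂ) (u : L2C), h0] with ξ h1 h2 h3 h4
  rw [h1, h2, h3, h4]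
  have : (κ + (2 * Real.pi) ^ 2 * ‖ξ‖ ^ 2 : ℝ) * resSymbol κ ξ = 1 := by
    unfold resSymbol
    exact mul_inv_cancel₀ (by positivity)
  have h' := congrArg (fun r : ℝ => (r : ℂ)) this
  push_cast at h' ⊢
  linear_combination ((𝓕 (u : L2C) : L2C) ξ) * h'

theorem inner_resC {κ : ℝ} (hκ : 0 < κ) (f g : L2C) :
    inner ℂ f (resC κ hκ g) =
      ∫ ξ, (resSymbol κ ξ : ℂ) * ((starRingEnd ℂ) ((𝓕 f : L2C) ξ) * (𝓕 g : L2C) ξ) := by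
  rw [← Lp.inner_fourier_eq, L2.inner_def]
  refine integral_congr_ae ?_
  filter_upwards [fourier_resC hκ g] with ξ h
  rw [h]
  simp only [RCLike.inner_apply]
  ring

theorem resC_symm {κ : ℝ} (hκ : 0 < κ) (f g : L2C) :
    inner ℂ (resC κ hκ f) g = inner ℂ f (resC κ hκ g) := by
  rw [inner_resC, ← inner_conj_symm, inner_resC, ← integral_conj]
  refine integral_congr_ae (Eventually.of_forall fun ξ => ?_)
  simp only [map_mul, Complex.conj_ofReal, Complex.conj_conj]
  ring

end

section

open FourierTransform

/-! ### Integrable Fourier transforms and the embedding `H² ⊂ L^∞` -/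

/-- Schwartz functions separate locally integrable functions. -/
theorem ae_eq_of_forall_schwartz {a b : Space → ℂ} (ha : LocallyIntegrable a volume)
    (hb : LocallyIntegrable b volume)
    (h : ∀ G : 𝓢(Space, ℂ), ∫ x, G x * a x = ∫ x, G x * b x) : a =ᵐ[volume] b := by
  refine ae_eq_of_integral_contDiff_smul_eq ha hb ?_
  intro g hg hgs
  have hgC : ContDiff ℝ ((⊤ : ℕ∞) : WithTop ℕ∞) (fun x => (g x : ℂ)) :=
    Complex.ofRealCLM.contDiff.comp hg
  have hgCs : HasCompactSupport (fun x => (g x : ℂ)) :=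
    hgs.comp_left (g := fun x : ℝ => (x : ℂ)) (by simp)
  have := h (hgCs.toSchwartzMap hgC)
  simpa using! this

theorem continuous_fourierInv_of_integrable {h : Space → ℂ} (hi : Integrable h) :
    Continuous (𝓕⁻ h : Space → ℂ) := by
  have e : (𝓕⁻ h : Space → ℂ) = fun x => 𝓕 h (-x) := by
    ext x; exact Real.fourierInv_eq_fourier_neg h x
  rw [e]
  exact (VectorFourier.fourierIntegral_continuous Real.continuous_fourierChar
    (by exact continuous_inner) hi).comp continuous_neg

theorem norm_fourierInv_le (h : Space → ℂ) (x : Space) : ‖𝓕⁻ h x‖ ≤ ∫ ξ, ‖h ξ‖ := by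
  rw [Real.fourierInv_eq_fourier_neg]
  exact VectorFourier.norm_fourierIntegral_le_integral_norm _ _ _ _ _

/-- On `L¹ ∩ L²` the inverse Fourier transform is given by the integral. -/
theorem coeFn_fourierInv_of_integrable (h : L2C) (hi : Integrable (h : Space → ℂ)) :
    (𝓕⁻ h : L2C) =ᵐ[volume] (𝓕⁻ (h : Space → ℂ) : Space → ℂ) := by
  refine ae_eq_of_forall_schwartz ((Lp.memLp _).locallyIntegrable (by norm_num))
    (continuous_fourierInv_of_integrable hi).locallyIntegrable fun G => ?_
  have h1 : (𝓕⁻ (toDist h)) G = toDist (𝓕⁻ h) G := by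
    exact congrArg (fun T : 𝓢'(Space, ℂ) => T G) (Lp.fourierInv_toTemperedDistribution_eq h)
  rw [TemperedDistribution.fourierInv_apply] at h1
  simp only [Lp.toTemperedDistribution_apply, smul_eq_mul] at h1
  rw [← h1]
  have h2 := VectorFourier.integral_fourierIntegral_smul_eq_flip (L := innerₗ Space)
    (μ := volume) (ν := volume) (f := fun x => G (-x)) (g := (h : Space → ℂ))
    Real.continuous_fourierChar continuous_inner
    G.integrable.comp_neg hi
  have e1 : ∀ ξ, VectorFourier.fourierIntegral Real.fourierChar volume (innerₗ Space)
      (fun x => G (-x)) ξ = 𝓕⁻ G ξ := by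
    intro ξ
    rw [SchwartzMap.fourierInv_coe, Real.fourierInv_eq_fourier_comp_neg]
    rfl
  simp only [e1, smul_eq_mul, flip_innerₗ] at h2
  rw [h2, ← integral_neg_eq_self (fun x => G x * 𝓕⁻ (h : Space → ℂ) x)]
  refine integral_congr_ae (Eventually.of_forall fun x => ?_)
  simp only
  rw [Real.fourierInv_eq_fourier_neg, neg_neg]
  rfl

/-- On `L¹ ∩ L²` the Fourier transform is given by the integral. -/
theorem coeFn_fourier_of_integrable (h : L2C) (hi : Integrable (h : Space → ℂ)) :
    (𝓕 h : L2C) =ᵐ[volume] (𝓕 (h : Space → ℂ) : Space → ℂ) := by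
  have hc : Continuous (𝓕 (h : Space → ℂ) : Space → ℂ) :=
    (VectorFourier.fourierIntegral_continuous Real.continuous_fourierChar
      (by exact continuous_inner) hi)
  refine ae_eq_of_forall_schwartz ((Lp.memLp _).locallyIntegrable (by norm_num))
    hc.locallyIntegrable fun G => ?_
  have h1 : (𝓕 (toDist h)) G = toDist (𝓕 h) G := by
    exact congrArg (fun T : 𝓢'(Space, ℂ) => T G) (Lp.fourier_toTemperedDistribution_eq h)
  rw [TemperedDistribution.fourier_apply] at h1
  simp only [Lp.toTemperedDistribution_apply, smul_eq_mul] at h1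
  rw [← h1]
  have h2 := VectorFourier.integral_fourierIntegral_smul_eq_flip (L := innerₗ Space)
    (μ := volume) (ν := volume) (f := fun x => G x) (g := (h : Space → ℂ))
    Real.continuous_fourierChar continuous_inner
    G.integrable hi
  simp only [smul_eq_mul, flip_innerₗ] at h2
  exact h2

/-- A product of two square integrable functions: the resolvent symbol is one of them because the
dimension is three. -/
theorem integrable_fourier_resC {κ : ℝ} (hκ : 0 < κ) (f : L2C) :
    Integrable (𝓕 (resC κ hκ f) : L2C) := by
  refine Integrable.congr ?_ (fourier_resC hκ f).symm
  exact (memLp_resSymbol_two hκ).integrable_mul (Lp.memLp _)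

theorem integral_norm_fourier_resC_le {κ : ℝ} (hκ : 0 < κ) (f : L2C) :
    ∫ ξ, ‖(𝓕 (resC κ hκ f) : L2C) ξ‖ ≤ ‖((memLp_resSymbol_two hκ).toLp : L2C)‖ * ‖f‖ := by
  have h1 : ∫ ξ, ‖(𝓕 (resC κ hκ f) : L2C) ξ‖ =
      ∫ ξ, ‖((memLp_resSymbol_two hκ).toLp : L2C) ξ‖ * ‖(𝓕 f : L2C) ξ‖ := by
    refine integral_congr_ae ?_
    filter_upwards [fourier_resC hκ f, (memLp_resSymbol_two hκ).coeFn_toLp] with ξ h2 h3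
    rw [h2, h3, norm_mul]
  rw [h1, ← Lp.norm_fourier_eq f]
  have h4 := integral_mul_norm_le_Lp_mul_Lq (μ := (volume : Measure Space))
    (f := ((memLp_resSymbol_two hκ).toLp : L2C))
    (g := (𝓕 f : L2C)) (p := 2) (q := 2) Real.HolderConjugate.two_two
    (by simpa using Lp.memLp _) (by simpa using Lp.memLp _)
  refine h4.trans (le_of_eq ?_)
  have h5 : ∀ u : L2C, (∫ a, ‖u a‖ ^ (2:ℝ)) ^ ((1:ℝ) / 2) = ‖u‖ := by
    intro u
    rw [Lp.norm_def, (Lp.memLp u).eLpNorm_eq_integral_rpow_norm (by norm_num) (by norm_num),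
      ENNReal.toReal_ofReal (by positivity)]
    norm_num
  rw [h5, h5]

/-- The continuous representative of `(-Δ + κ)⁻¹ f`. -/
theorem coeFn_resC {κ : ℝ} (hκ : 0 < κ) (f : L2C) :
    resC κ hκ f =ᵐ[volume] (𝓕⁻ (⇑(𝓕 (resC κ hκ f) : L2C)) : Space → ℂ) := by
  have h := coeFn_fourierInv_of_integrable _ (integrable_fourier_resC hκ f)
  rwa [fourierInv_fourier_eq] at h

theorem norm_resC_apply_le {κ : ℝ} (hκ : 0 < κ) (f : L2C) :
    ∀ᵐ x, ‖resC κ hκ f x‖ ≤ ‖((memLp_resSymbol_two hκ).toLp : L2C)‖ * ‖f‖ := by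
  filter_upwards [coeFn_resC hκ f] with x hx
  rw [hx]
  exact (norm_fourierInv_le _ _).trans (integral_norm_fourier_resC_le hκ f)

end

section

open FourierTransform

/-! ### Relative compactness of the potential -/

theorem _root_.ContinuousLinearMap.add_compLp_right {E F : Type*} [NormedAddCommGroup E]
    [NormedSpace ℂ E] [NormedAddCommGroup F] [NormedSpace ℂ F] (T : E →L[ℂ] F)
    (k k' : Lp E 2 (volume : Measure Space)) :
    T.compLp (k + k') = T.compLp k + T.compLp k' :=
  map_add (T.compLpₗ 2 volume) k k'

theorem _root_.ContinuousLinearMap.smul_compLp_right {E F : Type*} [NormedAddCommGroup E]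
    [NormedSpace ℂ E] [NormedAddCommGroup F] [NormedSpace ℂ F] (T : E →L[ℂ] F)
    (c : ℂ) (k : Lp E 2 (volume : Measure Space)) :
    T.compLp (c • k) = c • T.compLp k :=
  map_smul (T.compLpₗ 2 volume) c k

/-- The operator with square integrable kernel `k : ℝ³ → (L²)'`, mapping `f` to `x ↦ k x f`. -/
def kernelOp : Lp (L2C →L[ℂ] ℂ) 2 (volume : Measure Space) →L[ℂ] L2C →L[ℂ] L2C :=
  LinearMap.mkContinuous₂
    (LinearMap.mk₂ ℂ (fun k f => (ContinuousLinearMap.apply ℂ ℂ f).compLp k)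
      (fun k k' f => (ContinuousLinearMap.apply ℂ ℂ f).add_compLp_right k k')
      (fun c k f => (ContinuousLinearMap.apply ℂ ℂ f).smul_compLp_right c k)
      (fun k f f' => by rw [map_add]; exact ContinuousLinearMap.add_compLp _ _ _)
      (fun c k f => by rw [map_smul]; exact ContinuousLinearMap.smul_compLp _ _ _)) 1 (by
    intro k f
    simp only [LinearMap.mk₂_apply, one_mul]
    rw [mul_comm]
    refine (ContinuousLinearMap.norm_compLp_le _ _).trans ?_
    gcongr
    refine ContinuousLinearMap.opNorm_le_bound _ (norm_nonneg _) fun T => ?_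
    rw [ContinuousLinearMap.apply_apply, mul_comm]
    exact T.le_opNorm f)

theorem coeFn_kernelOp (k : Lp (L2C →L[ℂ] ℂ) 2 (volume : Measure Space)) (f : L2C) :
    kernelOp k f =ᵐ[volume] fun x => k x f :=
  ContinuousLinearMap.coeFn_compLp (ContinuousLinearMap.apply ℂ ℂ f) k

/-- A Hilbert–Schmidt operator is compact: simple kernels give operators of finite rank, and compact
operators form a closed set. -/
theorem isCompactOperator_kernelOp (k : Lp (L2C →L[ℂ] ℂ) 2 (volume : Measure Space)) :
    IsCompactOperator (kernelOp k) := by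
  induction k using Lp.induction (p := 2) ENNReal.ofNat_ne_top with
  | indicatorConst c hs hμs =>
    rename_i s
    have h1 : ∀ f, kernelOp (indicatorConstLp 2 hs hμs.ne c) f =
        (ContinuousLinearMap.toSpanSingleton ℂ (indicatorConstLp 2 hs hμs.ne (1 : ℂ))) (c f) := by
      intro f
      apply Lp.ext
      filter_upwards [coeFn_kernelOp (indicatorConstLp 2 hs hμs.ne c) f,
        indicatorConstLp_coeFn (p := 2) (hs := hs) (hμs := hμs.ne) (c := c),
        indicatorConstLp_coeFn (p := 2) (hs := hs) (hμs := hμs.ne) (c := (1 : ℂ)),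
        Lp.coeFn_smul (c f) (indicatorConstLp 2 hs hμs.ne (1 : ℂ))] with x h1 h2 h3 h4
      rw [h1, h2, ContinuousLinearMap.toSpanSingleton_apply, h4, Pi.smul_apply, h3]
      by_cases hx : x ∈ s <;> simp [hx]
    have h2 : (⇑(kernelOp (Lp.simpleFunc.indicatorConst 2 hs hμs.ne c : Lp _ 2 _)) :
        L2C → L2C) = (ContinuousLinearMap.toSpanSingleton ℂ
          (indicatorConstLp 2 hs hμs.ne (1 : ℂ))) ∘ c := by
      ext1 f
      rw [Lp.simpleFunc.coe_indicatorConst]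
      exact h1 f
    rw [h2]
    exact (isCompactOperator_of_locallyCompactSpace_dom c).clm_comp _
  | add hf hg _ h1 h2 =>
    rw [map_add]
    exact h1.add h2
  | isClosed =>
    exact isClosed_setOfPred_isCompactOperator.preimage (kernelOp).continuous

/-- The function `ξ ↦ e^{-2πi⟨x,ξ⟩} (κ + 4π²|ξ|²)⁻¹`. -/
def resWave (κ : ℝ) (x ξ : Space) : ℂ := Real.fourierChar (-inner ℝ ξ x) * (resSymbol κ ξ : ℂ)

theorem continuous_resWave_right {κ : ℝ} (hκ : 0 < κ) (x : Space) : Continuous (resWave κ x) := by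
  unfold resWave
  refine Continuous.mul ?_ ?_
  · exact continuous_subtype_val.comp (Real.continuous_fourierChar.comp (by fun_prop))
  · exact Complex.continuous_ofReal.comp (continuous_resSymbol hκ)

theorem continuous_resWave_left (κ : ℝ) (ξ : Space) : Continuous fun x => resWave κ x ξ := by
  unfold resWave
  refine Continuous.mul ?_ continuous_const
  exact continuous_subtype_val.comp (Real.continuous_fourierChar.comp (by fun_prop))

theorem norm_resWave {κ : ℝ} (hκ : 0 < κ) (x ξ : Space) : ‖resWave κ x ξ‖ = resSymbol κ ξ := by
  unfold resWave
  rw [norm_mul, Circle.norm_coe, one_mul, Complex.norm_real,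
    Real.norm_of_nonneg (resSymbol_pos hκ ξ).le]

theorem memLp_resWave {κ : ℝ} (hκ : 0 < κ) (x : Space) : MemLp (resWave κ x) 2 volume := by
  refine (memLp_resSymbol_two hκ).mono
    (continuous_resWave_right hκ x).aestronglyMeasurable
    (Eventually.of_forall fun ξ => ?_)
  rw [norm_resWave hκ, Complex.norm_real, Real.norm_of_nonneg (resSymbol_pos hκ ξ).le]

theorem continuous_toLp_resWave {κ : ℝ} (hκ : 0 < κ) :
    Continuous fun x => ((memLp_resWave hκ x).toLp : L2C) := by
  rw [continuous_iff_continuousAt]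
  intro x₀
  refine (Lp.tendsto_Lp_iff_tendsto_eLpNorm'' _ (fun x => memLp_resWave hκ x) _
    (memLp_resWave hκ x₀)).2 ?_
  have key : Tendsto (fun x => ∫⁻ ξ, ‖resWave κ x ξ - resWave κ x₀ ξ‖ₑ ^ (2 : ℝ)) (𝓝 x₀)
      (𝓝 (∫⁻ _ : Space, 0)) := by
    refine tendsto_lintegral_filter_of_dominated_convergence
      (fun ξ => ‖(2 : ℝ) * resSymbol κ ξ‖ₑ ^ (2 : ℝ)) ?_ ?_ ?_ ?_
    · refine Eventually.of_forall fun x => ?_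
      have : Continuous fun ξ => resWave κ x ξ - resWave κ x₀ ξ :=
        (continuous_resWave_right hκ x).sub (continuous_resWave_right hκ x₀)
      exact ((ENNReal.continuous_rpow_const).comp this.enorm).measurable
    · refine Eventually.of_forall fun x => Eventually.of_forall fun ξ => ?_
      gcongr
      rw [enorm_le_iff_norm_le]
      refine (norm_sub_le _ _).trans ?_
      rw [norm_resWave hκ, norm_resWave hκ, Real.norm_of_nonneg
        (mul_nonneg zero_le_two (resSymbol_pos hκ ξ).le)]
      linarith
    · have h2 : MemLp (fun ξ => (2 : ℝ) * resSymbol κ ξ) 2 volume := by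
        refine MemLp.const_mul ?_ 2
        refine (memLp_resSymbol_two hκ).mono (continuous_resSymbol hκ).aestronglyMeasurable
          (Eventually.of_forall fun ξ => ?_)
        rw [Complex.norm_real]
      have := lintegral_rpow_enorm_lt_top_of_eLpNorm_lt_top (by norm_num) (by norm_num) h2.2
      simpa using this.ne
    · refine Eventually.of_forall fun ξ => ?_
      have hc : Continuous fun x => ‖resWave κ x ξ - resWave κ x₀ ξ‖ₑ ^ (2 : ℝ) := by
        have : Continuous fun x => resWave κ x ξ - resWave κ x₀ ξ :=
          (continuous_resWave_left κ ξ).sub continuous_const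
        exact (ENNReal.continuous_rpow_const).comp this.enorm
      have := hc.tendsto x₀
      simpa using this
  rw [lintegral_zero] at key
  have h3 := (ENNReal.continuous_rpow_const (y := 1 / 2)).tendsto 0
  rw [ENNReal.zero_rpow_of_pos (by norm_num)] at h3
  refine (h3.comp key).congr fun x => ?_
  rw [eLpNorm_eq_lintegral_rpow_enorm_toReal (by norm_num) (by norm_num)]
  simp

/-- Evaluation of the continuous representative of `(-Δ + κ)⁻¹ f` at `x`, as a functional of
`f`. -/
def resEval (κ : ℝ) (hκ : 0 < κ) (x : Space) : L2C →L[ℂ] ℂ :=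
  innerSL ℂ ((memLp_resWave hκ x).toLp : L2C) ∘L
    ((Lp.fourierTransformₗᵢ Space ℂ).toContinuousLinearEquiv : L2C →L[ℂ] L2C)

theorem continuous_resEval {κ : ℝ} (hκ : 0 < κ) : Continuous (resEval κ hκ) := by
  unfold resEval
  exact (((innerSL ℂ).continuous.comp (continuous_toLp_resWave hκ)).clm_comp continuous_const)

theorem norm_resEval_le {κ : ℝ} (hκ : 0 < κ) (x : Space) :
    ‖resEval κ hκ x‖ ≤ ‖((memLp_resSymbol_two hκ).toLp : L2C)‖ := by
  refine ContinuousLinearMap.opNorm_le_bound _ (norm_nonneg _) fun f => ?_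
  have h1 : ‖((memLp_resWave hκ x).toLp : L2C)‖ = ‖((memLp_resSymbol_two hκ).toLp : L2C)‖ := by
    rw [Lp.norm_toLp, Lp.norm_toLp]
    congr 1
    refine eLpNorm_congr_norm_ae (Eventually.of_forall fun ξ => ?_)
    rw [norm_resWave hκ, Complex.norm_real, Real.norm_of_nonneg (resSymbol_pos hκ ξ).le]
  rw [← h1, ← Lp.norm_fourier_eq f]
  exact norm_inner_le_norm (𝕜 := ℂ) ((memLp_resWave hκ x).toLp : L2C) (𝓕 f : L2C)

/-- `(-Δ + κ)⁻¹` is an integral operator whose kernel is a bounded continuous function with values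
in `(L²)'`; a square integrable potential makes this kernel square integrable. -/
theorem coeFn_resC_eq_resEval {κ : ℝ} (hκ : 0 < κ) (f : L2C) :
    resC κ hκ f =ᵐ[volume] fun x => resEval κ hκ x f := by
  filter_upwards [coeFn_resC hκ f] with x hx
  rw [hx]
  change _ = inner ℂ ((memLp_resWave hκ x).toLp : L2C) (𝓕 f)
  rw [L2.inner_def, Real.fourierInv_eq]
  refine integral_congr_ae ?_
  filter_upwards [fourier_resC hκ f, (memLp_resWave hκ x).coeFn_toLp] with ξ h1 h2
  rw [h1, h2]
  simp only [resWave, RCLike.inner_apply, map_mul, Complex.conj_ofReal, Circle.smul_def,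
    smul_eq_mul]
  rw [← Circle.coe_inv_eq_conj, ← AddChar.map_neg_eq_inv, neg_neg]
  ring

/-- A square integrable, essentially bounded potential is compact relative to `-Δ`. -/
theorem isCompactOperator_mulL_comp_resC {κ : ℝ} (hκ : 0 < κ)
    (W : Lp ℂ ∞ (volume : Measure Space)) (hW : MemLp W 2 volume) :
    IsCompactOperator (mulL ℂ W ∘L resC κ hκ) := by
  have hk : MemLp (fun x => W x • resEval κ hκ x) 2 (volume : Measure Space) := by
    refine (hW.const_mul ((‖((memLp_resSymbol_two hκ).toLp : L2C)‖ : ℝ) : ℂ)).mono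
      (hW.1.smul (continuous_resEval hκ).aestronglyMeasurable)
      (Eventually.of_forall fun x => ?_)
    rw [norm_smul, norm_mul, Complex.norm_real, norm_norm, mul_comm]
    gcongr
    exact norm_resEval_le hκ x
  have : mulL ℂ W ∘L resC κ hκ = kernelOp hk.toLp := by
    ext1 f
    apply Lp.ext
    filter_upwards [coeFn_mulL W (resC κ hκ f), coeFn_resC_eq_resEval hκ f,
      coeFn_kernelOp hk.toLp f, hk.coeFn_toLp] with x h1 h2 h3 h4
    rw [ContinuousLinearMap.comp_apply, h1, h2, h3, h4]
    simp
  rw [this]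
  exact isCompactOperator_kernelOp _

end

section

open FourierTransform

/-! ### Positivity of the free resolvent -/

/-- The heat kernel on `ℝ³`, up to the choice of the time parameter `b = 4π²t`. -/
def heatKernel (b : ℝ) (z : Space) : ℝ :=
  (Real.pi / b) ^ (3 / 2 : ℝ) * Real.exp (-Real.pi ^ 2 * ‖z‖ ^ 2 / b)

theorem heatKernel_pos {b : ℝ} (hb : 0 < b) (z : Space) : 0 < heatKernel b z := by
  unfold heatKernel
  have := Real.pi_pos
  positivity

/-- The heat semigroup: a Gaussian Fourier multiplier is convolution with the heat kernel. -/
theorem fourierInv_gaussian_mul_fourier {h : Space → ℂ} (hh : Integrable h) {b : ℝ} (hb : 0 < b)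
    (x : Space) :
    𝓕⁻ (fun ξ : Space => (Real.exp (-b * ‖ξ‖ ^ 2) : ℂ) * 𝓕 h ξ) x =
      ∫ y, (heatKernel b (x - y) : ℂ) * h y := by
  have hb' : 0 < (b : ℂ).re := by simpa using hb
  have hg : Integrable (fun v : Space => Complex.exp (-(b : ℂ) * ‖v‖ ^ 2 +
      2 * Real.pi * Complex.I * (inner ℝ x v : ℝ))) :=
    GaussianFourier.integrable_cexp_neg_mul_sq_norm_add hb' (2 * Real.pi * Complex.I) x
  have h2 := VectorFourier.integral_fourierIntegral_smul_eq_flip (L := innerₗ Space)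
    (μ := volume) (ν := volume) (f := h) (g := fun v : Space => Complex.exp (-(b : ℂ) * ‖v‖ ^ 2 +
      2 * Real.pi * Complex.I * (inner ℝ x v : ℝ)))
    Real.continuous_fourierChar continuous_inner hh hg
  simp only [flip_innerₗ, smul_eq_mul] at h2
  rw [Real.fourierInv_eq]
  have e1 : ∀ ξ : Space, Real.fourierChar (inner ℝ ξ x) •
      ((Real.exp (-b * ‖ξ‖ ^ 2) : ℂ) * 𝓕 h ξ) =
      VectorFourier.fourierIntegral Real.fourierChar volume (innerₗ Space) h ξ *
      Complex.exp (-(b : ℂ) * ‖ξ‖ ^ 2 + 2 * Real.pi * Complex.I * (inner ℝ x ξ : ℝ)) := by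
    intro ξ
    rw [Complex.exp_add, Circle.smul_def, Real.fourierChar_apply, smul_eq_mul,
      real_inner_comm x ξ]
    change _ = 𝓕 h ξ * _
    push_cast
    rw [show (2 * Real.pi * (inner ℝ x ξ : ℝ) * Complex.I : ℂ) =
      2 * Real.pi * Complex.I * (inner ℝ x ξ : ℝ) by ring]
    ring
  rw [integral_congr_ae (Eventually.of_forall e1), h2]
  refine integral_congr_ae (Eventually.of_forall fun y => ?_)
  have h3 := fourier_gaussian_innerProductSpace' (V := Space) hb' x y
  simp only
  rw [mul_comm (h y)]
  congr 1
  refine Eq.trans h3 ?_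
  unfold heatKernel
  have := Real.pi_pos
  rw [Complex.ofReal_mul, Complex.ofReal_cpow (by positivity)]
  simp

theorem integral_gaussian_mul_fourier {f h : Space → ℝ} (hf : Integrable f) (hh : Integrable h)
    {b : ℝ} (hb : 0 < b) :
    ∫ ξ : Space, (Real.exp (-b * ‖ξ‖ ^ 2) : ℂ) *
        ((starRingEnd ℂ) (𝓕 (fun x => (f x : ℂ)) ξ) * 𝓕 (fun x => (h x : ℂ)) ξ) =
      ((∫ x, f x * ∫ y, heatKernel b (x - y) * h y : ℝ) : ℂ) := by
  have hk : Integrable (fun ξ : Space => (Real.exp (-b * ‖ξ‖ ^ 2) : ℂ) *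
      𝓕 (fun x => (h x : ℂ)) ξ) := by
    have h1 : Integrable (fun ξ : Space => (Real.exp (-b * ‖ξ‖ ^ 2) : ℂ)) := by
      have := GaussianFourier.integrable_cexp_neg_mul_sq_norm_add (V := Space)
        (b := (b : ℂ)) (by simpa using hb) 0 0
      refine this.congr (Eventually.of_forall fun ξ => ?_)
      simp
    refine h1.mul_bdd (c := ∫ x, ‖(h x : ℂ)‖) ?_ (Eventually.of_forall fun ξ => ?_)
    · exact (VectorFourier.fourierIntegral_continuous Real.continuous_fourierChar
        (by exact continuous_inner) hh.ofReal).aestronglyMeasurable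
    · exact VectorFourier.norm_fourierIntegral_le_integral_norm _ _ _ _ _
  have h2 := VectorFourier.integral_fourierIntegral_smul_eq_flip (L := -innerₗ Space)
    (μ := volume) (ν := volume) (f := fun x => (f x : ℂ)) (g := _)
    Real.continuous_fourierChar (by exact continuous_inner.neg) hf.ofReal hk
  have e1 : ∀ ξ : Space, (starRingEnd ℂ) (𝓕 (fun x => (f x : ℂ)) ξ) =
      VectorFourier.fourierIntegral Real.fourierChar volume (-innerₗ Space)
        (fun x => (f x : ℂ)) ξ := by
    intro ξ
    rw [Real.fourier_eq, ← integral_conj]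
    unfold VectorFourier.fourierIntegral
    refine integral_congr_ae (Eventually.of_forall fun x => ?_)
    simp only [Circle.smul_def, smul_eq_mul, map_mul, Complex.conj_ofReal,
      ← Circle.coe_inv_eq_conj, ← AddChar.map_neg_eq_inv, neg_neg]
    simp
  have e2 : ∀ ξ : Space, (Real.exp (-b * ‖ξ‖ ^ 2) : ℂ) *
        ((starRingEnd ℂ) (𝓕 (fun x => (f x : ℂ)) ξ) * 𝓕 (fun x => (h x : ℂ)) ξ) =
      VectorFourier.fourierIntegral Real.fourierChar volume (-innerₗ Space)
        (fun x => (f x : ℂ)) ξ • ((Real.exp (-b * ‖ξ‖ ^ 2) : ℂ) * 𝓕 (fun x => (h x : ℂ)) ξ) := by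
    intro ξ; rw [e1, smul_eq_mul]; ring
  rw [integral_congr_ae (Eventually.of_forall e2), h2, ← integral_complex_ofReal]
  refine integral_congr_ae (Eventually.of_forall fun x => ?_)
  simp only [smul_eq_mul, Complex.ofReal_mul]
  congr 1
  rw [← integral_complex_ofReal]
  refine Eq.trans ?_ ((fourierInv_gaussian_mul_fourier hh.ofReal hb x).trans ?_)
  · have : (-innerₗ Space).flip = -innerₗ Space := by
      ext a b; simp [real_inner_comm]
    rw [this]; rfl
  · refine integral_congr_ae (Eventually.of_forall fun y => ?_)
    simp

/-- The resolvent is the Laplace transform of the heat semigroup. -/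
theorem resSymbol_eq_integral {κ : ℝ} (hκ : 0 < κ) (ξ : Space) :
    resSymbol κ ξ = ∫ t in Set.Ioi (0 : ℝ),
      Real.exp (-κ * t) * Real.exp (-((2 * Real.pi) ^ 2 * t) * ‖ξ‖ ^ 2) := by
  have h := integral_exp_mul_Ioi (a := -(κ + (2 * Real.pi) ^ 2 * ‖ξ‖ ^ 2))
    (by have : 0 < κ + (2 * Real.pi) ^ 2 * ‖ξ‖ ^ 2 := by positivity
        linarith) 0
  simp only [mul_zero, Real.exp_zero] at h
  unfold resSymbol
  rw [show (κ + (2 * Real.pi) ^ 2 * ‖ξ‖ ^ 2)⁻¹ = -1 / -(κ + (2 * Real.pi) ^ 2 * ‖ξ‖ ^ 2) by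
    rw [neg_div_neg_eq, one_div], ← h]
  refine integral_congr_ae (Eventually.of_forall fun t => ?_)
  simp only [← Real.exp_add]
  ring_nf

/-- The quadratic form of the free resolvent is an average over time of heat kernels. -/
theorem inner_resC_toC_eq {κ : ℝ} (hκ : 0 < κ) (f h : L2R) (hf : Integrable f)
    (hh : Integrable h) :
    IntegrableOn (fun t : ℝ => Real.exp (-κ * t) *
      ∫ x, f x * ∫ y, heatKernel ((2 * Real.pi) ^ 2 * t) (x - y) * h y) (Set.Ioi 0) ∧
    inner ℂ (toC f) (resC κ hκ (toC h)) =
      ((∫ t in Set.Ioi (0 : ℝ), Real.exp (-κ * t) *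
        ∫ x, f x * ∫ y, heatKernel ((2 * Real.pi) ^ 2 * t) (x - y) * h y : ℝ) : ℂ) := by
  have ef : toC f =ᵐ[volume] fun x => (f x : ℂ) := Complex.ofRealCLM.coeFn_compLp f
  have eh : toC h =ᵐ[volume] fun x => (h x : ℂ) := Complex.ofRealCLM.coeFn_compLp h
  have Ff : (𝓕 (toC f) : L2C) =ᵐ[volume] 𝓕 (fun x => (f x : ℂ)) := by
    refine (coeFn_fourier_of_integrable _ (hf.ofReal.congr ef.symm)).trans
      (Eventually.of_forall fun ξ => ?_)
    rw [Real.fourier_eq, Real.fourier_eq]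
    refine integral_congr_ae ?_
    filter_upwards [ef] with x hx
    rw [hx]
  have Fh : (𝓕 (toC h) : L2C) =ᵐ[volume] 𝓕 (fun x => (h x : ℂ)) := by
    refine (coeFn_fourier_of_integrable _ (hh.ofReal.congr eh.symm)).trans
      (Eventually.of_forall fun ξ => ?_)
    rw [Real.fourier_eq, Real.fourier_eq]
    refine integral_congr_ae ?_
    filter_upwards [eh] with x hx
    rw [hx]
  set Φ : Space → ℂ := fun ξ => (starRingEnd ℂ) (𝓕 (fun x => (f x : ℂ)) ξ) *
    𝓕 (fun x => (h x : ℂ)) ξ with hΦ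
  have iΦ : Integrable Φ := by
    have h1 : Integrable (fun ξ => inner ℂ ((𝓕 (toC f) : L2C) ξ) ((𝓕 (toC h) : L2C) ξ)) :=
      L2.integrable_inner _ _
    refine h1.congr ?_
    filter_upwards [Ff, Fh] with ξ h2 h3
    rw [h2, h3, RCLike.inner_apply, mul_comm]
  have h1 : inner ℂ (toC f) (resC κ hκ (toC h)) = ∫ ξ, (resSymbol κ ξ : ℂ) * Φ ξ := by
    rw [inner_resC]
    refine integral_congr_ae ?_
    filter_upwards [Ff, Fh] with ξ h2 h3
    rw [h2, h3]
  have h2 : ∀ ξ, (resSymbol κ ξ : ℂ) * Φ ξ = ∫ t in Set.Ioi (0 : ℝ),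
      ((Real.exp (-κ * t) * Real.exp (-((2 * Real.pi) ^ 2 * t) * ‖ξ‖ ^ 2) : ℝ) : ℂ) * Φ ξ := by
    intro ξ
    rw [resSymbol_eq_integral hκ, ← integral_complex_ofReal, integral_mul_const]
  have hint : Integrable (Function.uncurry fun (ξ : Space) (t : ℝ) =>
      ((Real.exp (-κ * t) * Real.exp (-((2 * Real.pi) ^ 2 * t) * ‖ξ‖ ^ 2) : ℝ) : ℂ) * Φ ξ)
      (volume.prod (volume.restrict (Set.Ioi 0))) := by
    have d : Integrable (fun p : Space × ℝ => Φ p.1 * (Real.exp (-κ * p.2) : ℂ))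
        (volume.prod (volume.restrict (Set.Ioi 0))) := by
      refine Integrable.mul_prod (f := Φ) (g := fun t : ℝ => (Real.exp (-κ * t) : ℂ)) iΦ ?_
      exact (exp_neg_integrableOn_Ioi 0 hκ).ofReal
    refine d.mono ?_ ?_
    · refine AEStronglyMeasurable.mul ?_ iΦ.aestronglyMeasurable.comp_fst
      refine Continuous.aestronglyMeasurable ?_
      fun_prop
    · have : ∀ᵐ p : Space × ℝ ∂(volume.prod (volume.restrict (Set.Ioi 0))), 0 < p.2 := by
        have h3 : ∀ᵐ t : ℝ ∂(volume.restrict (Set.Ioi 0)), 0 < t :=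
          ae_restrict_mem measurableSet_Ioi
        exact (Measure.quasiMeasurePreserving_snd).ae h3
      filter_upwards [this] with p hp
      simp only [Function.uncurry]
      rw [norm_mul _ (Φ p.1), norm_mul (Φ p.1), mul_comm ‖Φ p.1‖]
      refine mul_le_mul_of_nonneg_right ?_ (norm_nonneg _)
      rw [Complex.norm_real, Complex.norm_real, Real.norm_of_nonneg (by positivity),
        Real.norm_of_nonneg (by positivity)]
      have : Real.exp (-((2 * Real.pi) ^ 2 * p.2) * ‖p.1‖ ^ 2) ≤ 1 := by
        rw [Real.exp_le_one_iff]
        have : 0 ≤ ((2 * Real.pi) ^ 2 * p.2) * ‖p.1‖ ^ 2 := by positivity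
        linarith
      nlinarith [Real.exp_pos (-κ * p.2)]
  have h3 : ∀ t : ℝ, 0 < t → (∫ ξ : Space,
      ((Real.exp (-κ * t) * Real.exp (-((2 * Real.pi) ^ 2 * t) * ‖ξ‖ ^ 2) : ℝ) : ℂ) * Φ ξ) =
      ((Real.exp (-κ * t) *
        ∫ x, f x * ∫ y, heatKernel ((2 * Real.pi) ^ 2 * t) (x - y) * h y : ℝ) : ℂ) := by
    intro t ht
    rw [Complex.ofReal_mul, ← integral_gaussian_mul_fourier hf hh (by positivity),
      ← integral_const_mul]
    refine integral_congr_ae (Eventually.of_forall fun ξ => ?_)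
    simp only [hΦ]
    push_cast
    ring
  constructor
  · have h4 := hint.integral_prod_right
    have h5 : IntegrableOn (fun t : ℝ => ((Real.exp (-κ * t) *
        ∫ x, f x * ∫ y, heatKernel ((2 * Real.pi) ^ 2 * t) (x - y) * h y : ℝ) : ℂ))
        (Set.Ioi 0) := by
      refine h4.congr ?_
      filter_upwards [ae_restrict_mem measurableSet_Ioi] with t ht
      exact h3 t ht
    exact h5.re
  · rw [h1, integral_congr_ae (Eventually.of_forall h2), integral_integral_swap hint,
      ← integral_complex_ofReal]
    refine integral_congr_ae ?_
    filter_upwards [ae_restrict_mem measurableSet_Ioi] with t ht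
    exact h3 t ht

end

section

open FourierTransform

/-! ### Real and complex valued functions -/

/-- The inclusion of `L²(ℝ³; ℝ)` into `L²(ℝ³; ℂ)` as a real-linear map. -/
def ofR : L2R →L[ℝ] L2C := Complex.ofRealCLM.compLpL 2 volume

/-- The real part of an `L²` function. -/
def reL : L2C →L[ℝ] L2R := Complex.reCLM.compLpL 2 volume

/-- The imaginary part of an `L²` function. -/
def imL : L2C →L[ℝ] L2R := Complex.imCLM.compLpL 2 volume

theorem coeFn_toC (u : L2R) : toC u =ᵐ[volume] fun x => (u x : ℂ) :=
  Complex.ofRealCLM.coeFn_compLp u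

theorem coeFn_reL (w : L2C) : reL w =ᵐ[volume] fun x => (w x).re :=
  Complex.reCLM.coeFn_compLp w

theorem coeFn_imL (w : L2C) : imL w =ᵐ[volume] fun x => (w x).im :=
  Complex.imCLM.coeFn_compLp w

theorem toC_add (u v : L2R) : toC (u + v) = toC u + toC v := map_add ofR u v
theorem toC_sub (u v : L2R) : toC (u - v) = toC u - toC v := map_sub ofR u v
theorem toC_neg (u : L2R) : toC (-u) = -toC u := map_neg ofR u
theorem toC_zero : toC 0 = 0 := map_zero ofR

theorem toC_smul (r : ℝ) (u : L2R) : toC (r • u) = (r : ℂ) • toC u := by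
  have := map_smul ofR r u
  rw [Complex.coe_smul]
  exact this

theorem toC_sum {ι : Type*} (s : Finset ι) (u : ι → L2R) :
    toC (∑ i ∈ s, u i) = ∑ i ∈ s, toC (u i) := map_sum ofR u s

theorem reL_toC (u : L2R) : reL (toC u) = u := by
  apply Lp.ext
  filter_upwards [coeFn_reL (toC u), coeFn_toC u] with x h1 h2
  rw [h1, h2, Complex.ofReal_re]

theorem imL_toC (u : L2R) : imL (toC u) = 0 := by
  apply Lp.ext
  filter_upwards [coeFn_imL (toC u), coeFn_toC u, Lp.coeFn_zero ℝ 2 (volume : Measure Space)]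
    with x h1 h2 h3
  rw [h1, h2, h3, Complex.ofReal_im]; rfl

theorem toC_injective : Function.Injective toC :=
  Function.LeftInverse.injective reL_toC

theorem toC_re_add_im (w : L2C) : toC (reL w) + Complex.I • toC (imL w) = w := by
  apply Lp.ext
  filter_upwards [coeFn_reL w, coeFn_imL w, coeFn_toC (reL w), coeFn_toC (imL w),
    Lp.coeFn_add (toC (reL w)) (Complex.I • toC (imL w)),
    Lp.coeFn_smul Complex.I (toC (imL w))] with x h1 h2 h3 h4 h5 h6
  rw [h5, Pi.add_apply, h6, Pi.smul_apply, h3, h4, h1, h2, smul_eq_mul, mul_comm]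
  exact Complex.re_add_im _

theorem reL_smul_I (w : L2C) : reL (Complex.I • w) = -imL w := by
  apply Lp.ext
  filter_upwards [coeFn_reL (Complex.I • w), coeFn_imL w, Lp.coeFn_neg (imL w),
    Lp.coeFn_smul Complex.I w] with x h1 h2 h3 h4
  rw [h1, h4, h3, Pi.neg_apply, h2]; simp

theorem imL_smul_I (w : L2C) : imL (Complex.I • w) = reL w := by
  apply Lp.ext
  filter_upwards [coeFn_imL (Complex.I • w), coeFn_reL w,
    Lp.coeFn_smul Complex.I w] with x h1 h2 h4
  rw [h1, h4, h2]; simp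

theorem inner_toC (u v : L2R) : inner ℂ (toC u) (toC v) = ((inner ℝ u v : ℝ) : ℂ) := by
  rw [L2.inner_def, L2.inner_def, ← integral_complex_ofReal]
  refine integral_congr_ae ?_
  filter_upwards [coeFn_toC u, coeFn_toC v] with x h1 h2
  rw [h1, h2]; simp

theorem norm_toC (u : L2R) : ‖toC u‖ = ‖u‖ := by
  have h : ‖toC u‖ ^ 2 = ‖u‖ ^ 2 := by
    rw [← inner_self_eq_norm_sq (𝕜 := ℂ), inner_toC, real_inner_self_eq_norm_sq]
    exact Complex.ofReal_re _
  exact (pow_left_inj₀ (norm_nonneg _) (norm_nonneg _) two_ne_zero).1 h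

theorem norm_reL_le (w : L2C) : ‖reL w‖ ≤ ‖w‖ := by
  refine Lp.norm_le_norm_of_ae_le ?_
  filter_upwards [coeFn_reL w] with x h
  rw [h]; exact Complex.abs_re_le_norm _

theorem norm_imL_le (w : L2C) : ‖imL w‖ ≤ ‖w‖ := by
  refine Lp.norm_le_norm_of_ae_le ?_
  filter_upwards [coeFn_imL w] with x h
  rw [h]; exact Complex.abs_im_le_norm _

theorem inner_toC_left_im (f : L2R) (w : L2C) :
    (inner ℂ (toC f) w).im = inner ℝ f (imL w) := by
  conv_lhs => rw [← toC_re_add_im w]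
  rw [inner_add_right, inner_smul_right, inner_toC, inner_toC]
  simp

theorem inner_toC_left_re (f : L2R) (w : L2C) :
    (inner ℂ (toC f) w).re = inner ℝ f (reL w) := by
  conv_lhs => rw [← toC_re_add_im w]
  rw [inner_add_right, inner_smul_right, inner_toC, inner_toC]
  simp

/-! ### The free resolvent preserves and improves positivity -/

theorem re_inner_resC_nonneg_of_integrable {κ : ℝ} (hκ : 0 < κ) {f h : L2R} (hf : 0 ≤ f)
    (hh : 0 ≤ h) (fi : Integrable f) (hi : Integrable h) :
    (inner ℂ (toC f) (resC κ hκ (toC h))).im = 0 ∧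
      0 ≤ (inner ℂ (toC f) (resC κ hκ (toC h))).re := by
  rw [(inner_resC_toC_eq hκ f h fi hi).2]
  refine ⟨Complex.ofReal_im _, ?_⟩
  rw [Complex.ofReal_re]
  refine setIntegral_nonneg measurableSet_Ioi fun t ht => mul_nonneg (Real.exp_pos _).le ?_
  refine integral_nonneg_of_ae ?_
  filter_upwards [(Lp.coeFn_nonneg f).2 hf] with x hx
  refine mul_nonneg hx (integral_nonneg_of_ae ?_)
  filter_upwards [(Lp.coeFn_nonneg h).2 hh] with y hy
  have : (0 : ℝ) < t := ht
  exact mul_nonneg (heatKernel_pos (by positivity) _).le hy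

theorem integral_mul_pos_of_pos {a w : Space → ℝ} (ha : 0 ≤ᵐ[volume] a) (ha' : ¬ a =ᵐ[volume] 0)
    (hw : ∀ x, 0 < w x) (hi : Integrable fun x => a x * w x) : 0 < ∫ x, a x * w x := by
  rw [integral_pos_iff_support_of_nonneg_ae _ hi]
  · rw [pos_iff_ne_zero]
    intro h0
    apply ha'
    have h1 : Function.support (fun x => a x * w x) = Function.support a := by
      ext x; simp [(hw x).ne']
    rw [h1] at h0
    exact measure_eq_zero_iff_ae_notMem.1 h0 |>.mono fun x hx => by simpa using hx
  · filter_upwards [ha] with x hx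
    exact mul_nonneg hx (hw x).le

theorem heatKernel_le {b : ℝ} (hb : 0 < b) (z : Space) :
    heatKernel b z ≤ (Real.pi / b) ^ (3 / 2 : ℝ) := by
  unfold heatKernel
  have := Real.pi_pos
  refine mul_le_of_le_one_right (by positivity) ?_
  rw [Real.exp_le_one_iff, neg_mul, neg_div]
  have : 0 ≤ Real.pi ^ 2 * ‖z‖ ^ 2 / b := by positivity
  linarith

theorem continuous_heatKernel (b : ℝ) : Continuous (heatKernel b) := by
  unfold heatKernel; fun_prop

theorem re_inner_resC_pos_of_integrable {κ : ℝ} (hκ : 0 < κ) {f h : L2R} (hf : 0 ≤ f)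
    (hh : 0 ≤ h) (fi : Integrable f) (hi : Integrable h) (hf0 : f ≠ 0) (hh0 : h ≠ 0) :
    0 < (inner ℂ (toC f) (resC κ hκ (toC h))).re := by
  obtain ⟨h1, h2⟩ := inner_resC_toC_eq hκ f h fi hi
  rw [h2, Complex.ofReal_re]
  have hfa := (Lp.coeFn_nonneg f).2 hf
  have hha := (Lp.coeFn_nonneg h).2 hh
  have hfn : ¬ f =ᵐ[volume] 0 := fun h => hf0 ((Lp.eq_zero_iff_ae_eq_zero).2 h)
  have hhn : ¬ h =ᵐ[volume] 0 := fun h => hh0 ((Lp.eq_zero_iff_ae_eq_zero).2 h)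
  have key : ∀ t : ℝ, 0 < t → 0 < Real.exp (-κ * t) *
      ∫ x, f x * ∫ y, heatKernel ((2 * Real.pi) ^ 2 * t) (x - y) * h y := by
    intro t ht
    have hb : 0 < (2 * Real.pi) ^ 2 * t := by have := Real.pi_pos; positivity
    have m1 : ∀ x : Space, Integrable fun y => h y *
        heatKernel ((2 * Real.pi) ^ 2 * t) (x - y) := by
      intro x
      refine hi.mul_bdd (c := (Real.pi / ((2 * Real.pi) ^ 2 * t)) ^ (3 / 2 : ℝ))
        ((continuous_heatKernel _).comp (by fun_prop)).aestronglyMeasurable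
        (Eventually.of_forall fun y => ?_)
      rw [Real.norm_of_nonneg (heatKernel_pos hb _).le]
      exact heatKernel_le hb _
    have m2 : ∀ x : Space, 0 < ∫ y, heatKernel ((2 * Real.pi) ^ 2 * t) (x - y) * h y := by
      intro x
      simp_rw [mul_comm _ (h _)]
      exact integral_mul_pos_of_pos hha hhn (fun y => heatKernel_pos hb _) (m1 x)
    refine mul_pos (Real.exp_pos _) (integral_mul_pos_of_pos hfa hfn m2 ?_)
    refine fi.mul_bdd (c := (Real.pi / ((2 * Real.pi) ^ 2 * t)) ^ (3 / 2 : ℝ) * ∫ y, ‖h y‖) ?_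
      (Eventually.of_forall fun x => ?_)
    · refine AEStronglyMeasurable.integral_prod_right' (f := fun p : Space × Space =>
        heatKernel ((2 * Real.pi) ^ 2 * t) (p.1 - p.2) * h p.2) ?_
      refine AEStronglyMeasurable.mul ?_ (Lp.aestronglyMeasurable h).comp_snd
      exact ((continuous_heatKernel _).comp (by fun_prop)).aestronglyMeasurable
    · refine (norm_integral_le_integral_norm _).trans ?_
      rw [← integral_const_mul]
      refine integral_mono_of_nonneg (Eventually.of_forall fun y => norm_nonneg _)
        (hi.norm.const_mul _) (Eventually.of_forall fun y => ?_)
      simp only [norm_mul]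
      gcongr
      rw [Real.norm_of_nonneg (heatKernel_pos hb _).le]
      exact heatKernel_le hb _
  rw [setIntegral_pos_iff_support_of_nonneg_ae _ h1]
  · refine lt_of_lt_of_le ?_ (measure_mono (s := Set.Ioo (0 : ℝ) 1) ?_)
    · simp
    · intro t ht
      exact ⟨(key t ht.1).ne', ht.1⟩
  · filter_upwards [ae_restrict_mem measurableSet_Ioi] with t ht
    exact (key t ht).le

/-- The quadratic form of the free resolvent is real and nonnegative on nonnegative functions; the
integrable case extends by density. -/
theorem inner_resC_toC_nonneg {κ : ℝ} (hκ : 0 < κ) {f h : L2R} (hf : 0 ≤ f) (hh : 0 ≤ h) :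
    (inner ℂ (toC f) (resC κ hκ (toC h))).im = 0 ∧
      0 ≤ (inner ℂ (toC f) (resC κ hκ (toC h))).re := by
  have cont : Continuous fun p : {g : L2R // 0 ≤ g} × {g : L2R // 0 ≤ g} =>
      inner ℂ (toC p.1.1) (resC κ hκ (toC p.2.1)) :=
    (ofR.continuous.comp (continuous_subtype_val.comp continuous_fst)).inner
      ((resC κ hκ).continuous.comp
        (ofR.continuous.comp (continuous_subtype_val.comp continuous_snd)))
  have hcl : IsClosed {p : {g : L2R // 0 ≤ g} × {g : L2R // 0 ≤ g} |
      (inner ℂ (toC p.1.1) (resC κ hκ (toC p.2.1))).im = 0 ∧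
      0 ≤ (inner ℂ (toC p.1.1) (resC κ hκ (toC p.2.1))).re} :=
    (isClosed_eq (Complex.continuous_im.comp cont) continuous_const).inter
      (isClosed_le continuous_const (Complex.continuous_re.comp cont))
  have hd := Lp.simpleFunc.denseRange_coeSimpleFuncNonnegToLpNonneg 2
    (volume : Measure Space) ℝ ENNReal.ofNat_ne_top
  have hd2 := hd.prodMap hd
  have := hd2.induction_on (p := fun p => (inner ℂ (toC p.1.1) (resC κ hκ (toC p.2.1))).im = 0 ∧
      0 ≤ (inner ℂ (toC p.1.1) (resC κ hκ (toC p.2.1))).re) (⟨f, hf⟩, ⟨h, hh⟩) hcl ?_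
  · exact this
  · rintro ⟨a, b⟩
    have hint : ∀ g : Lp.simpleFunc ℝ 2 (volume : Measure Space), Integrable (g : L2R) := by
      intro g
      have h1 := Lp.simpleFunc.toSimpleFunc_eq_toFun g
      refine Integrable.congr ?_ h1
      exact (SimpleFunc.memLp_iff_integrable (by norm_num) (by norm_num)).1
        (Lp.simpleFunc.memLp g)
    exact re_inner_resC_nonneg_of_integrable hκ a.2 b.2 (hint _) (hint _)

/-- The free resolvent preserves real functions, since it preserves the nonnegative ones. -/
theorem imL_resC_toC {κ : ℝ} (hκ : 0 < κ) (h : L2R) : imL (resC κ hκ (toC h)) = 0 := by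
  have h1 : ∀ f : L2R, (inner ℂ (toC f) (resC κ hκ (toC h))).im = 0 := by
    intro f
    have ef : f = f⁺ - f⁻ := (posPart_sub_negPart f).symm
    have eh : h = h⁺ - h⁻ := (posPart_sub_negPart h).symm
    rw [ef, eh, toC_sub, toC_sub, map_sub, inner_sub_left, inner_sub_right, inner_sub_right]
    simp only [Complex.sub_im]
    rw [(inner_resC_toC_nonneg hκ (posPart_nonneg f) (posPart_nonneg h)).1,
      (inner_resC_toC_nonneg hκ (posPart_nonneg f) (negPart_nonneg h)).1,
      (inner_resC_toC_nonneg hκ (negPart_nonneg f) (posPart_nonneg h)).1,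
      (inner_resC_toC_nonneg hκ (negPart_nonneg f) (negPart_nonneg h)).1]
    simp
  have h2 := h1 (imL (resC κ hκ (toC h)))
  rw [inner_toC_left_im] at h2
  exact inner_self_eq_zero.1 h2

/-- The free resolvent `(-Δ + κ)⁻¹` on `L²(ℝ³; ℝ)`. -/
def resR (κ : ℝ) (hκ : 0 < κ) : L2R →L[ℝ] L2R :=
  reL ∘L (resC κ hκ).restrictScalars ℝ ∘L ofR

theorem toC_resR {κ : ℝ} (hκ : 0 < κ) (f : L2R) : toC (resR κ hκ f) = resC κ hκ (toC f) := by
  have h := toC_re_add_im (resC κ hκ (toC f))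
  rw [imL_resC_toC, toC_zero, smul_zero, add_zero] at h
  exact h

theorem resC_eq {κ : ℝ} (hκ : 0 < κ) (w : L2C) :
    resC κ hκ w = toC (resR κ hκ (reL w)) + Complex.I • toC (resR κ hκ (imL w)) := by
  rw [toC_resR, toC_resR, ← map_smul, ← map_add, toC_re_add_im]

theorem reL_resC {κ : ℝ} (hκ : 0 < κ) (w : L2C) : reL (resC κ hκ w) = resR κ hκ (reL w) := by
  rw [resC_eq, map_add, reL_toC, reL_smul_I, imL_toC, neg_zero, add_zero]

theorem imL_resC {κ : ℝ} (hκ : 0 < κ) (w : L2C) : imL (resC κ hκ w) = resR κ hκ (imL w) := by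
  rw [resC_eq, map_add, imL_toC, imL_smul_I, reL_toC, zero_add]

theorem resR_symm {κ : ℝ} (hκ : 0 < κ) (f g : L2R) :
    inner ℝ (resR κ hκ f) g = inner ℝ f (resR κ hκ g) := by
  have h := resC_symm hκ (toC f) (toC g)
  rw [← toC_resR, ← toC_resR, inner_toC, inner_toC] at h
  exact_mod_cast h

theorem inner_resR_nonneg {κ : ℝ} (hκ : 0 < κ) {f h : L2R} (hf : 0 ≤ f) (hh : 0 ≤ h) :
    0 ≤ inner ℝ f (resR κ hκ h) := by
  have h1 := (inner_resC_toC_nonneg hκ hf hh).2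
  rwa [inner_toC_left_re, reL_resC, reL_toC] at h1

/-- A nonzero nonnegative `L²` function dominates a nonzero nonnegative integrable one. -/
theorem exists_integrable_le {f : L2R} (hf : 0 ≤ f) (hf0 : f ≠ 0) :
    ∃ f₁ : L2R, 0 ≤ f₁ ∧ f₁ ≤ f ∧ f₁ ≠ 0 ∧ Integrable f₁ := by
  have hfa := (Lp.coeFn_nonneg f).2 hf
  have hG : Integrable (fun x : Space => Real.exp (-(1 : ℝ) * ‖x‖ ^ 2)) := by
    have := GaussianFourier.integrable_cexp_neg_mul_sq_norm_add (V := Space)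
        (b := 1) (by simp) 0 0
    refine this.norm.congr (Eventually.of_forall fun ξ => ?_)
    simp [Complex.norm_exp]
    norm_cast
  have hGm : AEStronglyMeasurable (fun x : Space => Real.exp (-(1 : ℝ) * ‖x‖ ^ 2)) volume :=
    hG.1
  have hm : AEStronglyMeasurable (fun x => min (f x) (Real.exp (-(1 : ℝ) * ‖x‖ ^ 2))) volume :=
    (Lp.aestronglyMeasurable f).inf hGm
  have hL : MemLp (fun x => min (f x) (Real.exp (-(1 : ℝ) * ‖x‖ ^ 2))) 2 volume := by
    refine (Lp.memLp f).mono hm ?_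
    filter_upwards [hfa] with x hx
    rw [Real.norm_of_nonneg (le_min hx (Real.exp_pos _).le), Real.norm_of_nonneg hx]
    exact min_le_left _ _
  refine ⟨hL.toLp, ?_, ?_, ?_, ?_⟩
  · rw [← Lp.coeFn_nonneg]
    filter_upwards [hfa, hL.coeFn_toLp] with x hx h
    rw [h]; exact le_min hx (Real.exp_pos _).le
  · rw [← Lp.coeFn_le]
    filter_upwards [hL.coeFn_toLp] with x h
    rw [h]; exact min_le_left _ _
  · intro h0
    apply hf0
    rw [Lp.eq_zero_iff_ae_eq_zero] at h0 ⊢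
    filter_upwards [h0, hL.coeFn_toLp, hfa] with x h1 h2 h3
    rw [h2] at h1
    simp only [Pi.zero_apply] at h1 h3 ⊢
    rcases min_choice (f x) (Real.exp (-(1 : ℝ) * ‖x‖ ^ 2)) with h | h
    · rw [← h, h1]
    · rw [h] at h1; exact absurd h1 (Real.exp_pos _).ne'
  · refine (hG.mono hm ?_).congr hL.coeFn_toLp.symm
    filter_upwards [hfa] with x hx
    rw [Real.norm_of_nonneg (le_min hx (Real.exp_pos _).le),
      Real.norm_of_nonneg (Real.exp_pos _).le]
    exact min_le_right _ _

/-- The free resolvent is positivity improving. -/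
theorem inner_resR_pos {κ : ℝ} (hκ : 0 < κ) {f h : L2R} (hf : 0 ≤ f) (hh : 0 ≤ h)
    (hf0 : f ≠ 0) (hh0 : h ≠ 0) : 0 < inner ℝ f (resR κ hκ h) := by
  obtain ⟨f₁, f1, f2, f3, f4⟩ := exists_integrable_le hf hf0
  obtain ⟨h₁, h1, h2, h3, h4⟩ := exists_integrable_le hh hh0
  have key := re_inner_resC_pos_of_integrable hκ f1 h1 f4 h4 f3 h3
  rw [inner_toC_left_re, reL_resC, reL_toC] at key
  have a1 := inner_resR_nonneg hκ (sub_nonneg.2 f2) hh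
  have a2 := inner_resR_nonneg hκ f1 (sub_nonneg.2 h2)
  rw [inner_sub_left] at a1
  rw [map_sub, inner_sub_right] at a2
  linarith

end

section

open FourierTransform

/-! ### Schrödinger operators with bounded potentials -/

/-- Bounded real functions, regarded as potentials. -/
abbrev LinfR : Type := Lp ℝ ∞ (volume : Measure Space)

/-- A bounded real function regarded as a complex one. -/
def cInf (W : LinfR) : Lp ℂ ∞ (volume : Measure Space) := Complex.ofRealCLM.compLp W

theorem coeFn_cInf (W : LinfR) : cInf W =ᵐ[volume] fun x => (W x : ℂ) :=
  Complex.ofRealCLM.coeFn_compLp W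

theorem mulL_toC (W : LinfR) (u : L2R) : mulL ℂ (cInf W) (toC u) = toC (mulL ℝ W u) := by
  apply Lp.ext
  filter_upwards [coeFn_mulL (cInf W) (toC u), coeFn_mulL W u, coeFn_cInf W, coeFn_toC u,
    coeFn_toC (mulL ℝ W u)] with x h1 h2 h3 h4 h5
  rw [h1, h5, h2, h3, h4]; push_cast; rfl

theorem mulL_cInf_eq (W : LinfR) (w : L2C) : mulL ℂ (cInf W) w =
    toC (mulL ℝ W (reL w)) + Complex.I • toC (mulL ℝ W (imL w)) := by
  rw [← mulL_toC, ← mulL_toC]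
  conv_lhs => rw [← toC_re_add_im w]
  exact ((mulL ℂ (cInf W)).map_add _ _).trans
    (congrArg _ ((mulL ℂ (cInf W)).map_smul Complex.I _))

theorem reL_add_smul_I (a b : L2R) : reL (toC a + Complex.I • toC b) = a := by
  rw [map_add, reL_toC, reL_smul_I, imL_toC, neg_zero, add_zero]

theorem imL_add_smul_I (a b : L2R) : imL (toC a + Complex.I • toC b) = b := by
  rw [map_add, imL_toC, imL_smul_I, reL_toC, zero_add]

theorem reL_mulL (W : LinfR) (w : L2C) : reL (mulL ℂ (cInf W) w) = mulL ℝ W (reL w) := by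
  rw [mulL_cInf_eq, reL_add_smul_I]

theorem imL_mulL (W : LinfR) (w : L2C) : imL (mulL ℂ (cInf W) w) = mulL ℝ W (imL w) := by
  rw [mulL_cInf_eq, imL_add_smul_I]

theorem mulL_symm (W : LinfR) (u v : L2R) : inner ℝ (mulL ℝ W u) v = inner ℝ u (mulL ℝ W v) := by
  rw [L2.inner_def, L2.inner_def]
  refine integral_congr_ae ?_
  filter_upwards [coeFn_mulL W u, coeFn_mulL W v] with x h1 h2
  rw [h1, h2]; simp; ring

/-- `u ∈ H²` and `(-Δ + W) u = f`, for complex-valued functions. -/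
def HasSchC (W : LinfR) (u f : L2C) : Prop :=
  ∃ g, u = resC 1 one_pos g ∧ f = g - u + mulL ℂ (cInf W) u

/-- `u ∈ H²` and `(-Δ + W) u = f`, for real-valued functions. -/
def HasSch (W : LinfR) (u f : L2R) : Prop :=
  ∃ g, u = resR 1 one_pos g ∧ f = g - u + mulL ℝ W u

theorem mem_domain_schrodinger {W : Space → ℝ} (hW : MemLp W ∞ volume) {u : L2C} (hu : u ∈ H2) :
    u ∈ (schrodinger W).domain := by
  refine ⟨hu, ?_⟩
  change MemLp (fun x => (W x : ℂ) * u x) 2 volume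
  have h := Lp.memLp (mulL ℂ (cInf hW.toLp) u)
  refine (memLp_congr_ae ?_).1 h
  filter_upwards [coeFn_mulL (cInf hW.toLp) u, coeFn_cInf hW.toLp, hW.coeFn_toLp] with x h1 h2 h3
  rw [h1, h2, h3]

/-- The operator `schrodinger W` in terms of the free resolvent. -/
theorem schrodinger_iff {W : Space → ℝ} (hW : MemLp W ∞ volume) (u f : L2C) :
    (∃ h : u ∈ (schrodinger W).domain, schrodinger W ⟨u, h⟩ = f) ↔ HasSchC hW.toLp u f := by
  have key : ∀ (h1 : u ∈ negLaplacian.domain) (h2 : u ∈ (mulOp W).domain),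
      mulOp W ⟨u, h2⟩ = mulL ℂ (cInf hW.toLp) u := by
    intro h1 h2
    apply Lp.ext
    refine (MemLp.coeFn_toLp (memLp_mul ⟨u, h2⟩)).trans ?_
    filter_upwards [coeFn_mulL (cInf hW.toLp) u, coeFn_cInf hW.toLp, hW.coeFn_toLp]
      with x h1 h2 h3
    rw [h1, h2, h3]
  constructor
  · rintro ⟨h, hf⟩
    have h1 : u ∈ negLaplacian.domain := h.1
    have h2 : u ∈ (mulOp W).domain := h.2
    refine ⟨negLaplacian ⟨u, h1⟩ + ((1 : ℝ) : ℂ) • u, (resC_negLaplacian one_pos ⟨u, h1⟩).symm, ?_⟩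
    rw [← hf, ← key h1 h2]
    change negLaplacian ⟨u, h1⟩ + mulOp W ⟨u, h2⟩ = _
    simp
  · rintro ⟨g, hu, hf⟩
    have hH : u ∈ H2 := by rw [hu]; exact resC_mem_H2 one_pos g
    refine ⟨mem_domain_schrodinger hW hH, ?_⟩
    have h2 : u ∈ (mulOp W).domain := (mem_domain_schrodinger hW hH).2
    change negLaplacian ⟨u, hH⟩ + mulOp W ⟨u, h2⟩ = _
    rw [key hH h2, hf]
    congr 1
    subst hu
    rw [negLaplacian_resC one_pos g hH]
    simp

/-- A real Schrödinger operator acts separately on real and imaginary parts. -/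
theorem hasSchC_iff (W : LinfR) (u f : L2C) :
    HasSchC W u f ↔ HasSch W (reL u) (reL f) ∧ HasSch W (imL u) (imL f) := by
  constructor
  · rintro ⟨g, hu, hf⟩
    refine ⟨⟨reL g, ?_, ?_⟩, ⟨imL g, ?_, ?_⟩⟩
    · rw [hu, reL_resC]
    · rw [hf, map_add, map_sub, reL_mulL]
    · rw [hu, imL_resC]
    · rw [hf, map_add, map_sub, imL_mulL]
  · rintro ⟨⟨a, ha, ha'⟩, ⟨b, hb, hb'⟩⟩
    refine ⟨toC a + Complex.I • toC b, ?_, ?_⟩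
    · rw [map_add, map_smul, ← toC_resR, ← toC_resR, ← ha, ← hb, toC_re_add_im]
    · rw [← toC_re_add_im f, ha', hb', mulL_cInf_eq]
      simp only [toC_add, toC_sub, smul_add, smul_sub]
      have h : ∀ A B C D x y : L2C,
          A - x + C + (B - y + D) = A + B - (x + y) + (C + D) := by intros; abel
      rw [h, toC_re_add_im u]

theorem hasSchC_toC_iff (W : LinfR) (u f : L2R) : HasSchC W (toC u) (toC f) ↔ HasSch W u f := by
  rw [hasSchC_iff, reL_toC, reL_toC, imL_toC, imL_toC]
  refine ⟨fun h => h.1, fun h => ⟨h, 0, by simp, by simp⟩⟩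

namespace HasSch

variable {W : LinfR} {u v f h : L2R}

theorem add (hu : HasSch W u f) (hv : HasSch W v h) : HasSch W (u + v) (f + h) := by
  obtain ⟨a, ha, ha'⟩ := hu
  obtain ⟨b, hb, hb'⟩ := hv
  refine ⟨a + b, by rw [map_add, ha, hb], ?_⟩
  rw [ha', hb', map_add]; abel

theorem smul (c : ℝ) (hu : HasSch W u f) : HasSch W (c • u) (c • f) := by
  obtain ⟨a, ha, ha'⟩ := hu
  refine ⟨c • a, by rw [map_smul, ha], ?_⟩
  rw [ha', map_smul, smul_add, smul_sub]

theorem zero : HasSch W 0 0 := ⟨0, by simp, by simp⟩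

theorem neg (hu : HasSch W u f) : HasSch W (-u) (-f) := by
  simpa using hu.smul (-1)

theorem sub (hu : HasSch W u f) (hv : HasSch W v h) : HasSch W (u - v) (f - h) := by
  simpa [sub_eq_add_neg] using hu.add hv.neg

/-- `-Δ + W` is symmetric. -/
theorem symm (hu : HasSch W u f) (hv : HasSch W v h) : inner ℝ f v = inner ℝ u h := by
  obtain ⟨a, ha, ha'⟩ := hu
  obtain ⟨b, hb, hb'⟩ := hv
  rw [ha', hb', inner_add_left, inner_add_right, inner_sub_left, inner_sub_right, mulL_symm]
  have : inner ℝ a v = inner ℝ u b := by rw [ha, hb, resR_symm]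
  linarith

/-- A change of the bounded potential moves to the right-hand side. -/
theorem change (hu : HasSch W u f) (W' : LinfR) : HasSch W' u (f + mulL ℝ (W' - W) u) := by
  obtain ⟨a, ha, ha'⟩ := hu
  refine ⟨a, ha, ?_⟩
  rw [ha', map_sub, sub_apply]; abel

end HasSch

/-- The first resolvent identity. -/
theorem resR_eq_resR_one {κ : ℝ} (hκ : 0 < κ) (g : L2R) :
    resR κ hκ g = resR 1 one_pos (g + (1 - κ) • resR κ hκ g) := by
  apply toC_injective
  rw [toC_resR, toC_resR]
  have h1 : resC κ hκ (toC g) ∈ negLaplacian.domain := resC_mem_H2 hκ _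
  have h2 := resC_negLaplacian one_pos ⟨_, h1⟩
  rw [negLaplacian_resC hκ (toC g) h1] at h2
  refine h2.symm.trans ?_
  congr 1
  rw [toC_add, toC_smul, toC_resR]
  push_cast
  simp only [one_smul, sub_smul]
  abel

/-- The resolvent `(-Δ + κ)⁻¹` at any `κ > 0` has values in the range of the one at `κ = 1`, through
which `HasSch` is defined. -/
theorem hasSch_resR {κ : ℝ} (hκ : 0 < κ) (W : LinfR) (g : L2R) :
    HasSch W (resR κ hκ g) (g - κ • resR κ hκ g + mulL ℝ W (resR κ hκ g)) := by
  refine ⟨g + (1 - κ) • resR κ hκ g, resR_eq_resR_one hκ g, ?_⟩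
  rw [sub_smul, one_smul]; abel

theorem HasSch.exists_resR {κ : ℝ} (hκ : 0 < κ) {W : LinfR} {u f : L2R} (h : HasSch W u f) :
    u = resR κ hκ (f + κ • u - mulL ℝ W u) := by
  obtain ⟨g, hu, hf⟩ := h
  apply toC_injective
  have h1 : toC u ∈ negLaplacian.domain := by
    rw [hu, toC_resR]; exact resC_mem_H2 one_pos _
  have h3 : negLaplacian ⟨toC u, h1⟩ = toC g - toC u := by
    have h4 := negLaplacian_resC one_pos (toC g) (resC_mem_H2 one_pos _)
    have h5 : (⟨toC u, h1⟩ : negLaplacian.domain) =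
        ⟨resC 1 one_pos (toC g), resC_mem_H2 one_pos _⟩ :=
      Subtype.ext ((congrArg toC hu).trans (toC_resR _ _))
    rw [h5, h4, ← toC_resR, ← hu]; simp
  have h2 := resC_negLaplacian hκ ⟨_, h1⟩
  rw [h3] at h2
  rw [toC_resR]
  refine h2.symm.trans ?_
  congr 1
  rw [hf]
  simp only [toC_add, toC_sub, toC_smul]
  abel

/-- `(-Δ + W) u` is determined by `u`. -/
theorem HasSch.unique {W : LinfR} {u f h : L2R} (hu : HasSch W u f) (hu' : HasSch W u h) :
    f = h := by
  obtain ⟨a, ha, ha'⟩ := hu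
  obtain ⟨b, hb, hb'⟩ := hu'
  have h4 := negLaplacian_resC one_pos (toC a) (resC_mem_H2 one_pos _)
  have h5 := negLaplacian_resC one_pos (toC b) (resC_mem_H2 one_pos _)
  have h6 : (⟨resC 1 one_pos (toC a), resC_mem_H2 one_pos _⟩ : negLaplacian.domain) =
      ⟨resC 1 one_pos (toC b), resC_mem_H2 one_pos _⟩ :=
    Subtype.ext ((toC_resR _ _).symm.trans ((congrArg toC (ha.symm.trans hb)).trans (toC_resR _ _)))
  rw [h6, h5, ← toC_resR, ← toC_resR, ← ha, ← hb] at h4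
  have h7 : toC a = toC b := by simpa using h4.symm
  rw [ha', hb', toC_injective h7]

theorem isCompactOperator_mulL_comp_resR {V : LinfR} (hV : MemLp V 2 volume) {κ : ℝ}
    (hκ : 0 < κ) : IsCompactOperator (mulL ℝ V ∘L resR κ hκ) := by
  have h2 : MemLp (cInf V) 2 volume :=
    (memLp_congr_ae (coeFn_cInf V)).2 hV.ofReal
  have h3 := isCompactOperator_mulL_comp_resC hκ (cInf V) h2
  have h4 : (⇑(mulL ℝ V ∘L resR κ hκ) : L2R → L2R) =
      reL ∘ ((mulL ℂ (cInf V) ∘L resC κ hκ) ∘ ofR) := by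
    ext1 f
    simp only [ContinuousLinearMap.comp_apply, Function.comp, reL_mulL, reL_resC,
      show ofR f = toC f from rfl, reL_toC]
  rw [h4]
  exact (h3.comp_clm ofR).clm_comp reL

/-- If `K` is compact and `-1` is not an eigenvalue of `K`, then `1 + K` is invertible. -/
theorem exists_inverse_one_add {K : L2R →L[ℝ] L2R} (hK : IsCompactOperator K)
    (h : ∀ g, K g = -g → g = 0) :
    ∃ B : L2R →L[ℝ] L2R, (∀ f, B f + K (B f) = f) ∧ ∀ f, B (f + K f) = f := by
  have hno : ¬ Module.End.HasEigenvalue (K : Module.End ℝ L2R) (-1) := by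
    intro h'
    obtain ⟨g, hg⟩ := h'.exists_hasEigenvector
    have h1 : K g = -g := by simpa using hg.apply_eq_smul
    exact hg.2 (h g h1)
  have hres : (-1 : ℝ) ∈ resolventSet ℝ K :=
    (hK.hasEigenvalue_or_mem_resolventSet (by norm_num)).resolve_left hno
  rw [spectrum.mem_resolventSet_iff] at hres
  have hres' : IsUnit (1 + K) := by
    have := hres.neg
    convert this using 1
    rw [Algebra.algebraMap_eq_smul_one]
    simp [add_comm]
  obtain ⟨U, hU⟩ := hres'
  have a1 : (1 + K) * ↑(U⁻¹) = 1 := by rw [← hU]; exact U.mul_inv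
  have a2 : ↑(U⁻¹) * (1 + K) = 1 := by rw [← hU]; exact U.inv_mul
  exact ⟨↑(U⁻¹), fun f => congrArg (fun T : L2R →L[ℝ] L2R => T f) a1,
    fun f => congrArg (fun T : L2R →L[ℝ] L2R => T f) a2⟩

/-- The Fredholm alternative for `-Δ + V - λ + P` with `λ < 0`, a potential `V` in `L² ∩ L^∞` and
a compact `P`: if the operator is injective, it has a bounded inverse, whose range consists of
functions in the range of the free resolvent. -/
theorem exists_inverse {V : LinfR} (hV : MemLp V 2 volume) {l : ℝ} (hl : l < 0)
    (P : L2R →L[ℝ] L2R) (hP : IsCompactOperator P)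
    (hinj : ∀ u, HasSch V u (l • u - P u) → u = 0) :
    ∃ A : L2R →L[ℝ] L2R,
      (∀ f, HasSch V (resR 1 one_pos (A f))
        (f + l • resR 1 one_pos (A f) - P (resR 1 one_pos (A f)))) ∧
      ∀ u f, HasSch V u (f + l • u - P u) → u = resR 1 one_pos (A f) := by
  have hκ : 0 < -l := by linarith
  have hKc : IsCompactOperator ((mulL ℝ V + P) ∘L resR (-l) hκ) := by
    rw [ContinuousLinearMap.add_comp]
    exact (isCompactOperator_mulL_comp_resR hV hκ).add (hP.comp_clm _)
  have hKe : ∀ g, ((mulL ℝ V + P) ∘L resR (-l) hκ) g =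
      mulL ℝ V (resR (-l) hκ g) + P (resR (-l) hκ g) := fun g => rfl
  generalize (mulL ℝ V + P) ∘L resR (-l) hκ = K at hKc hKe
  obtain ⟨B, hB1, hB2⟩ := exists_inverse_one_add hKc (by
    intro g hg
    have h2 := hasSch_resR hκ V g
    rw [hKe] at hg
    have h5 : ∀ r m p : L2R, m + p = -g → g - (-l) • r + m = l • r - p := by
      intro r m p h
      have h6 : g = -(m + p) := by rw [h, neg_neg]
      rw [h6, neg_smul]; abel
    rw [h5 _ _ _ hg] at h2
    have h4 := hinj _ h2
    rw [h4, map_zero, map_zero, add_zero] at hg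
    exact neg_eq_zero.1 hg.symm)
  have e : ∀ f, resR 1 one_pos (((1 + (1 + l) • resR (-l) hκ) ∘L B) f) =
      resR (-l) hκ (B f) := by
    intro f
    refine Eq.trans ?_ (resR_eq_resR_one hκ (B f)).symm
    rw [sub_neg_eq_add]
    rfl
  refine ⟨(1 + (1 + l) • resR (-l) hκ) ∘L B, ?_, ?_⟩
  · intro f
    rw [e]
    have h1 := hasSch_resR hκ V (B f)
    have h2 := hB1 f
    rw [hKe] at h2
    have h5 : ∀ b r m p : L2R, b + (m + p) = f → b - (-l) • r + m = f + l • r - p := by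
      intro b r m p h
      rw [← h, neg_smul]; abel
    rwa [h5 _ _ _ _ h2] at h1
  · intro u f hu
    rw [e]
    have h1 := hu.exists_resR hκ
    have h5 : ∀ m p : L2R, f + l • u - p + (-l) • u - m + (m + p) = f := by
      intro m p
      rw [neg_smul]; abel
    have h6 := h5 (mulL ℝ V u) (P u)
    generalize f + l • u - P u + (-l) • u - mulL ℝ V u = g at h1 h6
    have h3 := hB2 g
    have h7 := hKe g
    rw [h7] at h3
    subst h1
    rw [h6] at h3
    rw [h3]

end

section

open scoped ContDiff

/-! ### Analytic implicit functions -/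

section Implicit

variable {Y Z : Type*} [NormedAddCommGroup Y] [NormedSpace ℝ Y] [CompleteSpace Y]
  [NormedAddCommGroup Z] [NormedSpace ℝ Z] [CompleteSpace Z]

/-- The analytic implicit function theorem for a curve of solutions. -/
theorem exists_analytic_implicit {Φ : ℝ × Y → Z} {y₀ : Y} (hΦ : ContDiffAt ℝ ω Φ (0, y₀))
    (h0 : Φ (0, y₀) = 0) (A : Y ≃L[ℝ] Z)
    (hA : HasFDerivAt (fun y => Φ (0, y)) (A : Y →L[ℝ] Z) y₀) :
    ∃ f : ℝ → Y, AnalyticAt ℝ f 0 ∧ f 0 = y₀ ∧ (∀ᶠ t in 𝓝 0, Φ (t, f t) = 0) ∧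
      ∀ᶠ v in 𝓝 ((0 : ℝ), y₀), Φ v = 0 → f v.1 = v.2 := by
  have hn : (ω : ℕ∞ω) ≠ 0 := by simp
  have hd : HasFDerivAt Φ (fderiv ℝ Φ (0, y₀)) (0, y₀) :=
    (hΦ.differentiableAt hn).hasFDerivAt
  have hc : fderiv ℝ Φ (0, y₀) ∘L .inr ℝ ℝ Y = A := by
    have h1 : HasFDerivAt (fun y : Y => ((0 : ℝ), y)) (ContinuousLinearMap.inr ℝ ℝ Y) y₀ :=
      hasFDerivAt_prodMk_right 0 y₀
    exact (hd.comp y₀ h1).unique hA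
  have hi : (fderiv ℝ Φ (0, y₀) ∘L .inr ℝ ℝ Y).IsInvertible := ⟨A, hc.symm⟩
  refine ⟨hΦ.implicitFunction hn hi, ?_, hΦ.implicitFunction_apply_self hn hi, ?_, ?_⟩
  · exact (hΦ.contDiffAt_implicitFunction hn hi).analyticAt
  · have := hΦ.eventually_apply_implicitFunction hn hi
    simpa only [h0] using this
  · have := hΦ.eventually_apply_eq_iff_implicitFunction hn hi
    filter_upwards [this] with v hv h
    exact hv.1 (h.trans h0.symm)

/-- For the equation `A f = n₀ + t G(t, f)` with `A` invertible and `G` analytic and bounded on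
bounded sets, all solutions in a given ball lie on one analytic curve when `t` is small. -/
theorem exists_analytic_branch (A : Y ≃L[ℝ] Z) (n₀ : Z) {G : ℝ × Y → Z} (hG : ContDiff ℝ ω G)
    (hb : ∀ C : ℝ, ∃ M : ℝ, ∀ (t : ℝ) (y : Y), |t| ≤ 1 → ‖y‖ ≤ C → ‖G (t, y)‖ ≤ M) :
    ∃ f : ℝ → Y, AnalyticAt ℝ f 0 ∧ ∀ C : ℝ, ∀ᶠ t in 𝓝 (0 : ℝ), ∀ y : Y, ‖y‖ ≤ C →
      A y = n₀ + t • G (t, y) → f t = y := by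
  have hΦ : ContDiff ℝ ω fun v : ℝ × Y => A v.2 - n₀ - v.1 • G v := by fun_prop
  have h0 : A (A.symm n₀) - n₀ - (0 : ℝ) • G (0, A.symm n₀) = 0 := by simp
  obtain ⟨f, hf, -, -, hu⟩ := exists_analytic_implicit (y₀ := A.symm n₀) hΦ.contDiffAt h0 A (by
    simp only [zero_smul, sub_zero]
    exact A.hasFDerivAt.sub_const n₀)
  refine ⟨f, hf, fun C => ?_⟩
  obtain ⟨M, hM⟩ := hb C
  obtain ⟨r, hr, hball⟩ := Metric.eventually_nhds_iff.1 hu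
  have hcont : Tendsto (fun t : ℝ => ‖(A.symm : Z →L[ℝ] Y)‖ * (|t| * |M|)) (𝓝 0) (𝓝 0) := by
    have : Continuous fun t : ℝ => ‖(A.symm : Z →L[ℝ] Y)‖ * (|t| * |M|) := by fun_prop
    simpa using this.tendsto 0
  filter_upwards [hcont.eventually (gt_mem_nhds hr), Metric.ball_mem_nhds (0 : ℝ) hr,
    Metric.ball_mem_nhds (0 : ℝ) one_pos] with t ht1 ht2 ht3 y hy hAy
  have ht3' : |t| ≤ 1 := by simpa using (Metric.mem_ball.1 ht3).le
  refine hball (y := (t, y)) ?_ ?_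
  · rw [Prod.dist_eq]
    refine max_lt (by simpa using ht2) ?_
    have e : y - A.symm n₀ = A.symm (t • G (t, y)) := by
      apply A.injective
      rw [map_sub, A.apply_symm_apply, A.apply_symm_apply, hAy]; abel
    change dist y (A.symm n₀) < r
    rw [dist_eq_norm, e]
    refine lt_of_le_of_lt ?_ ht1
    refine ((A.symm : Z →L[ℝ] Y).le_opNorm _).trans ?_
    gcongr
    rw [norm_smul, Real.norm_eq_abs]
    gcongr
    exact (hM t y ht3' hy).trans (le_abs_self M)
  · simp only [hAy]; abel

end Implicit

section Invariant

variable {Y K : Type*} [NormedAddCommGroup Y] [NormedSpace ℝ Y] [CompleteSpace Y]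
  [NormedAddCommGroup K] [NormedSpace ℝ K] [CompleteSpace K]

/-- Continuation of an invariant subspace: `ι` parametrizes an eigenspace of an operator `L₀`,
with eigenvalue `λ`, `π` is a left inverse of `ι`, and `S` is a reduced resolvent at `λ`.  Then
`U = ι + S r` solves `(L₀ + F t) U = U (λ + B)`. -/
theorem exists_analytic_invariant (ι : K →L[ℝ] Y) (π : Y →L[ℝ] K) (hπ : ∀ x, π (ι x) = x)
    (S : Y →L[ℝ] Y) {F : ℝ → Y →L[ℝ] Y} (hF : AnalyticAt ℝ F 0) (hF0 : F 0 = 0) :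
    ∃ (r : ℝ → K →L[ℝ] Y) (B : ℝ → K →L[ℝ] K), AnalyticAt ℝ r 0 ∧ AnalyticAt ℝ B 0 ∧
      r 0 = 0 ∧ B 0 = 0 ∧ ∀ᶠ t in 𝓝 0,
        (∀ x, r t x + F t (ι x + S (r t x)) = ι (B t x) + S (r t (B t x))) ∧
        ∀ x, π (r t x) = 0 := by
  let Φ : ℝ × ((K →L[ℝ] Y) × (K →L[ℝ] K)) → (K →L[ℝ] Y) × (K →L[ℝ] K) := fun v =>
    (v.2.1 + F v.1 ∘L (ι + S ∘L v.2.1) - (ι + S ∘L v.2.1) ∘L v.2.2, π ∘L v.2.1)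
  have hF' : ContDiffAt ℝ ω F 0 := hF.contDiffAt
  have hΦ : ContDiffAt ℝ ω Φ (0, 0) := by
    have h1 : ContDiffAt ℝ ω (fun v : ℝ × ((K →L[ℝ] Y) × (K →L[ℝ] K)) => F v.1) (0, 0) :=
      ContDiffAt.comp (0, 0) (f := Prod.fst) hF' contDiffAt_fst
    have h2 : ContDiffAt ℝ ω (fun v : ℝ × ((K →L[ℝ] Y) × (K →L[ℝ] K)) => ι + S ∘L v.2.1) (0, 0) :=
      contDiffAt_const.add (contDiffAt_const.clm_comp (contDiffAt_fst.comp _ contDiffAt_snd))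
    have h3 : ContDiffAt ℝ ω (fun v : ℝ × ((K →L[ℝ] Y) × (K →L[ℝ] K)) => v.2.2) (0, 0) :=
      contDiffAt_snd.comp _ contDiffAt_snd
    have h4 : ContDiffAt ℝ ω (fun v : ℝ × ((K →L[ℝ] Y) × (K →L[ℝ] K)) => v.2.1) (0, 0) :=
      contDiffAt_fst.comp _ contDiffAt_snd
    exact ((h4.add (h1.clm_comp h2)).sub (h2.clm_comp h3)).prodMk (contDiffAt_const.clm_comp h4)
  -- the derivative `(r, B) ↦ (r - ι B, π r)` has the explicit inverse
  -- `(a, b) ↦ (a + ι (b - π a), b - π a)`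
  let A : ((K →L[ℝ] Y) × (K →L[ℝ] K)) ≃L[ℝ] (K →L[ℝ] Y) × (K →L[ℝ] K) :=
    { toFun := fun v => (v.1 - ι ∘L v.2, π ∘L v.1)
      map_add' := fun v w => by
        ext x <;> simp <;> abel
      map_smul' := fun c v => by
        ext x <;> simp [smul_sub]
      invFun := fun v => (v.1 + ι ∘L (v.2 - π ∘L v.1), v.2 - π ∘L v.1)
      left_inv := fun v => by
        ext x <;> simp [hπ]
      right_inv := fun v => by
        ext x <;> simp [hπ]
      continuous_toFun := by fun_prop
      continuous_invFun := by fun_prop }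
  have hA : HasFDerivAt (fun y => Φ (0, y)) (A : _ →L[ℝ] _) 0 := by
    have hS : HasFDerivAt (fun y : (K →L[ℝ] Y) × (K →L[ℝ] K) => (ι + S ∘L y.1))
        ((ContinuousLinearMap.compL ℝ K Y Y S) ∘L ContinuousLinearMap.fst ℝ _ _) 0 :=
      (((ContinuousLinearMap.compL ℝ K Y Y S) ∘L
        ContinuousLinearMap.fst ℝ (K →L[ℝ] Y) (K →L[ℝ] K)).hasFDerivAt).const_add ι
    have h1 := hS.clm_comp (hasFDerivAt_snd (𝕜 := ℝ) (p := (0 : (K →L[ℝ] Y) × (K →L[ℝ] K))))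
    have h2 := ((hasFDerivAt_fst (𝕜 := ℝ) (p := (0 : (K →L[ℝ] Y) × (K →L[ℝ] K)))).sub h1).prodMk
      (((ContinuousLinearMap.compL ℝ K Y K π) ∘L
        ContinuousLinearMap.fst ℝ (K →L[ℝ] Y) (K →L[ℝ] K)).hasFDerivAt (x := 0))
    refine (h2.congr_fderiv ?_).congr_of_eventuallyEq (Eventually.of_forall fun y => ?_)
    · ext v x <;> simp [A]
    · simp only [Φ, hF0]
      ext x <;> simp
  obtain ⟨f, hf, hf0, hfe, -⟩ := exists_analytic_implicit (y₀ := 0) hΦ (by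
    simp [Φ, hF0]) A hA
  refine ⟨fun t => (f t).1, fun t => (f t).2, ?_, ?_, ?_, ?_, ?_⟩
  · exact (ContinuousLinearMap.fst ℝ (K →L[ℝ] Y) (K →L[ℝ] K)).analyticAt _ |>.comp hf
  · exact (ContinuousLinearMap.snd ℝ (K →L[ℝ] Y) (K →L[ℝ] K)).analyticAt _ |>.comp hf
  · simp [hf0]
  · simp [hf0]
  · filter_upwards [hfe] with t ht
    obtain ⟨e1, e2⟩ := Prod.ext_iff.1 ht
    refine ⟨fun x => ?_, fun x => ?_⟩
    · have := congrArg (fun T : K →L[ℝ] Y => T x) e1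
      simpa [Φ, sub_eq_zero] using this
    · exact congrArg (fun T : K →L[ℝ] K => T x) e2

end Invariant

end

section

open scoped ContDiff

/-! ### Analytic perturbation of eigenvalues -/

section Rellich

theorem _root_.AnalyticAt.clmApply {E F G : Type*} [NormedAddCommGroup E] [NormedSpace ℝ E]
    [NormedAddCommGroup F] [NormedSpace ℝ F] [NormedAddCommGroup G] [NormedSpace ℝ G]
    {f : E → F →L[ℝ] G} {g : E → F} {x : E} (hf : AnalyticAt ℝ f x) (hg : AnalyticAt ℝ g x) :
    AnalyticAt ℝ (fun t => f t (g t)) x :=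
  ((ContinuousLinearMap.id ℝ (F →L[ℝ] G)).analyticAt_bilinear (f x, g x)).comp₂ hf hg

theorem _root_.AnalyticAt.clmComp {E F G H : Type*} [NormedAddCommGroup E] [NormedSpace ℝ E]
    [NormedAddCommGroup F] [NormedSpace ℝ F] [NormedAddCommGroup G] [NormedSpace ℝ G]
    [NormedAddCommGroup H] [NormedSpace ℝ H] {f : E → G →L[ℝ] H} {g : E → F →L[ℝ] G} {x : E}
    (hf : AnalyticAt ℝ f x) (hg : AnalyticAt ℝ g x) : AnalyticAt ℝ (fun t => f t ∘L g t) x :=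
  ((ContinuousLinearMap.compL ℝ F G H).analyticAt_bilinear (f x, g x)).comp₂ hf hg

/-- A reduced resolvent of a symmetric operator on a finite-dimensional space. -/
theorem exists_reduced_inverse {K : Type*} [NormedAddCommGroup K] [InnerProductSpace ℝ K]
    [FiniteDimensional ℝ K] (T : K →L[ℝ] K) (hT : (T : K →ₗ[ℝ] K).IsSymmetric) (l : ℝ)
    (E : Submodule ℝ K) (hE : ∀ x, x ∈ E ↔ T x = l • x) :
    ∃ S : K →L[ℝ] K, ∀ r, E.orthogonalProjectionOnto r = 0 → T (S r) = l • S r + r := by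
  have key : ∀ x, inner ℝ (T x - l • x + E.starProjection x) (E.starProjection x) =
      ‖E.starProjection x‖ ^ 2 := by
    intro x
    have h1 : inner ℝ (T x) (E.starProjection x) = inner ℝ x (T (E.starProjection x)) := hT _ _
    rw [(hE _).1 (E.starProjection_apply_mem x)] at h1
    rw [inner_add_left, inner_sub_left, h1, real_inner_self_eq_norm_sq, inner_smul_left,
      inner_smul_right]
    simp
  let A : K →ₗ[ℝ] K := ((T - l • ContinuousLinearMap.id ℝ K + E.starProjection : K →L[ℝ] K) :
    K →ₗ[ℝ] K)
  have hA : ∀ x, A x = T x - l • x + E.starProjection x := fun x => by simp [A]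
  have hinj : Function.Injective A := by
    rw [← LinearMap.ker_eq_bot, LinearMap.ker_eq_bot']
    intro x hx
    rw [hA] at hx
    have h1 := key x
    rw [hx, inner_zero_left] at h1
    have h2 : E.starProjection x = 0 := norm_eq_zero.1 (pow_eq_zero_iff two_ne_zero |>.1 h1.symm)
    rw [h2, add_zero, sub_eq_zero] at hx
    rw [← h2, Submodule.starProjection_eq_self_iff.2 ((hE x).2 hx)]
  refine ⟨LinearMap.toContinuousLinearMap
    ((LinearEquiv.ofInjectiveEndo A hinj).symm : K →ₗ[ℝ] K), fun r hr => ?_⟩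
  have h1 : A ((LinearEquiv.ofInjectiveEndo A hinj).symm r) = r :=
    (LinearEquiv.ofInjectiveEndo A hinj).apply_symm_apply r
  change T ((LinearEquiv.ofInjectiveEndo A hinj).symm r) =
    l • ((LinearEquiv.ofInjectiveEndo A hinj).symm r) + r
  generalize (LinearEquiv.ofInjectiveEndo A hinj).symm r = x at h1
  rw [hA] at h1
  have h2 := key x
  rw [h1, real_inner_comm, (Submodule.mem_orthogonal E r).1
    (E.orthogonalProjectionOnto_eq_zero_iff.1 hr) _ (E.starProjection_apply_mem x)] at h2
  have h3 : E.starProjection x = 0 := norm_eq_zero.1 (pow_eq_zero_iff two_ne_zero |>.1 h2.symm)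
  rw [h3, add_zero] at h1
  rw [← h1]; abel

variable {Y : Type*} [NormedAddCommGroup Y] [NormedSpace ℝ Y]

theorem analyticAt_form (Φ : Y →L[ℝ] Y →L[ℝ] ℝ) {a b : ℝ → Y} (ha : AnalyticAt ℝ a 0)
    (hb : AnalyticAt ℝ b 0) : AnalyticAt ℝ (fun t => Φ (a t) (b t)) 0 :=
  (Φ.analyticAt_bilinear (a 0, b 0)).comp₂ ha hb

/-- Gram–Schmidt orthogonalization depending analytically on a parameter, for the forms
`(x, y) ↦ Φ (U t x) (U t y)`. -/
theorem exists_analytic_orthogonal (Φ : Y →L[ℝ] Y →L[ℝ] ℝ) (hsym : ∀ a b, Φ a b = Φ b a)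
    {K : Type*} [NormedAddCommGroup K] [InnerProductSpace ℝ K] {U : ℝ → K →L[ℝ] Y}
    (hU : AnalyticAt ℝ U 0) (hU0 : ∀ x y, Φ (U 0 x) (U 0 y) = inner ℝ x y) :
    ∀ (n : ℕ) (v : Fin n → K), Orthonormal ℝ v → ∃ e : Fin n → ℝ → K,
      (∀ i, AnalyticAt ℝ (e i) 0) ∧ (∀ i, e i 0 = v i) ∧
      ∀ i j, i ≠ j → ∀ᶠ t in 𝓝 0, Φ (U t (e i t)) (U t (e j t)) = 0 := by
  intro n
  induction n with
  | zero => exact fun v _ => ⟨fun i => i.elim0, fun i => i.elim0, fun i => i.elim0,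
      fun i => i.elim0⟩
  | succ n ih =>
    intro v hv
    obtain ⟨e, he1, he2, he3⟩ := ih (fun i => v i.castSucc)
      (hv.comp _ (Fin.castSucc_injective n))
    have hUe : ∀ i, AnalyticAt ℝ (fun t => U t (e i t)) 0 := fun i => hU.clmApply (he1 i)
    have hUv : AnalyticAt ℝ (fun t => U t (v (Fin.last n))) 0 := hU.clmApply analyticAt_const
    have hne : ∀ i, Φ (U 0 (e i 0)) (U 0 (e i 0)) ≠ 0 := by
      intro i
      rw [hU0, he2, real_inner_self_eq_norm_sq, hv.1]; norm_num
    let w : ℝ → K := fun t => v (Fin.last n) -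
      ∑ i, (Φ (U t (v (Fin.last n))) (U t (e i t)) / Φ (U t (e i t)) (U t (e i t))) • e i t
    have hw : AnalyticAt ℝ w 0 := by
      refine analyticAt_const.sub (Finset.analyticAt_fun_sum _ fun i _ => ?_)
      exact ((analyticAt_form Φ hUv (hUe i)).div (analyticAt_form Φ (hUe i) (hUe i))
        (hne i)).smul (he1 i)
    have hw0 : w 0 = v (Fin.last n) := by
      simp only [w]
      rw [Finset.sum_eq_zero, sub_zero]
      intro i _
      rw [hU0, he2, hv.2 (Fin.castSucc_lt_last i).ne', zero_div, zero_smul]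
    have horth : ∀ j, ∀ᶠ t in 𝓝 0, Φ (U t (w t)) (U t (e j t)) = 0 := by
      intro j
      have h1 : ∀ᶠ t in 𝓝 (0 : ℝ), Φ (U t (e j t)) (U t (e j t)) ≠ 0 :=
        (analyticAt_form Φ (hUe j) (hUe j)).continuousAt.eventually_ne (hne j)
      have h2 : ∀ᶠ t in 𝓝 (0 : ℝ), ∀ i, i ≠ j → Φ (U t (e i t)) (U t (e j t)) = 0 := by
        rw [eventually_all]
        intro i
        by_cases h : i = j
        · exact Eventually.of_forall fun t h' => (h' h).elim
        · filter_upwards [he3 i j h] with t ht _ using ht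
      filter_upwards [h1, h2] with t h1 h2
      simp only [w, map_sub, map_sum, map_smul, sub_apply, sum_apply, smul_apply, smul_eq_mul]
      rw [Finset.sum_eq_single j (fun i _ hi => by rw [h2 i hi, mul_zero]) (by simp),
        div_mul_cancel₀ _ h1, sub_self]
    refine ⟨Fin.snoc (α := fun _ => ℝ → K) e w, ?_, ?_, ?_⟩
    · intro i
      refine Fin.lastCases ?_ (fun i => ?_) i
      · simpa using hw
      · simpa using he1 i
    · intro i
      refine Fin.lastCases ?_ (fun i => ?_) i
      · simpa using hw0
      · simpa using he2 i
    · intro i j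
      refine Fin.lastCases ?_ (fun i => ?_) i <;> refine Fin.lastCases ?_ (fun j => ?_) j
      · simp
      · intro _; simpa using horth j
      · intro _
        filter_upwards [horth i] with t ht
        rw [hsym]; simpa using ht
      · intro h
        simpa using he3 i j (fun h' => h (by rw [h']))

/-- Rellich's theorem. Let `B t` be an analytic family of operators on a finite-dimensional space
`K`, symmetric with respect to the forms `(x, y) ↦ Φ (U t x) (U t y)`, which reduce to the inner
product of `K` at `t = 0`. Then `B t` has a basis of eigenvectors which is orthogonal for these
forms and analytic up to `t = 0`. The induction is on the dimension: after subtracting a scalar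
family and dividing by a power of `t`, the leading coefficient is not a scalar, and its eigenspaces
continue to invariant subspaces of smaller dimension. -/
theorem exists_analytic_eigenvectors (Φ : Y →L[ℝ] Y →L[ℝ] ℝ) (hsym : ∀ a b, Φ a b = Φ b a)
    (n : ℕ) : ∀ (K : Type) [NormedAddCommGroup K] [InnerProductSpace ℝ K]
    [FiniteDimensional ℝ K], Module.finrank ℝ K = n → ∀ (U : ℝ → K →L[ℝ] Y) (B : ℝ → K →L[ℝ] K),
    AnalyticAt ℝ U 0 → AnalyticAt ℝ B 0 → (∀ x y, Φ (U 0 x) (U 0 y) = inner ℝ x y) →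
    (∀ᶠ t in 𝓝 0, ∀ x y, Φ (U t (B t x)) (U t y) = Φ (U t x) (U t (B t y))) →
    ∃ (I : Type) (_ : Fintype I) (e : I → ℝ → K) (b : I → ℝ → ℝ), Fintype.card I = n ∧
      (∀ i, AnalyticAt ℝ (e i) 0) ∧ (∀ i, AnalyticAt ℝ (b i) 0) ∧ (∀ i, e i 0 ≠ 0) ∧
      (∀ i, ∀ᶠ t in 𝓝 0, B t (e i t) = b i t • e i t) ∧
      ∀ i j, i ≠ j → ∀ᶠ t in 𝓝 0, Φ (U t (e i t)) (U t (e j t)) = 0 := by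
  induction n using Nat.strong_induction_on with
  | _ n ih =>
  intro K _ _ _ hn U B hU hB hU0 hUB
  rcases Nat.eq_zero_or_pos n with rfl | hpos
  · exact ⟨Empty, inferInstance, fun i => i.elim, fun i => i.elim, by simp, fun i => i.elim,
      fun i => i.elim, fun i => i.elim, fun i => i.elim, fun i => i.elim⟩
  subst hn
  let v := stdOrthonormalBasis ℝ K
  let i₀ : Fin (Module.finrank ℝ K) := ⟨0, hpos⟩
  -- subtract a scalar operator which makes a diagonal entry vanish identically
  let τ : ℝ → ℝ := fun t => inner ℝ (v i₀) (B t (v i₀))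
  have hτ : AnalyticAt ℝ τ 0 :=
    (innerSL ℝ (v i₀)).analyticAt _ |>.comp (hB.clmApply analyticAt_const)
  have hC : AnalyticAt ℝ (fun t => B t - τ t • ContinuousLinearMap.id ℝ K) 0 :=
    hB.sub (hτ.smul analyticAt_const)
  by_cases hsc : ∀ᶠ t in 𝓝 0, B t - τ t • ContinuousLinearMap.id ℝ K = 0
  · obtain ⟨e, he1, he2, he3⟩ := exists_analytic_orthogonal Φ hsym hU hU0 _ v v.orthonormal
    refine ⟨Fin (Module.finrank ℝ K), inferInstance, e, fun _ => τ, by simp, he1, fun _ => hτ,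
      fun i => ?_, fun i => ?_, he3⟩
    · rw [he2]; exact v.orthonormal.ne_zero i
    · filter_upwards [hsc] with t ht
      rw [sub_eq_zero] at ht
      rw [ht]; simp
  -- divide by the order of vanishing at `t = 0`
  obtain ⟨k, D, hD, hD0, hDC⟩ := hC.exists_eventuallyEq_pow_smul_nonzero_iff.2 hsc
  have hBD : ∀ᶠ t in 𝓝 0, ∀ x, B t x = τ t • x + t ^ k • D t x := by
    filter_upwards [hDC] with t ht x
    have := congrArg (fun T : K →L[ℝ] K => T x) ht
    simp only [sub_apply, smul_apply, sub_zero] at this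
    rw [← this]; simp
  have hDsymm : ∀ᶠ t in 𝓝[≠] 0, ∀ x y,
      Φ (U t (D t x)) (U t y) = Φ (U t x) (U t (D t y)) := by
    filter_upwards [self_mem_nhdsWithin, hUB.filter_mono nhdsWithin_le_nhds,
      hBD.filter_mono nhdsWithin_le_nhds] with t ht h1 h2 x y
    have := h1 x y
    rw [h2, h2] at this
    simp only [map_add, map_smul, add_apply, smul_apply, smul_eq_mul] at this
    exact mul_left_cancel₀ (pow_ne_zero k ht) (by linarith)
  have hDsymm0 : ∀ x y, inner ℝ (D 0 x) y = inner ℝ x (D 0 y) := by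
    intro x y
    rw [← hU0, ← hU0]
    have h1 : ContinuousAt (fun t => Φ (U t (D t x)) (U t y)) 0 :=
      (analyticAt_form Φ (hU.clmApply (hD.clmApply analyticAt_const))
        (hU.clmApply analyticAt_const)).continuousAt
    have h2 : ContinuousAt (fun t => Φ (U t x) (U t (D t y))) 0 :=
      (analyticAt_form Φ (hU.clmApply analyticAt_const)
        (hU.clmApply (hD.clmApply analyticAt_const))).continuousAt
    refine tendsto_nhds_unique_of_eventuallyEq (h1.tendsto.mono_left nhdsWithin_le_nhds)
      (h2.tendsto.mono_left nhdsWithin_le_nhds) (l := 𝓝[≠] 0) ?_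
    filter_upwards [hDsymm] with t ht using ht x y
  have hDsymm' : ∀ᶠ t in 𝓝 0, ∀ x y,
      Φ (U t (D t x)) (U t y) = Φ (U t x) (U t (D t y)) := by
    rw [eventually_nhdsWithin_iff] at hDsymm
    filter_upwards [hDsymm] with t ht x y
    by_cases h : t = 0
    · subst h; rw [hU0, hU0, hDsymm0]
    · exact ht h x y
  have hT : (D 0 : K →ₗ[ℝ] K).IsSymmetric := hDsymm0
  -- the leading coefficient `D 0` is not a scalar, so its eigenspaces have smaller dimension
  have hlt : ∀ l : ℝ, Module.finrank ℝ (Module.End.eigenspace (D 0 : K →ₗ[ℝ] K) l) <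
      Module.finrank ℝ K := by
    intro l
    refine Submodule.finrank_lt fun htop => hD0 ?_
    have h1 : ∀ x, D 0 x = l • x := fun x => by
      have : x ∈ Module.End.eigenspace (D 0 : K →ₗ[ℝ] K) l := by rw [htop]; trivial
      exact Module.End.mem_eigenspace_iff.1 this
    have h2 : ∀ᶠ t in 𝓝[≠] (0 : ℝ), inner ℝ (v i₀) (D t (v i₀)) = 0 := by
      filter_upwards [self_mem_nhdsWithin, hBD.filter_mono nhdsWithin_le_nhds] with t ht h
      have h3 : inner ℝ (v i₀) (B t (v i₀)) = τ t := rfl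
      rw [h, inner_add_right, inner_smul_right, inner_smul_right, real_inner_self_eq_norm_sq,
        v.orthonormal.1] at h3
      have h4 : t ^ k * inner ℝ (v i₀) (D t (v i₀)) = 0 := by linarith
      exact (mul_eq_zero.1 h4).resolve_left (pow_ne_zero k ht)
    have h5 : ContinuousAt (fun t => inner ℝ (v i₀) (D t (v i₀))) 0 :=
      ((innerSL ℝ (v i₀)).analyticAt _ |>.comp (hD.clmApply analyticAt_const)).continuousAt
    have h6 : inner ℝ (v i₀) (D 0 (v i₀)) = 0 :=
      tendsto_nhds_unique_of_eventuallyEq (h5.tendsto.mono_left nhdsWithin_le_nhds)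
        (tendsto_const_nhds (x := (0 : ℝ))) (l := 𝓝[≠] 0) h2
    rw [h1, inner_smul_right, real_inner_self_eq_norm_sq, v.orthonormal.1] at h6
    have h7 : l = 0 := by linarith
    ext x; rw [h1, h7]; simp
  -- apply the induction hypothesis to the continuation of every eigenspace of `D 0`
  have hblock : ∀ l : Module.End.Eigenvalues (D 0 : K →ₗ[ℝ] K),
      ∃ (I : Type) (_ : Fintype I) (e : I → ℝ → K) (d : I → ℝ → ℝ),
        Fintype.card I = Module.finrank ℝ (Module.End.eigenspace (D 0 : K →ₗ[ℝ] K) l) ∧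
        (∀ i, AnalyticAt ℝ (e i) 0) ∧ (∀ i, AnalyticAt ℝ (d i) 0) ∧ (∀ i, e i 0 ≠ 0) ∧
        (∀ i, d i 0 = l) ∧
        (∀ i, ∀ᶠ t in 𝓝 0, D t (e i t) = d i t • e i t) ∧
        ∀ i j, i ≠ j → ∀ᶠ t in 𝓝 0, Φ (U t (e i t)) (U t (e j t)) = 0 := by
    intro l
    set E := Module.End.eigenspace (D 0 : K →ₗ[ℝ] K) (l : ℝ) with hE
    have hEmem : ∀ x, x ∈ E ↔ D 0 x = (l : ℝ) • x := fun x => Module.End.mem_eigenspace_iff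
    obtain ⟨S, hS⟩ := exists_reduced_inverse (D 0) hT l E hEmem
    have hF : AnalyticAt ℝ (fun t => D t - D 0) 0 := hD.sub analyticAt_const
    obtain ⟨r, B', hr, hB', hr0, hB'0, hinv⟩ := exists_analytic_invariant E.subtypeL
      E.orthogonalProjectionOnto (fun x => by simp) S hF (by simp)
    let W : ℝ → E →L[ℝ] K := fun t => E.subtypeL + S ∘L r t
    have hW : AnalyticAt ℝ W 0 :=
      analyticAt_const.add ((ContinuousLinearMap.compL ℝ E K K S).analyticAt _ |>.comp hr)
    have hW0 : ∀ x, W 0 x = x := fun x => by simp [W, hr0]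
    let B₁ : ℝ → E →L[ℝ] E := fun t => (l : ℝ) • ContinuousLinearMap.id ℝ E + B' t
    have hB₁ : AnalyticAt ℝ B₁ 0 := analyticAt_const.add hB'
    have hDW : ∀ᶠ t in 𝓝 0, ∀ x, D t (W t x) = W t (B₁ t x) := by
      filter_upwards [hinv] with t ht x
      obtain ⟨h1, h2⟩ := ht
      have h3 := hS (r t x) (h2 x)
      have h4 := (hEmem x).1 x.2
      have h5 := h1 x
      simp only [sub_apply, map_add, Submodule.subtypeL_apply] at h5
      change D t ((x : K) + S (r t x)) = (((l : ℝ) • x + B' t x : E) : K) +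
        S (r t ((l : ℝ) • x + B' t x))
      rw [h3, h4] at h5
      rw [map_add, map_add, map_add, map_smul, map_smul, Submodule.coe_add, Submodule.coe_smul]
      have h6 : D t (x : K) + D t (S (r t x)) = (l : ℝ) • (x : K) + (l : ℝ) • S (r t x) +
          (r t x + (D t (x : K) - (l : ℝ) • (x : K) + (D t (S (r t x)) -
            ((l : ℝ) • S (r t x) + r t x)))) := by abel
      rw [h6, h5]
      abel
    have hUW : AnalyticAt ℝ (fun t => U t ∘L W t) 0 := hU.clmComp hW
    obtain ⟨I, hI, e, d, hc, he, hd, he0, hed, heo⟩ := ih (Module.finrank ℝ E) (hlt l) E rfl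
      (fun t => U t ∘L W t) B₁ hUW hB₁ (fun x y => by
        simp only [ContinuousLinearMap.comp_apply]
        rw [hU0, hW0, hW0]; rfl) (by
        filter_upwards [hDW, hDsymm'] with t h1 h2 x y
        simp only [ContinuousLinearMap.comp_apply]
        rw [← h1, ← h1, h2])
    refine ⟨I, hI, fun i t => W t (e i t), d, hc, fun i => hW.clmApply (he i), hd, fun i => ?_,
      fun i => ?_, fun i => ?_, fun i j hij => heo i j hij⟩
    · change W 0 (e i 0) ≠ 0
      rw [hW0]; simpa using he0 i
    · have h1 := (hed i).self_of_nhds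
      simp only [B₁, hB'0, add_zero, smul_apply, ContinuousLinearMap.id_apply] at h1
      rw [← sub_eq_zero, ← sub_smul, smul_eq_zero, sub_eq_zero] at h1
      exact (h1.resolve_right (he0 i)).symm
    · filter_upwards [hed i, hDW] with t h1 h2
      rw [h2, h1, map_smul]
  choose I hI e d hc he hd he0 hd0 hed heo using hblock
  refine ⟨Σ l, I l, inferInstance, fun p => e p.1 p.2, fun p t => τ t + t ^ k * d p.1 p.2 t,
    ?_, fun p => he p.1 p.2, fun p => ?_, fun p => he0 p.1 p.2, fun p => ?_, ?_⟩
  · have hint := hT.direct_sum_isInternal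
    have h1 := Module.finrank_eq_card_basis
      (hint.collectedBasis fun l => Module.finBasis ℝ (Module.End.eigenspace _ (l : ℝ)))
    rw [Fintype.card_sigma] at h1 ⊢
    rw [h1]
    refine Finset.sum_congr rfl fun l _ => ?_
    rw [hc, Fintype.card_fin]
  · exact hτ.add ((analyticAt_id.pow k).mul (hd p.1 p.2))
  · filter_upwards [hed p.1 p.2, hBD] with t h1 h2
    rw [h2, h1, smul_smul, ← add_smul]
  · rintro ⟨l, i⟩ ⟨m, j⟩ hij
    by_cases hlm : l = m
    · subst hlm
      exact heo l i j fun h => hij (by rw [h])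
    · have hne : ∀ᶠ t in 𝓝 0, d l i t - d m j t ≠ 0 := by
        refine ((hd l i).sub (hd m j)).continuousAt.eventually_ne ?_
        change d l i 0 - d m j 0 ≠ 0
        rw [hd0, hd0, sub_ne_zero]
        exact fun h => hlm (Subtype.ext h)
      filter_upwards [hne, hDsymm', hed l i, hed m j] with t h1 h2 h3 h4
      have h5 := h2 (e l i t) (e m j t)
      rw [h3, h4] at h5
      simp only [map_smul, smul_apply, smul_eq_mul] at h5
      refine (mul_eq_zero.1 ?_).resolve_left h1
      rw [sub_mul]; linarith

end Rellich

end

/-! ### Eigenspaces and reduced resolvents of Schrödinger operators -/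

/-- The real eigenspace of `-Δ + W`. -/
def realEig (W : LinfR) (l : ℝ) : Submodule ℝ L2R where
  carrier := {u | HasSch W u (l • u)}
  zero_mem' := by simpa using HasSch.zero (W := W)
  add_mem' := fun {u v} hu hv => by
    change HasSch W (u + v) (l • (u + v))
    rw [smul_add]; exact HasSch.add hu hv
  smul_mem' := fun c u hu => by
    change HasSch W (c • u) (l • (c • u))
    rw [smul_comm]; exact HasSch.smul c hu

theorem mem_realEig {W : LinfR} {l : ℝ} {u : L2R} : u ∈ realEig W l ↔ HasSch W u (l • u) :=
  Iff.rfl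

theorem ae_norm_le_norm_top (W : LinfR) : ∀ᵐ x, |W x| ≤ ‖W‖ := by
  have h := ae_le_eLpNormEssSup (f := W) (μ := (volume : Measure Space))
  filter_upwards [h] with x hx
  rw [← eLpNorm_exponent_top] at hx
  have h2 : ‖W‖ = (eLpNorm W ∞ volume).toReal := Lp.norm_def W
  rw [h2, ← Real.norm_eq_abs, ← toReal_enorm]
  exact ENNReal.toReal_mono (Lp.eLpNorm_ne_top W) hx

theorem eq_zero_of_inner_pos {k h : L2R} (hk : ∀ᵐ x, 0 < k x) (hh : 0 ≤ h)
    (h0 : inner ℝ k h = 0) : h = 0 := by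
  have hha := (Lp.coeFn_nonneg h).2 hh
  rw [L2.inner_def] at h0
  have hi := L2.integrable_inner (𝕜 := ℝ) k h
  rw [integral_eq_zero_iff_of_nonneg_ae ?_ hi] at h0
  · rw [Lp.eq_zero_iff_ae_eq_zero]
    filter_upwards [h0, hk] with x h1 h2
    simp only [Pi.zero_apply, RCLike.inner_apply, conj_trivial] at h1 ⊢
    exact (mul_eq_zero.1 h1).resolve_right h2.ne'
  · filter_upwards [hha, hk] with x h1 h2
    simp only [Pi.zero_apply, RCLike.inner_apply, conj_trivial] at h1 ⊢
    exact mul_nonneg h1 h2.le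

theorem inner_posPart_negPart (u : L2R) : inner ℝ u⁻ u⁺ = 0 := by
  rw [L2.inner_def]
  refine integral_eq_zero_of_ae ?_
  have e1 : u⁺ = u ⊔ 0 := posPart_def u
  have e2 : u⁻ = (-u) ⊔ 0 := negPart_def u
  rw [e1, e2]
  filter_upwards [Lp.coeFn_sup u 0, Lp.coeFn_sup (-u) 0, Lp.coeFn_neg u,
    Lp.coeFn_zero ℝ 2 (volume : Measure Space)] with x h1 h2 h3 h4
  rw [h1, h2, Pi.sup_apply, Pi.sup_apply, h3, h4]
  simp only [Pi.neg_apply, Pi.zero_apply, RCLike.inner_apply, conj_trivial]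
  rcases le_total (u x) 0 with h | h
  · rw [sup_eq_right.2 h, zero_mul]
  · rw [sup_eq_right.2 (neg_nonpos.2 h), mul_zero]

theorem resR_nonneg {κ : ℝ} (hκ : 0 < κ) {f : L2R} (hf : 0 ≤ f) : 0 ≤ resR κ hκ f := by
  set w := resR κ hκ f
  have h1 : 0 ≤ inner ℝ w⁻ w := inner_resR_nonneg hκ (negPart_nonneg w) hf
  have h2 : inner ℝ w⁻ w = -inner ℝ w⁻ w⁻ := by
    conv_lhs => rw [show inner ℝ w⁻ w = inner ℝ w⁻ (w⁺ - w⁻) by rw [posPart_sub_negPart]]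
    rw [inner_sub_right, inner_posPart_negPart, zero_sub]
  have h3 : w⁻ = 0 := by
    rw [← inner_self_eq_zero (𝕜 := ℝ)]
    exact le_antisymm (by linarith) real_inner_self_nonneg
  exact negPart_eq_zero.1 h3

/-- An eigenvalue with a positive eigenfunction is simple.  The eigenvalue equation is written as
`u = (-Δ + κ)⁻¹ (M u)` with multiplication by a function `M ≥ 1`; the positive and negative parts
of a solution then solve the same equation, so one of them vanishes. -/
theorem eq_zero_of_inner_groundState {V : LinfR} {l : ℝ} {ψ u : L2R} (hψ : HasSch V ψ (l • ψ))
    (hpos : ∀ᵐ x, 0 < ψ x) (hu : HasSch V u (l • u)) (h0 : inner ℝ ψ u = 0) : u = 0 := by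
  have hκ : 0 < ‖V‖ + |l| + 1 := by positivity
  set κ := ‖V‖ + |l| + 1 with hκd
  let M : L2R →L[ℝ] L2R := (l + κ) • ContinuousLinearMap.id ℝ L2R - mulL ℝ V
  have hMe : ∀ v, M v = l • v + κ • v - mulL ℝ V v := fun v => by
    change (l + κ) • v - mulL ℝ V v = _
    rw [add_smul]
  have hMx : ∀ v : L2R, ∀ᵐ x, M v x = (l + κ - V x) * v x := by
    intro v
    change ∀ᵐ x, ((l + κ) • v - mulL ℝ V v) x = _
    filter_upwards [Lp.coeFn_sub ((l + κ) • v) (mulL ℝ V v), Lp.coeFn_smul (l + κ) v,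
      coeFn_mulL V v] with x h1 h2 h3
    rw [h1, Pi.sub_apply, h2, h3, Pi.smul_apply, smul_eq_mul]; ring
  have hm : ∀ᵐ x, 1 ≤ l + κ - V x := by
    filter_upwards [ae_norm_le_norm_top V] with x hx
    have := le_abs_self (V x)
    have := neg_abs_le l
    linarith
  have hMsymm : ∀ v w, inner ℝ (M v) w = inner ℝ v (M w) := by
    intro v w
    change inner ℝ ((l + κ) • v - mulL ℝ V v) w = inner ℝ v ((l + κ) • w - mulL ℝ V w)
    rw [inner_sub_left, inner_sub_right, mulL_symm]
    exact congrArg (· - inner ℝ v (mulL ℝ V w)) ((real_inner_smul_left v w (l + κ)).trans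
      (real_inner_smul_right v w (l + κ)).symm)
  have hMnn : ∀ v : L2R, 0 ≤ v → 0 ≤ M v := by
    intro v hv
    rw [← Lp.coeFn_nonneg] at hv ⊢
    filter_upwards [hv, hMx v, hm] with x h1 h2 h3
    rw [h2]; exact mul_nonneg (by linarith) h1
  have hM0 : ∀ v : L2R, M v = 0 → v = 0 := by
    intro v hv
    rw [Lp.eq_zero_iff_ae_eq_zero] at hv ⊢
    filter_upwards [hv, hMx v, hm] with x h1 h2 h3
    rw [h2] at h1
    exact (mul_eq_zero.1 h1).resolve_left (by linarith)
  have hMψ : ∀ᵐ x, 0 < M ψ x := by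
    filter_upwards [hMx ψ, hm, hpos] with x h1 h2 h3
    rw [h1]; exact mul_pos (by linarith) h3
  have hψR : ψ = resR κ hκ (M ψ) := by rw [hMe]; exact hψ.exists_resR hκ
  have huR : u = resR κ hκ (M u) := by rw [hMe]; exact hu.exists_resR hκ
  -- a nonnegative function dominated by its image under `(-Δ + κ)⁻¹ M` is a fixed point
  have hfix : ∀ a : L2R, a ≤ resR κ hκ (M a) → resR κ hκ (M a) = a := by
    intro a ha
    have h1 : inner ℝ (M ψ) (resR κ hκ (M a) - a) = 0 := by
      rw [inner_sub_right, ← resR_symm, ← hψR, hMsymm, sub_self]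
    exact sub_eq_zero.1 (eq_zero_of_inner_pos hMψ (sub_nonneg.2 ha) h1)
  have hu' : u = resR κ hκ (M u⁺) - resR κ hκ (M u⁻) := by
    rw [← map_sub, ← map_sub, posPart_sub_negPart]; exact huR
  have p1 : 0 ≤ resR κ hκ (M u⁺) := resR_nonneg hκ (hMnn _ (posPart_nonneg u))
  have p2 : 0 ≤ resR κ hκ (M u⁻) := resR_nonneg hκ (hMnn _ (negPart_nonneg u))
  have f1 : resR κ hκ (M u⁺) = u⁺ := by
    refine hfix _ ?_
    conv_lhs => rw [posPart_def]
    refine sup_le ?_ p1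
    conv_lhs => rw [hu']
    exact sub_le_self _ p2
  have hor : u⁺ = 0 ∨ u⁻ = 0 := by
    by_contra! h
    have h1 := inner_resR_pos hκ (negPart_nonneg u) (hMnn _ (posPart_nonneg u)) h.2
      (fun h' => h.1 (hM0 _ h'))
    rw [f1, inner_posPart_negPart] at h1
    exact lt_irrefl _ h1
  rcases hor with h | h
  · have e : u = -u⁻ := by conv_lhs => rw [← posPart_sub_negPart u, h, zero_sub]
    rw [e, inner_neg_right, neg_eq_zero] at h0
    rw [e, eq_zero_of_inner_pos hpos (negPart_nonneg u) h0, neg_zero]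
  · have e : u = u⁺ := by conv_lhs => rw [← posPart_sub_negPart u, h, sub_zero]
    rw [e] at h0 ⊢
    exact eq_zero_of_inner_pos hpos (posPart_nonneg u) h0

/-- The reduced resolvent: `resR 1 ∘ A` inverts `-Δ + V - l + P`, where `P` is the orthogonal
projection onto the kernel `K` of `-Δ + V - l`. -/
theorem exists_reduced_resolvent {V : LinfR} (hV : MemLp V 2 volume) {l : ℝ} (hl : l < 0)
    (K : Submodule ℝ L2R) [FiniteDimensional ℝ K] (hK : ∀ u, u ∈ K ↔ HasSch V u (l • u)) :
    ∃ A : L2R →L[ℝ] L2R,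
      (∀ f, HasSch V (resR 1 one_pos (A f))
        (f + l • resR 1 one_pos (A f) - K.starProjection (resR 1 one_pos (A f)))) ∧
      (∀ u f, HasSch V u (f + l • u - K.starProjection u) → u = resR 1 one_pos (A f)) ∧
      ∀ f, K.starProjection (resR 1 one_pos (A f)) = K.starProjection f := by
  -- testing the equation against the kernel
  have key : ∀ u f, HasSch V u (f + l • u - K.starProjection u) →
      K.starProjection u = K.starProjection f := by
    intro u f hu
    have h1 : ∀ z ∈ K, inner ℝ (f - K.starProjection u) z = 0 := by
      intro z hz
      have h2 := hu.symm ((hK z).1 hz)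
      rw [inner_sub_left, inner_add_left, inner_smul_left, inner_smul_right] at h2
      rw [inner_sub_left]
      simp only [conj_trivial] at h2
      linarith
    have h3 : f - K.starProjection u ∈ Kᗮ := (Submodule.mem_orthogonal' K _).2 h1
    have h4 := (Submodule.starProjection_apply_eq_zero_iff K).2 h3
    rw [map_sub, Submodule.starProjection_eq_self_iff.2 (K.starProjection_apply_mem u),
      sub_eq_zero] at h4
    exact h4.symm
  have hP : IsCompactOperator (K.starProjection : L2R →L[ℝ] L2R) := by
    have h1 : IsCompactOperator (K.orthogonalProjectionOnto : L2R →L[ℝ] K) :=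
      have : ProperSpace K := FiniteDimensional.proper ℝ K
      isCompactOperator_of_locallyCompactSpace_dom K.orthogonalProjectionOnto
    exact h1.clm_comp K.subtypeL
  obtain ⟨A, hA1, hA2⟩ := exists_inverse hV hl K.starProjection hP (by
    intro u hu
    have h1 := key u 0 (by simpa using hu)
    rw [map_zero] at h1
    rw [h1, sub_zero] at hu
    rw [← h1, Submodule.starProjection_eq_self_iff.2 ((hK u).2 hu)])
  exact ⟨A, hA1, hA2, fun f => key _ _ (hA1 f)⟩

/-- A Schwartz potential as a bounded function. -/
def schwPot (V : 𝓢(Space, ℝ)) : LinfR := (V.memLp_top volume).toLp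

theorem coeFn_schwPot (V : 𝓢(Space, ℝ)) : schwPot V =ᵐ[volume] V := MemLp.coeFn_toLp _

theorem memLp_schwPot (V : 𝓢(Space, ℝ)) : MemLp (schwPot V) 2 volume :=
  (memLp_congr_ae (coeFn_schwPot V)).2 (V.memLp 2 volume)

theorem mem_eigenspace_schrodinger {W : Space → ℝ} (hW : MemLp W ∞ volume) (u : L2C) (μ : ℂ) :
    u ∈ eigenspace (schrodinger W) μ ↔ HasSchC hW.toLp u (μ • u) :=
  schrodinger_iff hW u (μ • u)

theorem mem_eigenspace_schwPot (V : 𝓢(Space, ℝ)) (u : L2C) (l : ℝ) :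
    u ∈ eigenspace (schrodinger V) (l : ℂ) ↔
      reL u ∈ realEig (schwPot V) l ∧ imL u ∈ realEig (schwPot V) l := by
  rw [mem_eigenspace_schrodinger (V.memLp_top volume), hasSchC_iff, Complex.coe_smul, map_smul,
    map_smul]
  rfl

theorem toC_mem_eigenspace_iff (V : 𝓢(Space, ℝ)) (u : L2R) (l : ℝ) :
    toC u ∈ eigenspace (schrodinger V) (l : ℂ) ↔ u ∈ realEig (schwPot V) l := by
  rw [mem_eigenspace_schwPot, reL_toC, imL_toC]
  exact and_iff_left (Submodule.zero_mem _)

theorem realEig_eq_bot {V : 𝓢(Space, ℝ)} {l : ℝ}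
    (h : eigenspace (schrodinger V) (l : ℂ) = ⊥) : realEig (schwPot V) l = ⊥ := by
  rw [Submodule.eq_bot_iff]
  intro u hu
  have := (toC_mem_eigenspace_iff V u l).2 hu
  rw [h, Submodule.mem_bot] at this
  exact toC_injective (this.trans toC_zero.symm)

/-- The real eigenspace has the same dimension as the complex one. -/
theorem finiteDimensional_realEig {V : 𝓢(Space, ℝ)} {l : ℝ} {N : ℕ} {ξs : Fin N → L2C}
    (hξs : LinearIndependent ℂ ξs)
    (hspan : Submodule.span ℂ (Set.range ξs) = eigenspace (schrodinger V) (l : ℂ)) :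
    FiniteDimensional ℝ (realEig (schwPot V) l) ∧
      Module.finrank ℝ (realEig (schwPot V) l) = N := by
  have hfC : FiniteDimensional ℂ (eigenspace (schrodinger V) (l : ℂ)) := by
    rw [← hspan]; exact FiniteDimensional.span_of_finite ℂ (Set.finite_range ξs)
  have hfR : FiniteDimensional ℝ ((eigenspace (schrodinger V) (l : ℂ)).restrictScalars ℝ) :=
    Module.Finite.trans (R := ℝ) ℂ (eigenspace (schrodinger V) (l : ℂ))
  let T : realEig (schwPot V) l →ₗ[ℝ] (eigenspace (schrodinger V) (l : ℂ)).restrictScalars ℝ :=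
    LinearMap.restrict (ofR : L2R →ₗ[ℝ] L2C) fun u hu => (toC_mem_eigenspace_iff V u l).2 hu
  have hT : Function.Injective T := fun u v h =>
    Subtype.ext (toC_injective (congrArg Subtype.val h))
  have hf : FiniteDimensional ℝ (realEig (schwPot V) l) := Module.Finite.of_injective T hT
  refine ⟨hf, ?_⟩
  let b := stdOrthonormalBasis ℝ (realEig (schwPot V) l)
  have hon : Orthonormal ℂ fun i => toC (b i : L2R) := by
    classical
    rw [orthonormal_iff_ite]
    intro i j
    rw [inner_toC]
    have := orthonormal_iff_ite.1 b.orthonormal i j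
    rw [Submodule.coe_inner] at this
    rw [this]; split_ifs <;> simp
  have hsp : Submodule.span ℂ (Set.range fun i => toC (b i : L2R)) =
      eigenspace (schrodinger V) (l : ℂ) := by
    apply le_antisymm
    · rw [Submodule.span_le]
      rintro _ ⟨i, rfl⟩
      exact (toC_mem_eigenspace_iff V _ l).2 (b i).2
    · intro u hu
      obtain ⟨h1, h2⟩ := (mem_eigenspace_schwPot V u l).1 hu
      have h3 : ∀ v ∈ realEig (schwPot V) l,
          toC v ∈ Submodule.span ℂ (Set.range fun i => toC (b i : L2R)) := by
        intro v hv
        have h4 := b.sum_repr ⟨v, hv⟩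
        have h5 : v = ∑ i, b.repr ⟨v, hv⟩ i • (b i : L2R) := by
          have := congrArg Subtype.val h4
          rw [Submodule.coe_sum] at this
          exact this.symm
        rw [h5, toC_sum]
        refine Submodule.sum_mem _ fun i _ => ?_
        rw [toC_smul]
        exact Submodule.smul_mem _ _ (Submodule.subset_span ⟨i, rfl⟩)
      rw [← toC_re_add_im u]
      exact Submodule.add_mem _ (h3 _ h1) (Submodule.smul_mem _ _ (h3 _ h2))
  have c1 := finrank_span_eq_card hξs
  have c2 := finrank_span_eq_card hon.linearIndependent
  rw [hspan] at c1
  rw [hsp, c1] at c2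
  simpa using c2.symm

section

open scoped ContDiff

/-! ### The curve of nonlinear bound states -/

section AbstractBranch

/-- A function of a parameter `t` and of `y` is bounded for bounded `y` and `|t| ≤ 1`. -/
def BddOnBdd {X Z : Type*} [Norm X] [Norm Z] (G : ℝ → X → Z) : Prop :=
  ∀ C : ℝ, ∃ M : ℝ, ∀ (t : ℝ) (y : X), |t| ≤ 1 → ‖y‖ ≤ C → ‖G t y‖ ≤ M

variable {X Y Z : Type*} [NormedAddCommGroup X] [NormedAddCommGroup Y] [NormedAddCommGroup Z]

theorem BddOnBdd.add {G H : ℝ → X → Z} (hG : BddOnBdd G) (hH : BddOnBdd H) :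
    BddOnBdd fun t y => G t y + H t y := fun C => by
  obtain ⟨a, ha⟩ := hG C
  obtain ⟨b, hb⟩ := hH C
  exact ⟨a + b, fun t y h1 h2 => (norm_add_le _ _).trans (add_le_add (ha t y h1 h2) (hb t y h1 h2))⟩

theorem BddOnBdd.sub {G H : ℝ → X → Z} (hG : BddOnBdd G) (hH : BddOnBdd H) :
    BddOnBdd fun t y => G t y - H t y := fun C => by
  obtain ⟨a, ha⟩ := hG C
  obtain ⟨b, hb⟩ := hH C
  exact ⟨a + b, fun t y h1 h2 => (norm_sub_le _ _).trans (add_le_add (ha t y h1 h2) (hb t y h1 h2))⟩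

variable [NormedSpace ℝ Z]

theorem BddOnBdd.param_smul {G : ℝ → X → Z} (hG : BddOnBdd G) :
    BddOnBdd fun t y => t • G t y := fun C => by
  obtain ⟨a, ha⟩ := hG C
  refine ⟨a, fun t y h1 h2 => ?_⟩
  rw [norm_smul, Real.norm_eq_abs]
  exact (mul_le_of_le_one_left (norm_nonneg _) h1).trans (ha t y h1 h2)

variable [NormedSpace ℝ Y]

theorem BddOnBdd.clm {G : ℝ → X → Y} (hG : BddOnBdd G) (L : Y →L[ℝ] Z) :
    BddOnBdd fun t y => L (G t y) := fun C => by
  obtain ⟨a, ha⟩ := hG C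
  refine ⟨‖L‖ * a, fun t y h1 h2 => (L.le_opNorm _).trans ?_⟩
  gcongr
  exact ha t y h1 h2

theorem BddOnBdd.apply {G : ℝ → X → Y →L[ℝ] Z} {H : ℝ → X → Y} (hG : BddOnBdd G)
    (hH : BddOnBdd H) : BddOnBdd fun t y => G t y (H t y) := fun C => by
  obtain ⟨a, ha⟩ := hG C
  obtain ⟨b, hb⟩ := hH C
  refine ⟨|a| * b, fun t y h1 h2 => ((G t y).le_opNorm _).trans ?_⟩
  gcongr
  · exact (ha t y h1 h2).trans (le_abs_self a)
  · exact hb t y h1 h2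

theorem bddOnBdd_id : BddOnBdd fun (_ : ℝ) (y : X) => y := fun C => ⟨C, fun _ _ _ h => h⟩

variable [NormedSpace ℝ X]

/-- A rank one modification of a projection along `v` is invertible. -/
def rankOneEquiv (p l : X →L[ℝ] ℝ) (v : X) (hp : p v = 1) (hl : l v ≠ 0) : X ≃L[ℝ] X where
  toFun f := f - p f • v + l f • v
  map_add' f h := by simp only [map_add, add_smul]; abel
  map_smul' r f := by simp only [map_smul, smul_assoc, smul_add, smul_sub, RingHom.id_apply]
  invFun h := h - p h • v + ((p h - l h + p h * l v) / l v) • v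
  left_inv f := by
    have e : p (f - p f • v + l f • v) = l f := by simp [hp]
    have e2 : l (f - p f • v + l f • v) = l f - p f * l v + l f * l v := by simp
    beta_reduce
    rw [e, e2]
    have e3 : (l f - (l f - p f * l v + l f * l v) + l f * l v) / l v = p f := by
      field_simp; ring
    rw [e3]; abel
  right_inv h := by
    have e : p (h - p h • v + ((p h - l h + p h * l v) / l v) • v) =
        (p h - l h + p h * l v) / l v := by simp [hp]
    have e2 : l (h - p h • v + ((p h - l h + p h * l v) / l v) • v) = p h := by
      simp only [map_add, map_sub, map_smul, smul_eq_mul]; field_simp; ring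
    beta_reduce
    rw [e, e2]; abel
  continuous_toFun := by fun_prop
  continuous_invFun := by fun_prop

theorem rankOneEquiv_apply (p l : X →L[ℝ] ℝ) (v : X) (hp : p v = 1) (hl : l v ≠ 0) (f : X) :
    rankOneEquiv p l v hp hl f = f - p f • v + l f • v := rfl

/-- The bifurcation equation `f - p(f) ψ₀ = φ - c⁻¹ φ³` with `φ = ψ₀ + t R A f`.  Here `m a` stands
for multiplication by `R a`.  Applying `p` to the equation and dividing by `t` yields
`l f = t p(Q t f)`, where `l` is the linearization of `φ ↦ p(φ - c⁻¹ φ³)`; since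
`l (R a₀) = 1 - 3 = -2`, the two equations together have an invertible linear part. -/
theorem exists_analytic_bifurcation [CompleteSpace X] (m : X →L[ℝ] X →L[ℝ] X) (A R : X →L[ℝ] X)
    (p : X →L[ℝ] ℝ) (a₀ : X) {c : ℝ} (hc : c ≠ 0)
    (hcomm : ∀ a b u, m a (m b u) = m b (m a u)) (hmR : ∀ a b, m a (R b) = m b (R a))
    (hp : p (R a₀) = 1) (hA : R (A (R a₀)) = R a₀) (hpc : p (m a₀ (m a₀ (R a₀))) = c) :
    ∃ f : ℝ → X, AnalyticAt ℝ f 0 ∧ ∀ C : ℝ, ∀ᶠ t in 𝓝 (0 : ℝ), t ≠ 0 → ∀ y : X, ‖y‖ ≤ C →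
      y - p y • R a₀ = R (a₀ + t • A y) -
        c⁻¹ • m (a₀ + t • A y) (m (a₀ + t • A y) (R (a₀ + t • A y))) → f t = y := by
  let l : X →L[ℝ] ℝ := p ∘L ((ContinuousLinearMap.id ℝ X - (3 * c⁻¹) • (m a₀ ∘L m a₀)) ∘L R ∘L A)
  have hlf : ∀ f, l f = p (R (A f)) - 3 * c⁻¹ * p (m a₀ (m a₀ (R (A f)))) := fun f => by
    simp [l]
  have hl : l (R a₀) ≠ 0 := by
    rw [hlf, hA, hp, hpc, mul_assoc, inv_mul_cancel₀ hc]; norm_num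
  let Q : ℝ → X → X := fun t f => c⁻¹ • ((3 : ℝ) • m a₀ (m (A f) (R (A f))) +
    t • m (A f) (m (A f) (R (A f))))
  let N : ℝ → X → X := fun t f => R (A f) - (3 * c⁻¹) • m a₀ (m a₀ (R (A f))) - t • Q t f
  let G : ℝ × X → X := fun v => N v.1 v.2 + p (Q v.1 v.2) • R a₀
  have hG : ContDiff ℝ ω G := by
    simp only [G, N, Q]
    fun_prop
  have bm : BddOnBdd fun (_ : ℝ) (f : X) => m (A f) := (bddOnBdd_id.clm A).clm m
  have bR : BddOnBdd fun (_ : ℝ) (f : X) => R (A f) := (bddOnBdd_id.clm A).clm R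
  have bsm : ∀ (r : ℝ) {H : ℝ → X → X}, BddOnBdd H → BddOnBdd fun t y => r • H t y :=
    fun r H hH => hH.clm (r • ContinuousLinearMap.id ℝ X)
  have bQ : BddOnBdd Q := bsm _ ((bsm _ ((bm.apply bR).clm (m a₀))).add
    ((bm.apply (bm.apply bR)).param_smul))
  have bN : BddOnBdd N := (bR.sub (bsm _ ((bR.clm (m a₀)).clm (m a₀)))).sub bQ.param_smul
  have bG : BddOnBdd fun t y => G (t, y) :=
    bN.add (bQ.clm (p.smulRight (R a₀)))
  obtain ⟨f, hf, hfu⟩ := exists_analytic_branch (rankOneEquiv p l (R a₀) hp hl)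
    (R a₀ - c⁻¹ • m a₀ (m a₀ (R a₀))) hG bG
  refine ⟨f, hf, fun C => ?_⟩
  filter_upwards [hfu C] with t ht ht0 y hy heq
  refine ht y hy ?_
  rw [rankOneEquiv_apply]
  have hcub : R (a₀ + t • A y) - c⁻¹ • m (a₀ + t • A y) (m (a₀ + t • A y) (R (a₀ + t • A y))) =
      R a₀ - c⁻¹ • m a₀ (m a₀ (R a₀)) + t • N t y := by
    simp only [map_add, map_smul, add_apply, smul_apply, N, Q]
    rw [hcomm (A y) a₀, hmR (A y) a₀, hcomm (A y) a₀]
    module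
  rw [hcub] at heq
  have h1 := congrArg p heq
  have h2 : p (R a₀ - c⁻¹ • m a₀ (m a₀ (R a₀))) = 0 := by
    rw [map_sub, map_smul, hp, hpc, smul_eq_mul, inv_mul_cancel₀ hc, sub_self]
  rw [map_sub, map_smul, hp, map_add, h2, map_smul] at h1
  have h3 : p (N t y) = 0 := by
    simp only [smul_eq_mul, mul_one, sub_self, zero_add] at h1
    exact (mul_eq_zero.1 h1.symm).resolve_left ht0
  have h4 : l y = t * p (Q t y) := by
    have : p (N t y) = l y - t * p (Q t y) := by
      rw [hlf]; simp only [N, map_sub, map_smul, smul_eq_mul]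
    linarith
  rw [heq, h4]
  simp only [G, smul_add, smul_smul]
  abel

end AbstractBranch

end

section

open FourierTransform

/-! ### Multiplication by functions in `H²` -/

theorem coeFn_resR (f : L2R) : ∀ᵐ x, (resR 1 one_pos f x : ℂ) = resC 1 one_pos (toC f) x := by
  filter_upwards [coeFn_toC (resR 1 one_pos f)] with x h1
  rw [← h1, toC_resR]

theorem abs_resR_apply_le (f : L2R) : ∀ᵐ x, ‖resR 1 one_pos f x‖ ≤
    ‖((memLp_resSymbol_two (κ := 1) one_pos).toLp : L2C)‖ * ‖f‖ := by
  filter_upwards [coeFn_resR f, norm_resC_apply_le one_pos (toC f)] with x h1 h2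
  rw [← h1, norm_toC, Complex.norm_real] at h2
  exact h2

theorem memLp_top_resR (f : L2R) : MemLp (resR 1 one_pos f) ∞ volume :=
  memLp_top_of_bound (Lp.aestronglyMeasurable _) _ (abs_resR_apply_le f)

/-- The function `resR 1 f`, as a bounded function. -/
def embInf : L2R →L[ℝ] LinfR :=
  LinearMap.mkContinuous
    { toFun := fun f => (memLp_top_resR f).toLp
      map_add' := fun f h => by
        rw [← MemLp.toLp_add, MemLp.toLp_eq_toLp_iff, map_add]
        exact Lp.coeFn_add _ _
      map_smul' := fun c f => by
        rw [RingHom.id_apply, ← MemLp.toLp_const_smul, MemLp.toLp_eq_toLp_iff, map_smul]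
        exact Lp.coeFn_smul _ _ }
    ‖((memLp_resSymbol_two (κ := 1) one_pos).toLp : L2C)‖ (fun f => by
      change ‖(memLp_top_resR f).toLp‖ ≤ _
      rw [Lp.norm_toLp, eLpNorm_exponent_top]
      exact ENNReal.toReal_le_of_le_ofReal (by positivity)
        (eLpNormEssSup_le_of_ae_bound (abs_resR_apply_le f)))

theorem coeFn_embInf (f : L2R) : embInf f =ᵐ[volume] resR 1 one_pos f :=
  (memLp_top_resR f).coeFn_toLp

/-- Multiplication by the function `resR 1 a`. -/
def mulR : L2R →L[ℝ] L2R →L[ℝ] L2R := mulL ℝ ∘L embInf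

theorem mulR_apply (a u : L2R) : mulR a u = mulL ℝ (embInf a) u := rfl

theorem coeFn_mulR (a u : L2R) : mulR a u =ᵐ[volume] fun x => resR 1 one_pos a x * u x := by
  filter_upwards [coeFn_mulL (embInf a) u, coeFn_embInf a] with x h1 h2
  rw [mulR_apply, h1, h2]

theorem mulR_comm (a b u : L2R) : mulR a (mulR b u) = mulR b (mulR a u) := by
  apply Lp.ext
  filter_upwards [coeFn_mulR a (mulR b u), coeFn_mulR b u, coeFn_mulR b (mulR a u),
    coeFn_mulR a u] with x h1 h2 h3 h4
  rw [h1, h2, h3, h4]; ring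

/-- Both sides are the pointwise product of `resR 1 a` and `resR 1 b`. -/
theorem mulR_resR (a b : L2R) : mulR a (resR 1 one_pos b) = mulR b (resR 1 one_pos a) := by
  apply Lp.ext
  filter_upwards [coeFn_mulR a (resR 1 one_pos b), coeFn_mulR b (resR 1 one_pos a)]
    with x h1 h2
  rw [h1, h2]; ring

theorem mulR_symm (a u v : L2R) : inner ℝ (mulR a u) v = inner ℝ u (mulR a v) :=
  mulL_symm (embInf a) u v

theorem resR_injective {a : L2R} (h : resR 1 one_pos a = 0) : a = 0 := by
  have h1 : HasSch 0 0 a := ⟨a, h.symm, by simp⟩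
  exact h1.unique HasSch.zero

/-- A bound in `H²` for `resR 1 a` is an `L²` bound for `a`. -/
theorem norm_le_of_sobolevNorm_two_le {a : L2R} {B : ℝ} (hB : 0 ≤ B)
    (h : sobolevNorm 2 (toC (resR 1 one_pos a)) ≤ ENNReal.ofReal B) :
    ‖a‖ ≤ (2 * Real.pi) ^ 2 * B := by
  rw [sobolevNorm_eq] at h
  have h1 : eLpNorm (𝓕 (toC a) : L2C) 2 volume ≤ ENNReal.ofReal ((2 * Real.pi) ^ 2) *
      eLpNorm (fun ξ => (weight 2 ξ : ℂ) * (𝓕 (toC (resR 1 one_pos a)) : L2C) ξ) 2 volume := by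
    refine eLpNorm_le_mul_eLpNorm_of_ae_le_mul ?_ 2
    rw [toC_resR]
    filter_upwards [fourier_resC one_pos (toC a)] with ξ h2
    rw [h2, norm_mul, norm_mul, Complex.norm_real, Complex.norm_real,
      Real.norm_of_nonneg (weight_pos 2 ξ).le, Real.norm_of_nonneg (resSymbol_pos one_pos ξ).le,
      weight_two]
    have h3 : 1 ≤ (2 * Real.pi) ^ 2 * ((1 + ‖ξ‖ ^ 2) * resSymbol 1 ξ) := by
      unfold resSymbol
      rw [← mul_assoc, ← div_eq_mul_inv, le_div_iff₀ (by positivity), one_mul]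
      nlinarith [Real.pi_gt_three]
    calc ‖(𝓕 (toC a) : L2C) ξ‖ = 1 * ‖(𝓕 (toC a) : L2C) ξ‖ := (one_mul _).symm
      _ ≤ _ := mul_le_mul_of_nonneg_right h3 (norm_nonneg _)
      _ = _ := by ring
  have h2 : ‖a‖ = (eLpNorm (𝓕 (toC a) : L2C) 2 volume).toReal := by
    rw [← norm_toC, ← Lp.norm_fourier_eq, Lp.norm_def]
  rw [h2]
  refine ENNReal.toReal_le_of_le_ofReal (by positivity) (h1.trans ?_)
  rw [ENNReal.ofReal_mul (by positivity)]
  gcongr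

/-- A function in the natural domain of `-Δ + W` is in the range of the free resolvent. -/
theorem exists_eq_resR_of_mem_eigenspace {W : Space → ℝ} {ψ : L2R} {μ : ℂ}
    (h : toC ψ ∈ eigenspace (schrodinger W) μ) : ∃ y, ψ = resR 1 one_pos y := by
  obtain ⟨h1, -⟩ := h
  have h2 : toC ψ ∈ negLaplacian.domain := h1.1
  have h3 := resC_negLaplacian one_pos ⟨toC ψ, h2⟩
  refine ⟨reL (negLaplacian ⟨toC ψ, h2⟩ + ((1 : ℝ) : ℂ) • toC ψ), ?_⟩
  rw [← reL_resC]
  exact (reL_toC ψ).symm.trans (congrArg reL h3.symm)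

/-- The nonlinear equation, with the cubic term on the right-hand side and the potential fixed. -/
theorem hasSch_of_solves {V : 𝓢(Space, ℝ)} {g E : ℝ} {y : L2R}
    (h : toC (resR 1 one_pos y) ∈
      eigenspace (schrodinger fun x => V x + g * (resR 1 one_pos y x) ^ 2) (E : ℂ)) :
    HasSch (schwPot V) (resR 1 one_pos y)
      (E • resR 1 one_pos y - g • mulR y (mulR y (resR 1 one_pos y))) := by
  have hsq : MemLp (fun x => (resR 1 one_pos y x) ^ 2) ∞ volume := by
    have := (memLp_top_resR y).mul (memLp_top_resR y) (r := ∞)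
    simp only [pow_two]
    exact this
  have hW : MemLp (fun x => V x + g * (resR 1 one_pos y x) ^ 2) ∞ volume :=
    (V.memLp_top volume).add (hsq.const_mul g)
  rw [mem_eigenspace_schrodinger hW, ← toC_smul, hasSchC_toC_iff] at h
  convert h.change (schwPot V) using 1
  rw [sub_eq_add_neg]
  congr 1
  apply Lp.ext
  filter_upwards [Lp.coeFn_neg (g • mulR y (mulR y (resR 1 one_pos y))),
    Lp.coeFn_smul g (mulR y (mulR y (resR 1 one_pos y))), coeFn_mulR y (mulR y (resR 1 one_pos y)),
    coeFn_mulR y (resR 1 one_pos y), coeFn_mulL (schwPot V - hW.toLp) (resR 1 one_pos y),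
    Lp.coeFn_sub (schwPot V) hW.toLp, hW.coeFn_toLp, coeFn_schwPot V] with x h1 h2 h3 h4 h5 h6 h7 h8
  rw [h1, Pi.neg_apply, h2, Pi.smul_apply, h3, h4, h5, h6, Pi.sub_apply, h7, h8, smul_eq_mul]
  ring

theorem inner_mulR_mulR_eq (a : L2R) :
    inner ℝ (resR 1 one_pos a) (mulR a (mulR a (resR 1 one_pos a))) =
      ∫ x, (resR 1 one_pos a x) ^ 4 := by
  rw [L2.inner_def]
  refine integral_congr_ae ?_
  filter_upwards [coeFn_mulR a (mulR a (resR 1 one_pos a)), coeFn_mulR a (resR 1 one_pos a)]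
    with x h1 h2
  rw [h1, h2, RCLike.inner_apply, conj_trivial]; ring

theorem inner_mulR_mulR_pos {a : L2R} (ha : ∀ᵐ x, 0 < resR 1 one_pos a x) :
    0 < inner ℝ (resR 1 one_pos a) (mulR a (mulR a (resR 1 one_pos a))) := by
  have h3 : ∀ᵐ x, 0 < mulR a (mulR a (resR 1 one_pos a)) x := by
    filter_upwards [coeFn_mulR a (mulR a (resR 1 one_pos a)), coeFn_mulR a (resR 1 one_pos a), ha]
      with x h1 h2 h3
    rw [h1, h2]; positivity
  have h4 : 0 ≤ mulR a (mulR a (resR 1 one_pos a)) :=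
    (Lp.coeFn_nonneg _).1 (h3.mono fun x hx => hx.le)
  refine lt_of_le_of_ne ?_ fun h0 => ?_
  · rw [L2.inner_def]
    refine integral_nonneg_of_ae ?_
    filter_upwards [ha, h3] with x h1 h2
    rw [RCLike.inner_apply, conj_trivial]
    exact (mul_pos h2 h1).le
  · have h5 := eq_zero_of_inner_pos ha h4 h0.symm
    rw [Lp.eq_zero_iff_ae_eq_zero] at h5
    have h6 : ∀ᵐ _ : Space, False := by
      filter_upwards [h5, h3] with x h1 h2
      rw [h1] at h2; exact lt_irrefl _ h2
    rw [ae_iff] at h6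
    simp at h6

theorem amplitude_pos {g E₀ E : ℝ} {ψ₀ : L2R} (hc : 0 < ∫ x, (ψ₀ x) ^ 4)
    (h : 0 < g * (E - E₀)) : 0 < amplitude g E₀ ψ₀ E := by
  have hg : g ≠ 0 := fun h0 => by simp [h0] at h
  have hE : E₀ - E ≠ 0 := fun h0 => by
    rw [show E - E₀ = -(E₀ - E) by ring, h0] at h; simp at h
  unfold amplitude
  have := abs_pos.2 hg
  have := abs_pos.2 hE
  positivity

/-- The amplitude is chosen so that `g ρ(E)² ∫ ψ₀⁴ = E - E₀`. -/
theorem mul_sq_amplitude {g E₀ E : ℝ} {ψ₀ : L2R} (hc : 0 < ∫ x, (ψ₀ x) ^ 4)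
    (h : 0 < g * (E - E₀)) :
    g * amplitude g E₀ ψ₀ E ^ 2 = (E - E₀) * (∫ x, (ψ₀ x) ^ 4)⁻¹ := by
  have hg : g ≠ 0 := fun h0 => by simp [h0] at h
  have hg' := abs_pos.2 hg
  unfold amplitude
  rw [mul_pow, inv_pow, Real.sq_sqrt (abs_nonneg _), Real.sq_sqrt (by positivity), abs_sub_comm]
  have h1 : g * |E - E₀| = |g| * (E - E₀) := by
    rcases lt_or_gt_of_ne hg with h2 | h2
    · have : E - E₀ < 0 := by nlinarith
      rw [abs_of_neg h2, abs_of_neg this]; ring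
    · have : 0 < E - E₀ := by nlinarith
      rw [abs_of_pos h2, abs_of_pos this]
  rw [mul_inv, ← mul_assoc, h1]
  field_simp

end

/-- The eigenvalue of the positive eigenfunction is simple. -/
theorem mem_span_groundState_iff {V : LinfR} {l : ℝ} {ψ : L2R} (hψ : HasSch V ψ (l • ψ))
    (hpos : ∀ᵐ x, 0 < ψ x) (hn : ‖ψ‖ = 1) (u : L2R) :
    u ∈ Submodule.span ℝ {ψ} ↔ HasSch V u (l • u) := by
  constructor
  · intro h
    obtain ⟨c, rfl⟩ := Submodule.mem_span_singleton.1 h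
    rw [smul_comm]; exact hψ.smul c
  · intro h
    have h1 : HasSch V (u - inner ℝ ψ u • ψ) (l • (u - inner ℝ ψ u • ψ)) := by
      rw [smul_sub, smul_comm]; exact h.sub (hψ.smul _)
    have h2 := eq_zero_of_inner_groundState hψ hpos h1 (by
      rw [inner_sub_right, real_inner_smul_right, real_inner_self_eq_norm_sq, hn]; ring)
    rw [sub_eq_zero] at h2
    exact Submodule.mem_span_singleton.2 ⟨_, h2.symm⟩

/-- The bifurcating branch is `ψ_E = ρ(E) φ(E - E₀)` with a profile `φ = resR 1 a` which is analytic
up to `E = E₀`.  The assumed expansion in `H²` bounds the profile, and bounded solutions of the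
bifurcation equation are unique. -/
theorem exists_analytic_profile {V : 𝓢(Space, ℝ)} {g E₀ : ℝ} (hg : g ≠ 0) (hE₀ : E₀ < 0)
    {ψ₀ : L2R} (hψ₀ : IsGroundState V E₀ ψ₀) {δ₀ : ℝ} (hδ₀ : 0 < δ₀) {ψ : ℝ → L2R}
    (hψ : IsBranch V g E₀ ψ₀ δ₀ ψ) :
    ∃ a : ℝ → L2R, AnalyticAt ℝ a 0 ∧ ψ₀ = resR 1 one_pos (a 0) ∧
      ∀ᶠ E in 𝓝[{E | 0 < g * (E - E₀)}] E₀,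
        ψ E = amplitude g E₀ ψ₀ E • resR 1 one_pos (a (E - E₀)) := by
  obtain ⟨a₀, rfl⟩ := exists_eq_resR_of_mem_eigenspace hψ₀.eigen
  have h0 : HasSch (schwPot V) (resR 1 one_pos a₀) (E₀ • resR 1 one_pos a₀) :=
    (toC_mem_eigenspace_iff V _ _).1 hψ₀.eigen
  have hK := mem_span_groundState_iff h0 hψ₀.pos hψ₀.norm_eq_one
  obtain ⟨A, hA1, hA2, hA3⟩ := exists_reduced_resolvent (memLp_schwPot V) hE₀ _ hK
  have hP : ∀ u, (Submodule.span ℝ {resR 1 one_pos a₀}).starProjection u =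
      inner ℝ (resR 1 one_pos a₀) u • resR 1 one_pos a₀ := fun u =>
    Submodule.starProjection_unit_singleton ℝ hψ₀.norm_eq_one u
  simp only [hP] at hA1 hA2 hA3
  have hn : inner ℝ (resR 1 one_pos a₀) (resR 1 one_pos a₀) = (1 : ℝ) := by
    rw [real_inner_self_eq_norm_sq, hψ₀.norm_eq_one]; norm_num
  have hc : 0 < ∫ x, (resR 1 one_pos a₀ x) ^ 4 := by
    rw [← inner_mulR_mulR_eq]; exact inner_mulR_mulR_pos hψ₀.pos
  set c := ∫ x, (resR 1 one_pos a₀ x) ^ 4 with hcd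
  obtain ⟨f, hf, hfu⟩ := exists_analytic_bifurcation mulR A (resR 1 one_pos)
    (innerSL ℝ (resR 1 one_pos a₀)) a₀ hc.ne' mulR_comm mulR_resR hn
    ((hA2 _ _ (by rw [hn, one_smul, add_sub_cancel_left]; exact h0)).symm)
    (inner_mulR_mulR_eq a₀)
  refine ⟨fun t => a₀ + t • A (f t), ?_, by simp, ?_⟩
  · exact analyticAt_const.add (analyticAt_id.smul ((A.analyticAt _).comp hf))
  obtain ⟨C, hC⟩ := hψ.expansion
  -- a priori bound for the right-hand side in terms of the bound for the profile
  have hbd : BddOnBdd fun (t : ℝ) (x : L2R) => resR 1 one_pos (a₀ + t • x) -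
      c⁻¹ • mulR (a₀ + t • x) (mulR (a₀ + t • x) (resR 1 one_pos (a₀ + t • x))) +
        inner ℝ (resR 1 one_pos a₀) (resR 1 one_pos x) • resR 1 one_pos a₀ := by
    have b0 : BddOnBdd fun (t : ℝ) (x : L2R) => a₀ + t • x :=
      BddOnBdd.add (fun _ => ⟨‖a₀‖, fun _ _ _ _ => le_rfl⟩) bddOnBdd_id.param_smul
    have b1 := b0.clm mulR
    exact ((b0.clm (resR 1 one_pos)).sub ((b1.apply (b1.apply (b0.clm (resR 1 one_pos)))).clm
      (c⁻¹ • ContinuousLinearMap.id ℝ L2R))).add ((bddOnBdd_id.clm (resR 1 one_pos)).clm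
        ((innerSL ℝ (resR 1 one_pos a₀)).smulRight (resR 1 one_pos a₀)))
  obtain ⟨M, hM⟩ := hbd ((2 * Real.pi) ^ 2 * |C| * (c⁻¹ / |g|))
  have htend : Tendsto (fun E => E - E₀) (𝓝[{E | 0 < g * (E - E₀)}] E₀) (𝓝 0) := by
    have : Continuous fun E : ℝ => E - E₀ := by fun_prop
    simpa using (this.tendsto E₀).mono_left nhdsWithin_le_nhds
  filter_upwards [self_mem_nhdsWithin, htend.eventually (hfu M),
    htend.eventually (Metric.closedBall_mem_nhds 0 hδ₀),
    htend.eventually (Metric.closedBall_mem_nhds 0 one_pos)] with E hE hEu hEδ hE1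
  have hE : 0 < g * (E - E₀) := hE
  have hEδ : |E - E₀| ≤ δ₀ := by simpa using hEδ
  have hE1 : |E - E₀| ≤ 1 := by simpa using hE1
  have ht0 : E - E₀ ≠ 0 := fun h => by rw [h] at hE; simp at hE
  set ρ := amplitude g E₀ (resR 1 one_pos a₀) E with hρd
  have hρ : 0 < ρ := amplitude_pos hc hE
  have hρ2 : g * ρ ^ 2 = (E - E₀) * c⁻¹ := mul_sq_amplitude hc hE
  have hsol := hψ.solves E hE hEδ
  obtain ⟨y, hy⟩ := exists_eq_resR_of_mem_eigenspace hsol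
  rw [hy] at hsol
  have hS := hasSch_of_solves hsol
  have hex := hC E hE hEδ
  rw [hy, ← hρd] at hex
  rw [hy]
  -- the rescaled correction to the linear profile
  set t := E - E₀ with htd
  obtain ⟨x, hx⟩ : ∃ x : L2R, y = ρ • (a₀ + t • x) :=
    ⟨t⁻¹ • (ρ⁻¹ • y - a₀), by rw [smul_inv_smul₀ ht0, add_sub_cancel, smul_inv_smul₀ hρ.ne']⟩
  have hxb : ‖x‖ ≤ (2 * Real.pi) ^ 2 * |C| * (c⁻¹ / |g|) := by
    have e : resR 1 one_pos y - ρ • resR 1 one_pos a₀ = resR 1 one_pos ((ρ * t) • x) := by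
      rw [hx]; simp only [map_smul, map_add]; module
    rw [e] at hex
    have h1 := norm_le_of_sobolevNorm_two_le (B := |C| * ρ ^ 3) (by positivity)
      (hex.trans (ENNReal.ofReal_le_ofReal (by gcongr; exact le_abs_self C)))
    rw [norm_smul, Real.norm_eq_abs, abs_mul, abs_of_pos hρ] at h1
    have h2 : |g| * ρ ^ 2 = |t| * c⁻¹ := by
      have := congrArg abs hρ2
      rwa [abs_mul, abs_mul, abs_of_pos (inv_pos.2 hc), abs_of_pos (pow_pos hρ 2)] at this
    have hg' := abs_pos.2 hg
    have ht' := abs_pos.2 ht0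
    have h3 : ρ ^ 2 = |t| * (c⁻¹ / |g|) := by field_simp at h2 ⊢; linarith
    have h4 : (ρ * |t|) * ‖x‖ ≤ (ρ * |t|) * ((2 * Real.pi) ^ 2 * |C| * (c⁻¹ / |g|)) := by
      calc _ ≤ _ := h1
        _ = (2 * Real.pi) ^ 2 * |C| * ρ * ρ ^ 2 := by ring
        _ = _ := by rw [h3]; ring
    exact le_of_mul_le_mul_left h4 (by positivity)
  have hφ : resR 1 one_pos (a₀ + t • x) = resR 1 one_pos a₀ + t • resR 1 one_pos x := by
    rw [map_add, map_smul]
  have hS2 : HasSch (schwPot V) (resR 1 one_pos x) (E₀ • resR 1 one_pos x +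
      (resR 1 one_pos (a₀ + t • x) -
        c⁻¹ • mulR (a₀ + t • x) (mulR (a₀ + t • x) (resR 1 one_pos (a₀ + t • x))))) := by
    have h1 := ((hS.smul ρ⁻¹).sub h0).smul t⁻¹
    have hg3 : ρ⁻¹ * (g * (ρ * (ρ * ρ))) = t * c⁻¹ := by
      rw [← hρ2]; field_simp
    convert h1 using 1
    · rw [hx, map_smul, inv_smul_smul₀ hρ.ne', hφ, add_sub_cancel_left, inv_smul_smul₀ ht0]
    · rw [hx]
      simp only [map_smul, smul_apply]
      generalize mulR (a₀ + t • x) (mulR (a₀ + t • x) (resR 1 one_pos (a₀ + t • x))) = w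
      have e1 : ρ⁻¹ • (E • ρ • resR 1 one_pos (a₀ + t • x) - g • ρ • ρ • ρ • w) =
          E • resR 1 one_pos (a₀ + t • x) - (t * c⁻¹) • w := by
        rw [← hg3, smul_sub, smul_comm E ρ, inv_smul_smul₀ hρ.ne']
        simp only [smul_smul]
      rw [e1, hφ]
      have e2 : E = E₀ + t := by rw [htd]; ring
      rw [e2]
      generalize resR 1 one_pos a₀ = p
      generalize resR 1 one_pos x = q
      have e3 : (E₀ + t) • (p + t • q) - (t * c⁻¹) • w - E₀ • p =
          t • (E₀ • q + (p + t • q - c⁻¹ • w)) := by module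
      rw [e3, inv_smul_smul₀ ht0]
  set F := resR 1 one_pos (a₀ + t • x) -
      c⁻¹ • mulR (a₀ + t • x) (mulR (a₀ + t • x) (resR 1 one_pos (a₀ + t • x))) +
        inner ℝ (resR 1 one_pos a₀) (resR 1 one_pos x) • resR 1 one_pos a₀ with hF
  have hx' : resR 1 one_pos x = resR 1 one_pos (A F) := by
    refine hA2 _ _ ?_
    convert hS2 using 1
    rw [hF]; abel
  have hxA : x = A F := by
    rw [← sub_eq_zero] at hx' ⊢
    exact resR_injective (by rw [map_sub]; exact hx')
  have hfF : f t = F := by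
    refine hEu ht0 F (hM t x hE1 hxb) ?_
    have h3 := hA3 F
    rw [← hxA] at h3
    rw [innerSL_apply_apply, ← h3, ← hxA]
    exact add_sub_cancel_right _ _
  rw [hx, map_smul, hfF, ← hxA]

/-! ### The neutral modes -/

section Krein

variable (X : Type*) [NormedAddCommGroup X] [InnerProductSpace ℝ X]

/-- The indefinite form `((p, q), (p', q')) ↦ ⟨p, p'⟩ - ⟨q, q'⟩`.  The operator whose eigenvectors
are the neutral modes is symmetric for it. -/
def kreinForm : (X × X) →L[ℝ] (X × X) →L[ℝ] ℝ :=
  let B : X →L[ℝ] X →L[ℝ] ℝ := (isBoundedBilinearMap_inner (𝕜 := ℝ) (E := X)).toContinuousLinearMap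
  B.bilinearComp (.fst ℝ X X) (.fst ℝ X X) - B.bilinearComp (.snd ℝ X X) (.snd ℝ X X)

theorem kreinForm_apply (a b : X × X) :
    kreinForm X a b = inner ℝ a.1 b.1 - inner ℝ a.2 b.2 := rfl

variable {X}

/-- The perturbation `(p, q) ↦ (-t p + 2 F p + F q, t q - 2 F q - F p)` of `diag (H, -H)`, with
`H = -Δ + V - E₀`. For `F` multiplication by `g ψ²` and `E = E₀ + t`, an eigenvector `(p, q)` of the
sum with eigenvalue `b` amounts to `L₊ ξ = b η`, `L₋ η = b ξ` for `ξ = p + q`, `η = p - q`. -/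
def modeOp (t : ℝ) (F : X →L[ℝ] X) : (X × X) →L[ℝ] (X × X) :=
  .inl ℝ X X ∘L ((2 : ℝ) • F - t • ContinuousLinearMap.id ℝ X) ∘L .fst ℝ X X +
    .inl ℝ X X ∘L F ∘L .snd ℝ X X -
    .inr ℝ X X ∘L ((2 : ℝ) • F - t • ContinuousLinearMap.id ℝ X) ∘L .snd ℝ X X -
    .inr ℝ X X ∘L F ∘L .fst ℝ X X

theorem modeOp_fst (t : ℝ) (F : X →L[ℝ] X) (w : X × X) :
    (modeOp t F w).1 = (2 : ℝ) • F w.1 - t • w.1 + F w.2 := by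
  simp [modeOp]

theorem modeOp_snd (t : ℝ) (F : X →L[ℝ] X) (w : X × X) :
    (modeOp t F w).2 = -((2 : ℝ) • F w.2 - t • w.2) - F w.1 := by
  simp [modeOp]

theorem analyticAt_modeOp {F : ℝ → X →L[ℝ] X} (hF : AnalyticAt ℝ F 0) :
    AnalyticAt ℝ (fun t => modeOp t (F t)) 0 := by
  have h2 : AnalyticAt ℝ (fun t => (2 : ℝ) • F t - t • ContinuousLinearMap.id ℝ X) 0 :=
    (hF.const_smul (c := (2 : ℝ))).sub (analyticAt_id.smul analyticAt_const)
  exact (((analyticAt_const.clmComp (h2.clmComp analyticAt_const)).add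
    (analyticAt_const.clmComp (hF.clmComp analyticAt_const))).sub
    (analyticAt_const.clmComp (h2.clmComp analyticAt_const))).sub
    (analyticAt_const.clmComp (hF.clmComp analyticAt_const))

end Krein

set_option maxHeartbeats 1000000 in
/-- The invariant subspace of `diag (H - E₀, -(H - E₀)) + (perturbation)` which continues the
kernel of `-Δ + V - E₁` in the first component; its frame is
`x ↦ (resR 1 (w t x).1, resR 1 (w t x).2)`.  At the eigenvalue `E₁ - E₀` the second component is
regular, since `2 E₀ - E₁` is not an eigenvalue of `-Δ + V`. -/
theorem exists_mode_frame {V : LinfR} (hV : MemLp V 2 volume) {E₀ E₁ : ℝ} (h01 : E₀ < E₁)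
    (hE₁ : E₁ < 0) [FiniteDimensional ℝ (realEig V E₁)]
    (h2 : ∀ u, HasSch V u ((2 * E₀ - E₁) • u) → u = 0) {F : ℝ → L2R →L[ℝ] L2R}
    (hF : AnalyticAt ℝ F 0) (hF0 : F 0 = 0) :
    ∃ (w : ℝ → realEig V E₁ →L[ℝ] L2R × L2R) (B : ℝ → realEig V E₁ →L[ℝ] realEig V E₁),
      AnalyticAt ℝ w 0 ∧ AnalyticAt ℝ B 0 ∧ (∀ x, B 0 x = (E₁ - E₀) • x) ∧
      (∀ x, resR 1 one_pos (w 0 x).1 = x ∧ (w 0 x).2 = 0) ∧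
      ∀ᶠ t in 𝓝 0, ∀ x,
        HasSch V (resR 1 one_pos (w t x).1) ((E₀ + t) • resR 1 one_pos (w t x).1 -
          (2 : ℝ) • F t (resR 1 one_pos (w t x).1) - F t (resR 1 one_pos (w t x).2) +
          resR 1 one_pos (w t (B t x)).1) ∧
        HasSch V (resR 1 one_pos (w t x).2) ((E₀ + t) • resR 1 one_pos (w t x).2 -
          (2 : ℝ) • F t (resR 1 one_pos (w t x).2) - F t (resR 1 one_pos (w t x).1) -
          resR 1 one_pos (w t (B t x)).2) := by
  set K := realEig V E₁ with hK
  set R := resR 1 one_pos with hR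
  obtain ⟨A₁, hA1, -, hA3⟩ := exists_reduced_resolvent hV hE₁ K fun u => mem_realEig
  obtain ⟨A₂, hB1, -⟩ := exists_inverse hV (l := 2 * E₀ - E₁) (by linarith) 0
    isCompactOperator_zero (fun u hu => h2 u (by simpa using hu))
  -- the kernel itself is in the range of the free resolvent
  let j : K →L[ℝ] L2R := ((E₁ + 1) • ContinuousLinearMap.id ℝ L2R - mulL ℝ V) ∘L K.subtypeL
  have hj : ∀ x : K, R (j x) = x := by
    intro x
    obtain ⟨y, hy, hy'⟩ := mem_realEig.1 x.2
    have : j x = y := by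
      change (E₁ + 1) • (x : L2R) - mulL ℝ V x = y
      rw [add_smul, one_smul, hy']; abel
    rw [this]; exact hy.symm
  -- the reduced resolvent of `diag (H, -H)` at `E₁ - E₀`: the components see `-Δ + V - E₁` and
  -- `-(-Δ + V - (2 E₀ - E₁))`
  let S : L2R × L2R →L[ℝ] L2R × L2R := (R ∘L A₁).prodMap (-(R ∘L A₂))
  obtain ⟨r, B', hr, hB', hr0, hB'0, hinv⟩ := exists_analytic_invariant
    (.inl ℝ L2R L2R ∘L K.subtypeL) (K.orthogonalProjectionOnto ∘L .fst ℝ L2R L2R)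
    (fun x => by simp) S (analyticAt_modeOp hF) (by simp [hF0, modeOp])
  let A : L2R × L2R →L[ℝ] L2R × L2R := A₁.prodMap (-A₂)
  refine ⟨fun t => .inl ℝ L2R L2R ∘L j + A ∘L r t,
    fun t => (E₁ - E₀) • ContinuousLinearMap.id ℝ K + B' t, ?_, ?_, ?_, ?_, ?_⟩
  · exact analyticAt_const.add (analyticAt_const.clmComp hr)
  · exact analyticAt_const.add hB'
  · intro x; simp [hB'0]
  · intro x
    simp only [hr0]
    constructor
    · simpa using hj x
    · simp
  have ew1 : ∀ t x, R (((ContinuousLinearMap.inl ℝ L2R L2R ∘L j + A ∘L r t) x).1) =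
      (x : L2R) + R (A₁ (r t x).1) := by
    intro t x
    rw [← hj x, ← map_add]; rfl
  have ew2 : ∀ t x, R (((ContinuousLinearMap.inl ℝ L2R L2R ∘L j + A ∘L r t) x).2) =
      -R (A₂ (r t x).2) := by
    intro t x
    rw [← map_neg]
    congr 1
    change 0 + -A₂ (r t x).2 = _
    rw [zero_add]
  filter_upwards [hinv] with t ht x
  obtain ⟨ht1, ht2⟩ := ht
  simp only [ew1, ew2]
  have hx := mem_realEig.1 x.2
  have hq : K.starProjection (r t x).1 = 0 := by
    have : K.orthogonalProjectionOnto (r t x).1 = 0 := ht2 x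
    rw [Submodule.starProjection_apply, this]; rfl
  have s1 := hA1 (r t x).1
  rw [hA3, hq, sub_zero] at s1
  have s2 := (hB1 (r t x).2).neg
  rw [zero_apply, sub_zero] at s2
  have e1 := congrArg Prod.fst (ht1 x)
  have e2 := congrArg Prod.snd (ht1 x)
  rw [Prod.fst_add, modeOp_fst] at e1
  rw [Prod.snd_add, modeOp_snd] at e2
  have c1 : ((ContinuousLinearMap.inl ℝ L2R L2R ∘L K.subtypeL) x + S (r t x)).1 =
    (x : L2R) + R (A₁ (r t x).1) := rfl
  have c2 : ((ContinuousLinearMap.inl ℝ L2R L2R ∘L K.subtypeL) x + S (r t x)).2 =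
    -R (A₂ (r t x).2) := zero_add _
  have d1 : ((ContinuousLinearMap.inl ℝ L2R L2R ∘L K.subtypeL) (B' t x) + S (r t (B' t x))).1 =
    (B' t x : L2R) + R (A₁ (r t (B' t x)).1) := rfl
  have d2 : ((ContinuousLinearMap.inl ℝ L2R L2R ∘L K.subtypeL) (B' t x) + S (r t (B' t x))).2 =
    -R (A₂ (r t (B' t x)).2) := zero_add _
  rw [c1, c2, d1] at e1
  rw [c1, c2, d2] at e2
  have f1 : (((((E₁ - E₀) • ContinuousLinearMap.id ℝ K + B' t) x : K)) : L2R) =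
      (E₁ - E₀) • (x : L2R) + B' t x := rfl
  have f2 : r t (((E₁ - E₀) • ContinuousLinearMap.id ℝ K + B' t) x) =
      (E₁ - E₀) • r t x + r t (B' t x) := by
    rw [← map_smul, ← map_add]; rfl
  rw [f1, f2]
  simp only [Prod.fst_add, Prod.snd_add, Prod.smul_fst, Prod.smul_snd, map_add, map_smul]
  constructor
  · convert hx.add s1 using 1
    rw [map_add] at e1
    generalize R (A₁ (r t x).1) = a1 at *
    generalize R (A₂ (r t x).2) = a2 at *
    have e1' : R (A₁ (r t (B' t x)).1) = (r t x).1 + ((2 : ℝ) • (F t x + F t a1) -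
        t • ((x : L2R) + a1) + F t (-a2)) - (B' t x : L2R) := by rw [e1]; abel
    rw [e1']
    module
  · convert s2 using 1
    generalize R (A₁ (r t x).1) = a1 at *
    generalize R (A₂ (r t x).2) = a2 at *
    have e2' : R (A₂ (r t (B' t x)).2) = -((r t x).2 + (-((2 : ℝ) • F t (-a2) - t • (-a2)) -
        F t ((x : L2R) + a1))) := by rw [e2, neg_neg]
    rw [e2']
    simp only [map_neg, map_add]
    module

/-- Invariance of the frame makes the reduced operator `B` symmetric for the Krein form. -/
theorem krein_symm_of_frame {V : LinfR} {c : ℝ} {F : L2R →L[ℝ] L2R}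
    (hF : ∀ u v, inner ℝ (F u) v = inner ℝ u (F v)) {p q p' q' pB qB pB' qB' : L2R}
    (h1 : HasSch V p (c • p - (2 : ℝ) • F p - F q + pB))
    (h2 : HasSch V q (c • q - (2 : ℝ) • F q - F p - qB))
    (h1' : HasSch V p' (c • p' - (2 : ℝ) • F p' - F q' + pB'))
    (h2' : HasSch V q' (c • q' - (2 : ℝ) • F q' - F p' - qB')) :
    inner ℝ pB p' - inner ℝ qB q' = inner ℝ p pB' - inner ℝ q qB' := by
  have a := h1.symm h1'
  have b := h2.symm h2'
  simp only [inner_add_left, inner_add_right, inner_sub_left, inner_sub_right,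
    real_inner_smul_left, real_inner_smul_right, hF] at a b
  linarith

/-- For coupled eigenvectors, `⟨ξ, η'⟩ = ⟨η, ξ'⟩` when the sum of the eigenvalues does not
vanish. -/
theorem inner_comm_of_modes {V : LinfR} {c b b' : ℝ} {F : L2R →L[ℝ] L2R}
    (hF : ∀ u v, inner ℝ (F u) v = inner ℝ u (F v)) {x y x' y' : L2R}
    (h1 : HasSch V x (c • x - (3 : ℝ) • F x + b • y)) (h2 : HasSch V y (c • y - F y + b • x))
    (h1' : HasSch V x' (c • x' - (3 : ℝ) • F x' + b' • y'))
    (h2' : HasSch V y' (c • y' - F y' + b' • x')) (hb : b + b' ≠ 0) :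
    inner ℝ x y' = inner ℝ y x' := by
  have e1 := h1.symm h1'
  have e2 := h2.symm h2'
  simp only [inner_add_left, inner_add_right, inner_sub_left, inner_sub_right,
    real_inner_smul_left, real_inner_smul_right, hF] at e1 e2
  have : (b + b') * (inner ℝ x y' - inner ℝ y x') = 0 := by linarith
  exact sub_eq_zero.1 ((mul_eq_zero.1 this).resolve_left hb)

/-- The neutral modes of the linearized operator, with `F t` in place of `g ψ²`.  The frame of the
invariant subspace is diagonalized analytically with respect to the Krein form, the eigenvectors
`(p, q)` are normalized by their Krein square, and the modes are `ξ = p + q` and `η = p - q`. -/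
theorem exists_modes {V : LinfR} (hV : MemLp V 2 volume) {E₀ E₁ : ℝ} (h01 : E₀ < E₁)
    (hE₁ : E₁ < 0) {N : ℕ} [FiniteDimensional ℝ (realEig V E₁)]
    (hN : Module.finrank ℝ (realEig V E₁) = N)
    (h2 : ∀ u, HasSch V u ((2 * E₀ - E₁) • u) → u = 0) {F : ℝ → L2R →L[ℝ] L2R}
    (hF : AnalyticAt ℝ F 0) (hF0 : F 0 = 0)
    (hFs : ∀ t u v, inner ℝ (F t u) v = inner ℝ u (F t v)) :
    ∃ (b : Fin N → ℝ → ℝ) (u v : Fin N → ℝ → L2R),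
      (∀ n, ContinuousAt (b n) 0 ∧ b n 0 = E₁ - E₀ ∧ ContinuousAt (u n) 0 ∧
        ContinuousAt (v n) 0 ∧ u n 0 = v n 0 ∧ resR 1 one_pos (u n 0) ∈ realEig V E₁) ∧
      ∀ᶠ t in 𝓝 0, (∀ n,
        HasSch V (resR 1 one_pos (u n t)) ((E₀ + t) • resR 1 one_pos (u n t) -
          (3 : ℝ) • F t (resR 1 one_pos (u n t)) + b n t • resR 1 one_pos (v n t)) ∧
        HasSch V (resR 1 one_pos (v n t)) ((E₀ + t) • resR 1 one_pos (v n t) -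
          F t (resR 1 one_pos (v n t)) + b n t • resR 1 one_pos (u n t))) ∧
        ∀ m n, inner ℝ (resR 1 one_pos (u m t)) (resR 1 one_pos (v n t)) =
          if m = n then (1 : ℝ) else 0 := by
  obtain ⟨w, B, hw, hB, hB0, hw0, hfr⟩ := exists_mode_frame hV h01 hE₁ h2 hF hF0
  set R := resR 1 one_pos with hR
  let RR : L2R × L2R →L[ℝ] L2R × L2R := R.prodMap R
  have hU : AnalyticAt ℝ (fun t => RR ∘L w t) 0 := analyticAt_const.clmComp hw
  have hU1 : ∀ t x, ((RR ∘L w t) x).1 = R (w t x).1 := fun t x => rfl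
  have hU2 : ∀ t x, ((RR ∘L w t) x).2 = R (w t x).2 := fun t x => rfl
  have hsym : ∀ a b : L2R × L2R, kreinForm L2R a b = kreinForm L2R b a := fun a b => by
    rw [kreinForm_apply, kreinForm_apply, real_inner_comm b.1, real_inner_comm b.2]
  obtain ⟨I, hI, e, d, hc, he, hd, he0, hed, heo⟩ := exists_analytic_eigenvectors (kreinForm L2R)
    hsym N (realEig V E₁) hN (fun t => RR ∘L w t) B hU hB (fun x y => by
      rw [kreinForm_apply, hU1, hU1, hU2, hU2, (hw0 x).1, (hw0 y).1, (hw0 x).2, (hw0 y).2, map_zero,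
        inner_zero_left, sub_zero]
      rfl) (by
      filter_upwards [hfr] with t ht x y
      simp only [kreinForm_apply, hU1, hU2]
      exact krein_symm_of_frame (hFs t) (ht x).1 (ht x).2 (ht y).1 (ht y).2)
  obtain ⟨σ⟩ : Nonempty (Fin N ≃ I) := ⟨(Fintype.equivFinOfCardEq hc).symm⟩
  -- normalization by the Krein square, which is positive at `t = 0`
  let γ : I → ℝ → ℝ := fun i t => kreinForm L2R ((RR ∘L w t) (e i t)) ((RR ∘L w t) (e i t))
  have hγ : ∀ i, ContinuousAt (γ i) 0 := fun i =>
    (analyticAt_form _ (hU.clmApply (he i)) (hU.clmApply (he i))).continuousAt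
  have hγ0 : ∀ i, 0 < γ i 0 := fun i => by
    simp only [γ]
    rw [kreinForm_apply, hU1, hU2, (hw0 _).1, (hw0 _).2, map_zero, inner_zero_left, sub_zero,
      real_inner_self_eq_norm_sq]
    have : (e i 0 : L2R) ≠ 0 := fun h => he0 i (Subtype.ext h)
    exact pow_pos (norm_pos_iff.2 this) 2
  let z : I → ℝ → L2R × L2R := fun i t => (√(γ i t))⁻¹ • w t (e i t)
  have hz : ∀ i, ContinuousAt (z i) 0 := fun i =>
    ((Real.continuous_sqrt.continuousAt.comp (hγ i)).inv₀
      (Real.sqrt_pos.2 (hγ0 i)).ne').smul (hw.clmApply (he i)).continuousAt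
  have hz1 : ∀ i, ContinuousAt (fun t => (z i t).1) 0 := fun i =>
    continuous_fst.continuousAt.comp (hz i)
  have hz2 : ∀ i, ContinuousAt (fun t => (z i t).2) 0 := fun i =>
    continuous_snd.continuousAt.comp (hz i)
  have hz20 : ∀ i, (z i 0).2 = 0 := fun i => by simp [z, (hw0 _).2]
  have hd0 : ∀ i, d i 0 = E₁ - E₀ := fun i => by
    have h1 := (hed i).self_of_nhds
    rw [hB0, ← sub_eq_zero, ← sub_smul, smul_eq_zero, sub_eq_zero] at h1
    exact (h1.resolve_right (he0 i)).symm
  refine ⟨fun n => d (σ n), fun n t => (z (σ n) t).1 + (z (σ n) t).2,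
    fun n t => (z (σ n) t).1 - (z (σ n) t).2, fun n => ⟨(hd _).continuousAt, hd0 _,
      (hz1 _).add (hz2 _), (hz1 _).sub (hz2 _), by beta_reduce; rw [hz20, add_zero, sub_zero],
      ?_⟩, ?_⟩
  · beta_reduce
    rw [hz20, add_zero]
    simp only [z, Prod.smul_fst, map_smul]
    rw [(hw0 _).1]
    exact Submodule.smul_mem _ _ (e (σ n) 0).2
  have hγev : ∀ᶠ t in 𝓝 0, ∀ i, 0 < γ i t :=
    eventually_all.2 fun i => (hγ i).eventually (lt_mem_nhds (hγ0 i))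
  have hdev : ∀ᶠ t in 𝓝 0, ∀ i, 0 < d i t :=
    eventually_all.2 fun i => (hd i).continuousAt.eventually (lt_mem_nhds (by
      rw [hd0]; linarith))
  have hoev : ∀ᶠ t in 𝓝 0, ∀ i j, i ≠ j →
      kreinForm L2R ((RR ∘L w t) (e i t)) ((RR ∘L w t) (e j t)) = 0 := by
    refine eventually_all.2 fun i => eventually_all.2 fun j => ?_
    by_cases h : i = j
    · exact Eventually.of_forall fun t h' => (h' h).elim
    · filter_upwards [heo i j h] with t ht _ using ht
  filter_upwards [hfr, eventually_all.2 hed, hγev, hdev, hoev] with t h1 h2 h3 h4 h5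
  have hp : ∀ i, HasSch V (R (z i t).1) ((E₀ + t) • R (z i t).1 - (2 : ℝ) • F t (R (z i t).1) -
      F t (R (z i t).2) + d i t • R (z i t).1) := fun i => by
    have := (h1 (e i t)).1.smul (√(γ i t))⁻¹
    rw [h2 i] at this
    simp only [z, Prod.smul_fst, Prod.smul_snd, map_smul] at this ⊢
    convert this using 1
    module
  have hq : ∀ i, HasSch V (R (z i t).2) ((E₀ + t) • R (z i t).2 - (2 : ℝ) • F t (R (z i t).2) -
      F t (R (z i t).1) - d i t • R (z i t).2) := fun i => by
    have := (h1 (e i t)).2.smul (√(γ i t))⁻¹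
    rw [h2 i] at this
    simp only [z, Prod.smul_fst, Prod.smul_snd, map_smul] at this ⊢
    convert this using 1
    module
  have hmode : ∀ n, HasSch V (R ((z (σ n) t).1 + (z (σ n) t).2))
        ((E₀ + t) • R ((z (σ n) t).1 + (z (σ n) t).2) -
          (3 : ℝ) • F t (R ((z (σ n) t).1 + (z (σ n) t).2)) +
          d (σ n) t • R ((z (σ n) t).1 - (z (σ n) t).2)) ∧
      HasSch V (R ((z (σ n) t).1 - (z (σ n) t).2))
        ((E₀ + t) • R ((z (σ n) t).1 - (z (σ n) t).2) -
          F t (R ((z (σ n) t).1 - (z (σ n) t).2)) +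
          d (σ n) t • R ((z (σ n) t).1 + (z (σ n) t).2)) := by
    intro n
    have e1 := (hp (σ n)).add (hq (σ n))
    have e2 := (hp (σ n)).sub (hq (σ n))
    simp only [map_add, map_sub]
    constructor
    · convert e1 using 1; module
    · convert e2 using 1; module
  refine ⟨hmode, fun m n => ?_⟩
  have hsymm := inner_comm_of_modes (hFs t) (hmode m).1 (hmode m).2 (hmode n).1 (hmode n).2
    (by have := h4 (σ m); have := h4 (σ n); positivity)
  have hkr : kreinForm L2R (RR (z (σ m) t)) (RR (z (σ n) t)) = if m = n then (1 : ℝ) else 0 := by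
    have : kreinForm L2R (RR (z (σ m) t)) (RR (z (σ n) t)) = (√(γ (σ m) t))⁻¹ * ((√(γ (σ n) t))⁻¹ *
        kreinForm L2R ((RR ∘L w t) (e (σ m) t)) ((RR ∘L w t) (e (σ n) t))) := by
      simp only [z, map_smul, smul_apply, smul_eq_mul, ContinuousLinearMap.comp_apply]
      ring
    rw [this]
    split_ifs with h
    · subst h
      change (√(γ (σ m) t))⁻¹ * ((√(γ (σ m) t))⁻¹ * γ (σ m) t) = 1
      have h6 := Real.sqrt_pos.2 (h3 (σ m))
      have h7 := Real.mul_self_sqrt (h3 (σ m)).le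
      field_simp
      rw [pow_two, h7]
    · rw [h5 _ _ fun h' => h (σ.injective h'), mul_zero, mul_zero]
  rw [kreinForm_apply] at hkr
  have k1 : ∀ i, (RR (z i t)).1 = R (z i t).1 := fun i => rfl
  have k2 : ∀ i, (RR (z i t)).2 = R (z i t).2 := fun i => rfl
  rw [k1, k1, k2, k2] at hkr
  simp only [map_add, map_sub, inner_add_left, inner_add_right, inner_sub_left,
    inner_sub_right] at hsymm ⊢
  linarith

section

open FourierTransform

/-! ### Products in Sobolev spaces -/

theorem lintegral_lconvolution_sq_le {f g : Space → ℝ≥0∞} (hf : Measurable f)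
    (hg : Measurable g) :
    ∫⁻ x, (f ⋆ₗ g) x ^ (2 : ℝ) ≤ (∫⁻ x, f x) ^ (2 : ℝ) * ∫⁻ x, g x ^ (2 : ℝ) := by
  -- the Cauchy-Schwarz inequality for the measure with density `f`
  have h1 : ∀ x, (f ⋆ₗ g) x ^ (2 : ℝ) ≤ (∫⁻ y, f y) * ∫⁻ y, f y * g (-y + x) ^ (2 : ℝ) := by
    intro x
    have h := ENNReal.lintegral_mul_le_Lp_mul_Lq volume Real.HolderConjugate.two_two
      (f := fun y => f y ^ (1 / 2 : ℝ)) (g := fun y => f y ^ (1 / 2 : ℝ) * g (-y + x))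
      (by fun_prop) (by fun_prop)
    have e0 : ∀ a : ℝ≥0∞, a ^ (1 / 2 : ℝ) * a ^ (1 / 2 : ℝ) = a := fun a => by
      rw [← ENNReal.rpow_add_of_nonneg _ _ (by norm_num) (by norm_num)]; norm_num
    have e1 : ∀ a : ℝ≥0∞, (a ^ (1 / 2 : ℝ)) ^ (2 : ℝ) = a := fun a => by
      rw [← ENNReal.rpow_mul]; norm_num
    have e2 : (f ⋆ₗ g) x =
        ∫⁻ y, ((fun y => f y ^ (1 / 2 : ℝ)) * fun y => f y ^ (1 / 2 : ℝ) * g (-y + x)) y := by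
      rw [lconvolution_def]
      refine lintegral_congr fun y => ?_
      rw [Pi.mul_apply, ← mul_assoc, e0]
    rw [← e2] at h
    calc (f ⋆ₗ g) x ^ (2 : ℝ) ≤ _ := ENNReal.rpow_le_rpow h (by norm_num)
      _ = _ := by
        rw [ENNReal.mul_rpow_of_nonneg _ _ (by norm_num), e1, e1]
        simp only [e1, ENNReal.mul_rpow_of_nonneg _ _ (show (0 : ℝ) ≤ 2 by norm_num)]
  calc ∫⁻ x, (f ⋆ₗ g) x ^ (2 : ℝ)
      ≤ ∫⁻ x, (∫⁻ y, f y) * ∫⁻ y, f y * g (-y + x) ^ (2 : ℝ) := lintegral_mono h1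
    _ = (∫⁻ y, f y) * ∫⁻ x, ∫⁻ y, f y * g (-y + x) ^ (2 : ℝ) :=
        lintegral_const_mul _ (by fun_prop)
    _ = (∫⁻ y, f y) * ∫⁻ y, ∫⁻ x, f y * g (-y + x) ^ (2 : ℝ) := by
        rw [lintegral_lintegral_swap (by fun_prop)]
    _ = (∫⁻ y, f y) * ∫⁻ y, f y * ∫⁻ x, g x ^ (2 : ℝ) := by
        congr 1
        refine lintegral_congr fun y => ?_
        rw [lintegral_const_mul _ (by fun_prop),
          lintegral_add_left_eq_self (fun x => g x ^ (2 : ℝ)) (-y)]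
    _ = _ := by
        rw [lintegral_mul_const _ hf, ← mul_assoc, ENNReal.rpow_two, pow_two]

/-- Young's inequality `‖f * g‖₂ ≤ ‖f‖₁ ‖g‖₂`. -/
theorem eLpNorm_lconvolution_le {f g : Space → ℝ≥0∞} (hf : Measurable f) (hg : Measurable g) :
    eLpNorm (f ⋆ₗ g) 2 volume ≤ (∫⁻ x, f x) * eLpNorm g 2 volume := by
  rw [eLpNorm_eq_lintegral_rpow_enorm_toReal (by norm_num) (by norm_num),
    eLpNorm_eq_lintegral_rpow_enorm_toReal (by norm_num) (by norm_num)]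
  simp only [enorm_eq_self, ENNReal.toReal_ofNat]
  refine (ENNReal.rpow_le_rpow (lintegral_lconvolution_sq_le hf hg) (by norm_num)).trans ?_
  rw [ENNReal.mul_rpow_of_nonneg _ _ (by norm_num), ← ENNReal.rpow_mul]
  norm_num

/-- A Peetre type inequality, which distributes derivatives over the factors of a product. -/
theorem weight_le_add {s : ℝ} (hs : 0 ≤ s) (x y : Space) :
    weight s x ≤ 4 ^ (s / 2) * (weight s y + weight s (-y + x)) := by
  have h0 : ‖x‖ ≤ ‖y‖ + ‖-y + x‖ := by
    calc ‖x‖ = ‖y + (-y + x)‖ := by congr 1; abel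
      _ ≤ _ := norm_add_le _ _
  have h1 : 1 + ‖x‖ ^ 2 ≤ 4 * max (1 + ‖y‖ ^ 2) (1 + ‖-y + x‖ ^ 2) := by
    have := le_max_left (1 + ‖y‖ ^ 2) (1 + ‖-y + x‖ ^ 2)
    have := le_max_right (1 + ‖y‖ ^ 2) (1 + ‖-y + x‖ ^ 2)
    have : ‖x‖ ^ 2 ≤ (‖y‖ + ‖-y + x‖) ^ 2 := by gcongr
    nlinarith [sq_nonneg (‖y‖ - ‖-y + x‖)]
  have h2 : weight s x ≤ 4 ^ (s / 2) * max (1 + ‖y‖ ^ 2) (1 + ‖-y + x‖ ^ 2) ^ (s / 2) := by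
    rw [← Real.mul_rpow (by norm_num) (by positivity)]
    exact Real.rpow_le_rpow (by positivity) h1 (by linarith)
  refine h2.trans (mul_le_mul_of_nonneg_left ?_ (by positivity))
  have h3 := weight_pos s y
  have h4 := weight_pos s (-y + x)
  rcases max_choice (1 + ‖y‖ ^ 2) (1 + ‖-y + x‖ ^ 2) with h | h <;> rw [h]
  · change weight s y ≤ _; linarith
  · change weight s (-y + x) ≤ _; linarith

end

section

open FourierTransform

open scoped Convolution in
/-- The Fourier transform of a product is the convolution of the Fourier transforms. -/
theorem enorm_fourier_mul_le {u v p : L2C} (hu : Integrable (𝓕 u : L2C))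
    (hv : Integrable (𝓕 v : L2C)) (hp : p =ᵐ[volume] fun x => u x * v x) :
    ∀ᵐ ξ, ‖(𝓕 p : L2C) ξ‖ₑ ≤
      ((fun ξ => ‖(𝓕 u : L2C) ξ‖ₑ) ⋆ₗ fun ξ => ‖(𝓕 v : L2C) ξ‖ₑ) ξ := by
  let a : Space → ℂ := ⇑(𝓕 u : L2C)
  let b : Space → ℂ := ⇑(𝓕 v : L2C)
  let c : Space → ℂ := a ⋆[ContinuousLinearMap.mul ℂ ℂ] b
  have hci : Integrable c := hu.integrable_convolution _ hv
  have hle : ∀ ξ, ‖c ξ‖ₑ ≤ ((fun ξ => ‖a ξ‖ₑ) ⋆ₗ fun ξ => ‖b ξ‖ₑ) ξ := fun ξ => by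
    rw [lconvolution_def]
    refine (enorm_integral_le_lintegral_enorm _).trans (lintegral_mono fun y => le_of_eq ?_)
    rw [ContinuousLinearMap.mul_apply', enorm_mul, sub_eq_neg_add]
  have ha : Measurable fun ξ => ‖a ξ‖ₑ := (Lp.stronglyMeasurable _).measurable.enorm
  have hb : Measurable fun ξ => ‖b ξ‖ₑ := (Lp.stronglyMeasurable _).measurable.enorm
  have hc2 : MemLp c 2 volume := by
    refine ⟨hci.1, ?_⟩
    calc eLpNorm c 2 volume ≤ eLpNorm ((fun ξ => ‖a ξ‖ₑ) ⋆ₗ fun ξ => ‖b ξ‖ₑ) 2 volume :=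
          eLpNorm_mono_enorm fun ξ => by rw [enorm_eq_self]; exact hle ξ
      _ ≤ _ := eLpNorm_lconvolution_le ha hb
      _ < ⊤ := by
        refine ENNReal.mul_lt_top hu.2 ?_
        rw [eLpNorm_enorm]
        exact (Lp.memLp _).2
  have hca := hc2.coeFn_toLp
  have hh := coeFn_fourierInv_of_integrable hc2.toLp (hci.congr hca.symm)
  have hu' := coeFn_fourierInv_of_integrable _ hu
  have hv' := coeFn_fourierInv_of_integrable _ hv
  rw [fourierInv_fourier_eq] at hu' hv'
  have hfin : (𝓕 p : L2C) = hc2.toLp := by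
    have : (𝓕⁻ hc2.toLp : L2C) = p := by
      apply Lp.ext
      filter_upwards [hh, hu', hv', hp] with x h1 h2 h3 h4
      have h5 : (𝓕⁻ (hc2.toLp : Space → ℂ) : Space → ℂ) x = (𝓕⁻ c : Space → ℂ) x := by
        rw [Real.fourierInv_eq, Real.fourierInv_eq]
        exact integral_congr_ae (hca.mono fun y hy => by simp only [hy])
      rw [h1, h5, h4, h2, h3, Real.fourierInv_eq_fourier_neg, Real.fourierInv_eq_fourier_neg,
        Real.fourierInv_eq_fourier_neg]
      exact Real.fourier_mul_convolution_eq hu hv (-x)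
    rw [← this, fourier_fourierInv_eq]
  rw [hfin]
  filter_upwards [hca] with ξ h
  rw [h]
  exact hle ξ

theorem sobolevNorm_eq' (s : ℝ) (u : L2C) : sobolevNorm s u =
    eLpNorm (fun ξ => ENNReal.ofReal (weight s ξ) * ‖(𝓕 u : L2C) ξ‖ₑ) 2 volume := by
  rw [sobolevNorm_eq]
  refine eLpNorm_congr_enorm_ae (Eventually.of_forall fun ξ => ?_)
  rw [enorm_eq_self, enorm_mul, ← ofReal_norm (weight s ξ : ℂ), Complex.norm_real,
    Real.norm_of_nonneg (weight_pos s ξ).le]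

theorem sobolevNorm_mono {s t : ℝ} (h : s ≤ t) (u : L2C) : sobolevNorm s u ≤ sobolevNorm t u := by
  rw [sobolevNorm_eq', sobolevNorm_eq']
  refine eLpNorm_mono_enorm fun ξ => ?_
  simp only [enorm_eq_self]
  gcongr
  exact weight_mono h ξ

theorem sobolevNorm_zero_left (u : L2C) : sobolevNorm 0 u = ‖u‖ₑ := by
  rw [sobolevNorm_eq', ← ofReal_norm, ← Lp.norm_fourier_eq, ofReal_norm, Lp.enorm_def]
  refine eLpNorm_congr_enorm_ae (Eventually.of_forall fun ξ => ?_)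
  rw [enorm_eq_self, weight_zero, ENNReal.ofReal_one, one_mul]

theorem sobolevNorm_add_le (s : ℝ) (u v : L2C) :
    sobolevNorm s (u + v) ≤ sobolevNorm s u + sobolevNorm s v := by
  have hm : ∀ u : L2C, AEStronglyMeasurable (fun ξ => (weight s ξ : ℂ) * (𝓕 u : L2C) ξ) volume :=
    fun u => (Complex.continuous_ofReal.comp (continuous_weight s)).aestronglyMeasurable.mul
      (Lp.aestronglyMeasurable _)
  rw [sobolevNorm_eq, sobolevNorm_eq, sobolevNorm_eq]
  refine le_trans (le_of_eq (eLpNorm_congr_ae ?_)) (eLpNorm_add_le (hm u) (hm v) (by norm_num))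
  filter_upwards [coeFn_fourier_add u v] with ξ h
  rw [h, Pi.add_apply, mul_add]

theorem sobolevNorm_smul_le (s : ℝ) (c : ℂ) (u : L2C) :
    sobolevNorm s (c • u) ≤ ‖c‖ₑ * sobolevNorm s u := by
  rw [sobolevNorm_eq, sobolevNorm_eq]
  refine le_of_eq ?_
  rw [← eLpNorm_const_smul]
  refine eLpNorm_congr_ae ?_
  filter_upwards [coeFn_fourier_smul c u] with ξ h
  rw [h, Pi.smul_apply, smul_eq_mul]; ring

/-- The free resolvent gains two derivatives. -/
theorem sobolevNorm_resC_le (s : ℝ) (u : L2C) :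
    sobolevNorm (s + 2) (resC 1 one_pos u) ≤ sobolevNorm s u := by
  rw [sobolevNorm_eq', sobolevNorm_eq']
  refine eLpNorm_mono_enorm_ae ?_
  filter_upwards [fourier_resC one_pos u] with ξ h
  have h1 := resSymbol_le_weight one_pos ξ
  rw [inv_one, max_self, one_mul] at h1
  have h2 : weight (s + 2) ξ * resSymbol 1 ξ ≤ weight s ξ := by
    have h3 : weight s ξ = weight (s + 2) ξ * weight (-2) ξ := by rw [← weight_add]; ring_nf
    rw [h3]
    exact mul_le_mul_of_nonneg_left h1 (weight_pos _ _).le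
  have h4 : ‖(resSymbol 1 ξ : ℂ)‖ₑ = ENNReal.ofReal (resSymbol 1 ξ) := by
    rw [← ofReal_norm, Complex.norm_real, Real.norm_of_nonneg (resSymbol_pos one_pos ξ).le]
  rw [enorm_eq_self, enorm_eq_self, h, enorm_mul, h4, ← mul_assoc,
    ← ENNReal.ofReal_mul (weight_pos _ _).le]
  gcongr

/-- Functions in `H²(ℝ³)` have integrable Fourier transforms. -/
theorem exists_lintegral_fourier_le : ∃ C : ℝ≥0∞, C ≠ ⊤ ∧ ∀ u : L2C,
    ∫⁻ ξ, ‖(𝓕 u : L2C) ξ‖ₑ ≤ C * sobolevNorm 2 u := by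
  refine ⟨eLpNorm (weight (-2)) 2 volume, memLp_weight_neg_two.2.ne, fun u => ?_⟩
  have h := eLpNorm_smul_le_mul_eLpNorm (p := 2) (q := 2) (r := 1) (μ := volume)
    (f := fun ξ => (weight 2 ξ : ℂ) * (𝓕 u : L2C) ξ) (φ := weight (-2))
    ((Complex.continuous_ofReal.comp (continuous_weight 2)).aestronglyMeasurable.mul
      (Lp.aestronglyMeasurable _)) (continuous_weight _).aestronglyMeasurable
  rw [← sobolevNorm_eq] at h
  refine le_trans (le_of_eq ?_) h
  rw [eLpNorm_one_eq_lintegral_enorm]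
  refine lintegral_congr fun ξ => ?_
  have e : weight (-2) ξ * weight 2 ξ = 1 := by rw [← weight_add]; norm_num [weight_zero]
  rw [Pi.smul_apply', Complex.real_smul, ← mul_assoc, ← Complex.ofReal_mul, e, Complex.ofReal_one,
    one_mul]

/-- `H^s` is an algebra for `s ≥ 2`. -/
theorem exists_sobolevNorm_mul_le {s : ℝ} (hs : 2 ≤ s) : ∃ C : ℝ≥0∞, C ≠ ⊤ ∧ ∀ u v p : L2C,
    sobolevNorm s u < ⊤ → sobolevNorm s v < ⊤ → (p =ᵐ[volume] fun x => u x * v x) →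
      sobolevNorm s p ≤ C * (sobolevNorm s u * sobolevNorm s v) := by
  obtain ⟨C, hC, hL⟩ := exists_lintegral_fourier_le
  have hL' : ∀ u : L2C, ∫⁻ ξ, ‖(𝓕 u : L2C) ξ‖ₑ ≤ C * sobolevNorm s u := fun u =>
    (hL u).trans (by gcongr; exact sobolevNorm_mono hs u)
  let K : ℝ≥0∞ := ENNReal.ofReal (4 ^ (s / 2))
  refine ⟨K * (2 * C), by finiteness, fun u v p hu hv hp => ?_⟩
  have hi : ∀ u : L2C, sobolevNorm s u < ⊤ → Integrable (𝓕 u : L2C) := fun u hu =>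
    ⟨Lp.aestronglyMeasurable _, (hL' u).trans_lt (ENNReal.mul_lt_top hC.lt_top hu)⟩
  let w : Space → ℝ≥0∞ := fun ξ => ENNReal.ofReal (weight s ξ)
  let A : Space → ℝ≥0∞ := fun ξ => ‖(𝓕 u : L2C) ξ‖ₑ
  let B : Space → ℝ≥0∞ := fun ξ => ‖(𝓕 v : L2C) ξ‖ₑ
  have hw : Measurable w := (continuous_weight s).measurable.ennreal_ofReal
  have hA : Measurable A := (Lp.stronglyMeasurable _).measurable.enorm
  have hB : Measurable B := (Lp.stronglyMeasurable _).measurable.enorm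
  have hle : ∀ ξ, w ξ * (A ⋆ₗ B) ξ ≤ K * (((w * A) ⋆ₗ B) ξ + (A ⋆ₗ (w * B)) ξ) := fun ξ => by
    simp only [lconvolution_def]
    rw [← lintegral_add_left (by fun_prop), ← lintegral_const_mul _ (by fun_prop),
      ← lintegral_const_mul _ (by fun_prop)]
    refine lintegral_mono fun y => ?_
    have h1 : w ξ ≤ K * (w y + w (-y + ξ)) := by
      simp only [w, K]
      rw [← ENNReal.ofReal_add (weight_pos _ _).le (weight_pos _ _).le,
        ← ENNReal.ofReal_mul (by positivity)]
      exact ENNReal.ofReal_le_ofReal (weight_le_add (by linarith) ξ y)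
    calc w ξ * (A y * B (-y + ξ)) ≤ K * (w y + w (-y + ξ)) * (A y * B (-y + ξ)) := by gcongr
      _ = _ := by simp only [Pi.mul_apply]; ring
  have h1 : eLpNorm ((w * A) ⋆ₗ B) 2 volume ≤ (C * sobolevNorm s v) * sobolevNorm s u := by
    rw [lconvolution_comm]
    refine (eLpNorm_lconvolution_le hB (hw.mul hA)).trans ?_
    rw [sobolevNorm_eq' s u]
    exact mul_le_mul_left (hL' v) _
  have h2 : eLpNorm (A ⋆ₗ (w * B)) 2 volume ≤ (C * sobolevNorm s u) * sobolevNorm s v := by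
    refine (eLpNorm_lconvolution_le hA (hw.mul hB)).trans ?_
    rw [sobolevNorm_eq' s v]
    exact mul_le_mul_left (hL' u) _
  have hmA : AEStronglyMeasurable ((w * A) ⋆ₗ B) volume :=
    (measurable_lconvolution _ (hw.mul hA) hB).aestronglyMeasurable
  have hmB : AEStronglyMeasurable (A ⋆ₗ (w * B)) volume :=
    (measurable_lconvolution _ hA (hw.mul hB)).aestronglyMeasurable
  calc sobolevNorm s p ≤ K * eLpNorm (((w * A) ⋆ₗ B) + (A ⋆ₗ (w * B))) 2 volume := by
        rw [sobolevNorm_eq']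
        refine eLpNorm_le_mul_eLpNorm_of_ae_le_mul'' _ (hmA.add hmB) ?_
        filter_upwards [enorm_fourier_mul_le (hi u hu) (hi v hv) hp] with ξ h
        rw [enorm_eq_self, enorm_eq_self]
        exact (mul_le_mul_right h _).trans (hle ξ)
    _ ≤ K * ((C * sobolevNorm s v) * sobolevNorm s u +
        (C * sobolevNorm s u) * sobolevNorm s v) := by
        gcongr
        exact (eLpNorm_add_le hmA hmB (by norm_num)).trans (add_le_add h1 h2)
    _ = _ := by ring

end

/-! ### Regularity and convergence in all Sobolev spaces -/

/-- A Schwartz potential as a square integrable function. -/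
def schwL2 (V : 𝓢(Space, ℝ)) : L2R := V.toLp 2

theorem sobolevNorm_schwL2_lt_top (V : 𝓢(Space, ℝ)) (s : ℝ) :
    sobolevNorm s (toC (schwL2 V)) < ⊤ := by
  let W : 𝓢(Space, ℂ) := SchwartzMap.postcompCLM Complex.ofRealCLM V
  have h1 : toC (schwL2 V) = W.toLp 2 := by
    apply Lp.ext
    filter_upwards [coeFn_toC (schwL2 V), V.coeFn_toLp 2 volume, W.coeFn_toLp 2 volume]
      with x h1 h2 h3
    rw [h1, h3]
    exact congrArg Complex.ofReal h2
  obtain ⟨f, hf⟩ := W.memSobolev (s := s) (p := 2)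
  rw [← Lp.toTemperedDistribution_toLp_eq (p := 2), ← h1] at hf
  exact (iInf₂_le f hf).trans_lt enorm_lt_top

theorem exists_sobolevNorm_schwPot_le (V : 𝓢(Space, ℝ)) {s : ℝ} (hs : 2 ≤ s) :
    ∃ C : ℝ≥0∞, C ≠ ⊤ ∧ ∀ u : L2R, sobolevNorm s (toC u) < ⊤ →
      sobolevNorm s (toC (mulL ℝ (schwPot V) u)) ≤ C * sobolevNorm s (toC u) := by
  obtain ⟨C, hC, h⟩ := exists_sobolevNorm_mul_le hs
  have hV := sobolevNorm_schwL2_lt_top V s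
  refine ⟨C * sobolevNorm s (toC (schwL2 V)), by finiteness, fun u hu => ?_⟩
  rw [mul_assoc]
  refine h _ _ _ hV hu ?_
  filter_upwards [coeFn_toC (mulL ℝ (schwPot V) u), coeFn_mulL (schwPot V) u, coeFn_schwPot V,
    V.coeFn_toLp 2 volume, coeFn_toC (schwL2 V), coeFn_toC u] with x h1 h2 h3 h4 h5 h6
  rw [h1, h2, h3, h5, h6, ← Complex.ofReal_mul]
  exact congrArg Complex.ofReal (congrArg (· * u x) h4.symm)

theorem exists_sobolevNorm_mulR_le {s : ℝ} (hs : 2 ≤ s) :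
    ∃ C : ℝ≥0∞, C ≠ ⊤ ∧ ∀ a u : L2R, sobolevNorm s (toC (resR 1 one_pos a)) < ⊤ →
      sobolevNorm s (toC u) < ⊤ → sobolevNorm s (toC (mulR a u)) ≤
        C * (sobolevNorm s (toC (resR 1 one_pos a)) * sobolevNorm s (toC u)) := by
  obtain ⟨C, hC, h⟩ := exists_sobolevNorm_mul_le hs
  refine ⟨C, hC, fun a u ha hu => h _ _ _ ha hu ?_⟩
  filter_upwards [coeFn_toC (mulR a u), coeFn_mulR a u, coeFn_toC (resR 1 one_pos a),
    coeFn_toC u] with x h1 h2 h3 h4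
  rw [h1, h2, h3, h4, Complex.ofReal_mul]

/-- The equation solved for the preimage under the free resolvent; this is the form in which
regularity is bootstrapped. -/
theorem HasSch.eq_of_resR {W : LinfR} {u f : L2R} (h : HasSch W (resR 1 one_pos u) f) :
    u = f + resR 1 one_pos u - mulL ℝ W (resR 1 one_pos u) := by
  have := h.unique ⟨u, rfl, rfl⟩
  rw [this]; abel

/-- Eigenfunctions of `-Δ + V` with `V` a Schwartz function lie in every `H^s`. -/
theorem sobolevNorm_lt_top_of_hasSch {V : 𝓢(Space, ℝ)} {z : L2R} {l : ℝ}
    (h : HasSch (schwPot V) (resR 1 one_pos z) (l • resR 1 one_pos z)) (s : ℝ) :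
    sobolevNorm s (toC (resR 1 one_pos z)) < ⊤ := by
  have key : ∀ n : ℕ, sobolevNorm (2 * n + 2) (toC (resR 1 one_pos z)) < ⊤ := by
    intro n
    induction n with
    | zero =>
      rw [toC_resR]
      refine (sobolevNorm_resC_le _ _).trans_lt ?_
      rw [Nat.cast_zero, mul_zero, sobolevNorm_zero_left]
      exact enorm_lt_top
    | succ n ih =>
      obtain ⟨C, hC, hV⟩ := exists_sobolevNorm_schwPot_le V (s := 2 * n + 2)
        (by linarith [n.cast_nonneg (α := ℝ)])
      have e : (2 * ((n + 1 : ℕ) : ℝ) + 2) = (2 * n + 2) + 2 := by push_cast; ring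
      rw [e, toC_resR]
      refine (sobolevNorm_resC_le _ _).trans_lt ?_
      rw [h.eq_of_resR]
      generalize hw : resR 1 one_pos z = w at *
      have e2 : toC (l • w + w - mulL ℝ (schwPot V) w) =
          ((l + 1 : ℝ) : ℂ) • toC w + (-1 : ℂ) • toC (mulL ℝ (schwPot V) w) := by
        rw [toC_sub, toC_add, toC_smul]; push_cast; module
      rw [e2]
      refine (sobolevNorm_add_le _ _ _).trans_lt (ENNReal.add_lt_top.2 ⟨?_, ?_⟩)
      · exact (sobolevNorm_smul_le _ _ _).trans_lt (ENNReal.mul_lt_top enorm_lt_top ih)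
      · refine (sobolevNorm_smul_le _ _ _).trans_lt (ENNReal.mul_lt_top enorm_lt_top ?_)
        exact (hV w ih).trans_lt (ENNReal.mul_lt_top hC.lt_top ih)
  obtain ⟨n, hn⟩ := exists_nat_ge s
  exact (sobolevNorm_mono (by linarith [n.cast_nonneg (α := ℝ)]) _).trans_lt (key n)

/-- Convergence to zero in `H^s`. -/
def SobolevSmall {ι : Type*} (l : Filter ι) (s : ℝ) (X : ι → L2R) : Prop :=
  Tendsto (fun i => sobolevNorm s (toC (X i))) l (𝓝 0)

namespace SobolevSmall

variable {ι : Type*} {l : Filter ι} {s : ℝ} {X Y : ι → L2R}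

theorem of_tendsto (hX : Tendsto X l (𝓝 0)) : SobolevSmall l 0 X := by
  have := (continuous_enorm.tendsto (0 : L2R)).comp hX
  rw [enorm_zero] at this
  refine this.congr fun i => ?_
  rw [sobolevNorm_zero_left, ← ofReal_norm, norm_toC, ofReal_norm]; rfl

theorem mono {t : ℝ} (h : s ≤ t) (hX : SobolevSmall l t X) : SobolevSmall l s X :=
  tendsto_of_tendsto_of_tendsto_of_le_of_le tendsto_const_nhds hX (fun _ => zero_le)
    fun _ => sobolevNorm_mono h _

theorem congr' (hX : SobolevSmall l s X) (h : ∀ᶠ i in l, X i = Y i) : SobolevSmall l s Y :=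
  Tendsto.congr' (h.mono fun i hi => by simp only [hi]) hX

theorem eventually_lt_top (hX : SobolevSmall l s X) :
    ∀ᶠ i in l, sobolevNorm s (toC (X i)) < ⊤ :=
  (tendsto_order.1 hX).2 _ ENNReal.zero_lt_top

theorem add (hX : SobolevSmall l s X) (hY : SobolevSmall l s Y) :
    SobolevSmall l s fun i => X i + Y i := by
  have := Tendsto.add hX hY
  rw [add_zero] at this
  refine tendsto_of_tendsto_of_tendsto_of_le_of_le tendsto_const_nhds this (fun _ => zero_le)
    fun i => ?_
  simp only [toC_add]
  exact sobolevNorm_add_le _ _ _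

theorem smul {c : ι → ℝ} {c₀ : ℝ} (hc : Tendsto c l (𝓝 c₀)) (hX : SobolevSmall l s X) :
    SobolevSmall l s fun i => c i • X i := by
  have h1 := (continuous_enorm.tendsto c₀).comp hc
  have := ENNReal.Tendsto.mul h1 (Or.inr ENNReal.zero_ne_top) hX (Or.inr enorm_ne_top)
  rw [mul_zero] at this
  refine tendsto_of_tendsto_of_tendsto_of_le_of_le tendsto_const_nhds this (fun _ => zero_le)
    fun i => ?_
  simp only [toC_smul]
  refine (sobolevNorm_smul_le _ _ _).trans (le_of_eq ?_)
  rw [← ofReal_norm, Complex.norm_real, ofReal_norm]; rfl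

theorem sub (hX : SobolevSmall l s X) (hY : SobolevSmall l s Y) :
    SobolevSmall l s fun i => X i - Y i :=
  (hX.add (hY.smul (tendsto_const_nhds (x := (-1 : ℝ))))).congr'
    (Eventually.of_forall fun i => by module)

theorem smul_const {c : ι → ℝ} (hc : Tendsto c l (𝓝 0)) {w : L2R}
    (hw : sobolevNorm s (toC w) < ⊤) : SobolevSmall l s fun i => c i • w := by
  have h1 := (continuous_enorm.tendsto (0 : ℝ)).comp hc
  rw [enorm_zero] at h1
  have := ENNReal.Tendsto.mul_const (b := sobolevNorm s (toC w)) h1 (Or.inr hw.ne)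
  rw [zero_mul] at this
  refine tendsto_of_tendsto_of_tendsto_of_le_of_le tendsto_const_nhds this (fun _ => zero_le)
    fun i => ?_
  simp only [toC_smul]
  refine (sobolevNorm_smul_le _ _ _).trans (le_of_eq ?_)
  rw [← ofReal_norm, Complex.norm_real, ofReal_norm]; rfl

theorem schwPot (V : 𝓢(Space, ℝ)) (hs : 2 ≤ s) (hX : SobolevSmall l s X) :
    SobolevSmall l s fun i => mulL ℝ (schwPot V) (X i) := by
  obtain ⟨C, hC, hV⟩ := exists_sobolevNorm_schwPot_le V hs
  have := ENNReal.Tendsto.const_mul (a := C) hX (Or.inr hC)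
  rw [mul_zero] at this
  exact tendsto_of_tendsto_of_tendsto_of_le_of_le' tendsto_const_nhds this
    (Eventually.of_forall fun _ => zero_le) (hX.eventually_lt_top.mono fun i hi => hV _ hi)

theorem mulR_const {y : ι → L2R} (hs : 2 ≤ s) (hy : SobolevSmall l s fun i => resR 1 one_pos (y i))
    {w : L2R} (hw : sobolevNorm s (toC w) < ⊤) : SobolevSmall l s fun i => mulR (y i) w := by
  obtain ⟨C, hC, hV⟩ := exists_sobolevNorm_mulR_le hs
  have := ENNReal.Tendsto.const_mul (a := C)
    (ENNReal.Tendsto.mul_const (b := sobolevNorm s (toC w)) hy (Or.inr hw.ne)) (Or.inr hC)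
  rw [zero_mul, mul_zero] at this
  exact tendsto_of_tendsto_of_tendsto_of_le_of_le' tendsto_const_nhds this
    (Eventually.of_forall fun _ => zero_le) (hy.eventually_lt_top.mono fun i hi => hV _ _ hi hw)

theorem mulR {y : ι → L2R} (hs : 2 ≤ s) (hy : SobolevSmall l s fun i => resR 1 one_pos (y i))
    (hX : SobolevSmall l s X) : SobolevSmall l s fun i => mulR (y i) (X i) := by
  obtain ⟨C, hC, hV⟩ := exists_sobolevNorm_mulR_le hs
  have := ENNReal.Tendsto.const_mul (a := C)
    (ENNReal.Tendsto.mul hy (Or.inr ENNReal.zero_ne_top) hX (Or.inr ENNReal.zero_ne_top))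
    (Or.inr hC)
  rw [zero_mul, mul_zero] at this
  exact tendsto_of_tendsto_of_tendsto_of_le_of_le' tendsto_const_nhds this
    (Eventually.of_forall fun _ => zero_le)
    ((hy.eventually_lt_top.and hX.eventually_lt_top).mono fun i hi => hV _ _ hi.1 hi.2)

theorem resR (hX : SobolevSmall l s X) : SobolevSmall l (s + 2) fun i => resR 1 one_pos (X i) := by
  refine tendsto_of_tendsto_of_tendsto_of_le_of_le tendsto_const_nhds hX (fun _ => zero_le)
    fun i => ?_
  simp only [toC_resR]
  exact sobolevNorm_resC_le s _

/-- Regularity is gained two derivatives at a time. -/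
theorem induct (h0 : SobolevSmall l 2 X)
    (h : ∀ s, 2 ≤ s → SobolevSmall l s X → SobolevSmall l (s + 2) X) (s : ℝ) :
    SobolevSmall l s X := by
  have key : ∀ n : ℕ, SobolevSmall l (2 * n + 2) X := by
    intro n
    induction n with
    | zero => simpa using h0
    | succ n ih =>
      have e : (2 * ((n + 1 : ℕ) : ℝ) + 2) = (2 * n + 2) + 2 := by push_cast; ring
      rw [e]
      exact h _ (by linarith [n.cast_nonneg (α := ℝ)]) ih
  obtain ⟨n, hn⟩ := exists_nat_ge s
  exact (key n).mono (by linarith [n.cast_nonneg (α := ℝ)])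

end SobolevSmall

/-- The nonlinear bound states converge to zero in every Sobolev space once they do so in `H²`. -/
theorem sobolevSmall_branch {ι : Type*} {l : Filter ι} {V : 𝓢(Space, ℝ)} {g E₀ : ℝ} {E : ι → ℝ}
    {y : ι → L2R} (hE : Tendsto E l (𝓝 E₀)) (hy : Tendsto y l (𝓝 0))
    (h : ∀ᶠ i in l, HasSch (schwPot V) (resR 1 one_pos (y i)) (E i • resR 1 one_pos (y i) -
      g • mulR (y i) (mulR (y i) (resR 1 one_pos (y i))))) (s : ℝ) :
    SobolevSmall l s fun i => resR 1 one_pos (y i) := by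
  refine SobolevSmall.induct ?_ (fun s hs ih => ?_) s
  · have := (SobolevSmall.of_tendsto hy).resR
    rwa [zero_add] at this
  · refine SobolevSmall.resR (SobolevSmall.congr' (((ih.smul (hE.add_const 1)).sub ((ih.mulR hs
      (ih.mulR hs ih)).smul (tendsto_const_nhds (x := g)))).sub (ih.schwPot V hs))
      (h.mono fun i hi => ?_))
    have e := hi.eq_of_resR
    generalize resR 1 one_pos (y i) = w at e ⊢
    generalize mulR (y i) (mulR (y i) w) = w', mulL ℝ (schwPot V) w = w'' at e ⊢
    rw [e]
    module

/-- The algebra of a bootstrap step: `p`, `q` are the components of a mode, `r` their limit, and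
`u`, `z` the preimages of `p`, `r` under the free resolvent. -/
theorem sub_eq_of_mode_eq (M W : L2R →L[ℝ] L2R) {u z p q r : L2R} {E b E₁ c : ℝ}
    (hu : u = E • p - c • M (M p) + b • q + p - W p) (hz : z = E₁ • r + r - W r) :
    (E + 1) • (p - r) + b • (q - r) - W (p - r) + (E + b - E₁) • r -
      c • (M (M (p - r)) + M (M r)) = u - z := by
  rw [hu, hz, map_sub, map_sub, map_sub]
  module

/-- One bootstrap step for a mode: the differences from the limit `z` are solved for by the free
resolvent, and the sources are small in `H^s` because `E + b → E₁`. -/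
theorem sobolevSmall_mode_step {ι : Type*} {l : Filter ι} {V : 𝓢(Space, ℝ)} {E₀ E₁ : ℝ}
    {E b : ι → ℝ} {y u v : ι → L2R} {z : L2R} (hE : Tendsto E l (𝓝 E₀))
    (hb : Tendsto b l (𝓝 (E₁ - E₀))) {s : ℝ} (hs : 2 ≤ s)
    (hy : SobolevSmall l s fun i => resR 1 one_pos (y i))
    (hz : HasSch (schwPot V) (resR 1 one_pos z) (E₁ • resR 1 one_pos z)) {c : ℝ}
    (h : ∀ᶠ i in l, HasSch (schwPot V) (resR 1 one_pos (u i)) (E i • resR 1 one_pos (u i) -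
        c • mulR (y i) (mulR (y i) (resR 1 one_pos (u i))) + b i • resR 1 one_pos (v i)))
    (hu : SobolevSmall l s (fun i => resR 1 one_pos (u i) - resR 1 one_pos z))
    (hv : SobolevSmall l s (fun i => resR 1 one_pos (v i) - resR 1 one_pos z)) :
    SobolevSmall l (s + 2) (fun i => resR 1 one_pos (u i) - resR 1 one_pos z) := by
  have hz' := sobolevNorm_lt_top_of_hasSch hz s
  have hc : Tendsto (fun i => E i + b i - E₁) l (𝓝 0) := by
    simpa using (hE.add hb).sub_const E₁
  have hc' := tendsto_const_nhds (x := c) (f := l)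
  have h1 := ((hu.smul (hE.add_const 1)).add (hv.smul hb)).sub (hu.schwPot V hs)
  have h2 := (h1.add (SobolevSmall.smul_const hc hz')).sub
    (((hy.mulR hs (hy.mulR hs hu)).add (hy.mulR hs (hy.mulR_const hs hz'))).smul hc')
  have h3 : SobolevSmall l s fun i => u i - z := by
    refine h2.congr' (h.mono fun i hi => ?_)
    exact sub_eq_of_mode_eq (mulR (y i)) (mulL ℝ (schwPot V)) hi.eq_of_resR hz.eq_of_resR
  refine h3.resR.congr' (Eventually.of_forall fun i => map_sub _ _ _)

/-- The modes converge in every Sobolev space once they converge in `H²`. -/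
theorem sobolevSmall_modes {ι : Type*} {l : Filter ι} {V : 𝓢(Space, ℝ)} {E₀ E₁ : ℝ}
    {E b : ι → ℝ} {y u v : ι → L2R} {z : L2R} (hE : Tendsto E l (𝓝 E₀))
    (hb : Tendsto b l (𝓝 (E₁ - E₀))) (hu : Tendsto u l (𝓝 z)) (hv : Tendsto v l (𝓝 z))
    (hy : ∀ s, SobolevSmall l s fun i => resR 1 one_pos (y i))
    (hz : HasSch (schwPot V) (resR 1 one_pos z) (E₁ • resR 1 one_pos z)) {c c' : ℝ}
    (h : ∀ᶠ i in l, HasSch (schwPot V) (resR 1 one_pos (u i)) (E i • resR 1 one_pos (u i) -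
        c • mulR (y i) (mulR (y i) (resR 1 one_pos (u i))) + b i • resR 1 one_pos (v i)) ∧
      HasSch (schwPot V) (resR 1 one_pos (v i)) (E i • resR 1 one_pos (v i) -
        c' • mulR (y i) (mulR (y i) (resR 1 one_pos (v i))) + b i • resR 1 one_pos (u i)))
    (s : ℝ) :
    SobolevSmall l s (fun i => resR 1 one_pos (u i) - resR 1 one_pos z) ∧
      SobolevSmall l s (fun i => resR 1 one_pos (v i) - resR 1 one_pos z) := by
  have base : ∀ {u : ι → L2R}, Tendsto u l (𝓝 z) →
      SobolevSmall l 2 (fun i => resR 1 one_pos (u i) - resR 1 one_pos z) := fun {u} hu => by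
    have h1 : Tendsto (fun i => u i - z) l (𝓝 0) := by simpa using hu.sub_const z
    have h2 := (SobolevSmall.of_tendsto h1).resR
    rw [zero_add] at h2
    exact h2.congr' (Eventually.of_forall fun i => map_sub _ _ _)
  have key : ∀ n : ℕ, SobolevSmall l (2 * n + 2)
      (fun i => resR 1 one_pos (u i) - resR 1 one_pos z) ∧
      SobolevSmall l (2 * n + 2) (fun i => resR 1 one_pos (v i) - resR 1 one_pos z) := by
    intro n
    induction n with
    | zero => simpa using And.intro (base hu) (base hv)
    | succ n ih =>
      have e : (2 * ((n + 1 : ℕ) : ℝ) + 2) = (2 * n + 2) + 2 := by push_cast; ring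
      have hn : (2 : ℝ) ≤ 2 * n + 2 := by linarith [n.cast_nonneg (α := ℝ)]
      rw [e]
      exact ⟨sobolevSmall_mode_step hE hb hn (hy _) hz (h.mono fun i hi => hi.1) ih.1 ih.2,
        sobolevSmall_mode_step hE hb hn (hy _) hz (h.mono fun i hi => hi.2) ih.2 ih.1⟩
  obtain ⟨n, hn⟩ := exists_nat_ge s
  have hs : s ≤ 2 * n + 2 := by linarith [n.cast_nonneg (α := ℝ)]
  exact ⟨(key n).1.mono hs, (key n).2.mono hs⟩

/-! ### The spectrum near the unperturbed eigenvalues -/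

section Accounting

variable {M : Type*} [AddCommGroup M] [Module ℂ M]

theorem eigenspace_le_rootSpace (A : M →ₗ.[ℂ] M) (μ : ℂ) : eigenspace A μ ≤ rootSpace A μ := by
  refine le_trans ?_ (le_iSup (genEigenspace A μ) 1)
  rintro x ⟨hx, h⟩
  exact ⟨hx, by rw [h, sub_self]; exact Submodule.zero_mem _⟩

/-- An operator with eigenvectors `e n` and dual eigenfunctionals `φ n` has no further
generalized eigenvectors at `μ` when the common kernel of the functionals contains no
eigenvector. -/
theorem eigenspace_eq_span_of_dual {ι : Type*} [Fintype ι] (A : M →ₗ.[ℂ] M) (e : ι → M)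
    (ν : ι → ℂ) (φ : ι → M →ₗ[ℂ] ℂ) (he : ∀ n, e n ∈ eigenspace A (ν n))
    (hφ : ∀ n (x : A.domain), φ n (A x) = ν n * φ n x)
    (hd : ∀ n, φ n (e n) = 1) (ho : ∀ m n, m ≠ n → φ m (e n) = 0) (μ : ℂ)
    (h0 : ∀ x ∈ eigenspace A μ, (∀ n, φ n x = 0) → x = 0) :
    eigenspace A μ = Submodule.span ℂ {w | ∃ n, μ = ν n ∧ w = e n} ∧
      rootSpace A μ = eigenspace A μ := by
  classical
  set S := Submodule.span ℂ {w | ∃ n, μ = ν n ∧ w = e n} with hS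
  have hSe : S ≤ eigenspace A μ := by
    rw [hS, Submodule.span_le]
    rintro _ ⟨n, hn, rfl⟩
    rw [hn]; exact he n
  have hφs : ∀ s ∈ S, s = ∑ n, φ n s • e n ∧ ∀ n, μ ≠ ν n → φ n s = 0 := by
    intro s hs
    induction hs using Submodule.span_induction with
    | mem x hx =>
      obtain ⟨n, hn, rfl⟩ := hx
      constructor
      · rw [Finset.sum_eq_single n (fun m _ hm => by rw [ho m n hm, zero_smul])
          (fun h => (h (Finset.mem_univ n)).elim), hd, one_smul]
      · intro m hm
        exact ho m n fun h => hm (h ▸ hn)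
    | zero => simp
    | add x y _ _ hx hy =>
      constructor
      · conv_lhs => rw [hx.1, hy.1]
        rw [← Finset.sum_add_distrib]
        exact Finset.sum_congr rfl fun n _ => by rw [map_add, add_smul]
      · intro n hn
        rw [map_add, hx.2 n hn, hy.2 n hn, add_zero]
    | smul c x _ hx =>
      constructor
      · conv_lhs => rw [hx.1]
        rw [Finset.smul_sum]
        exact Finset.sum_congr rfl fun n _ => by rw [map_smul, smul_eq_mul, mul_smul]
      · intro n hn
        rw [map_smul, hx.2 n hn, smul_zero]
  have key : ∀ x (hx : x ∈ A.domain), A ⟨x, hx⟩ - μ • x ∈ S → x ∈ S := by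
    intro x hx hxS
    have h1 : ∀ n, φ n (A ⟨x, hx⟩ - μ • x) = (ν n - μ) * φ n x := fun n => by
      rw [map_sub, hφ, map_smul, smul_eq_mul, sub_mul]
    have h2 : A ⟨x, hx⟩ - μ • x = 0 := by
      rw [(hφs _ hxS).1]
      refine Finset.sum_eq_zero fun n _ => ?_
      by_cases hn : μ = ν n
      · rw [h1, hn, sub_self, zero_mul, zero_smul]
      · rw [(hφs _ hxS).2 n hn, zero_smul]
    have hxe : x ∈ eigenspace A μ := ⟨hx, sub_eq_zero.1 h2⟩
    have h3 : ∀ n, μ ≠ ν n → φ n x = 0 := fun n hn => by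
      have := h1 n
      rw [h2, map_zero] at this
      exact (mul_eq_zero.1 this.symm).resolve_left (sub_ne_zero.2 hn.symm)
    have h4 : ∑ n, φ n x • e n ∈ S := Submodule.sum_mem _ fun n _ => by
      by_cases hn : μ = ν n
      · exact Submodule.smul_mem _ _ (Submodule.subset_span ⟨n, hn, rfl⟩)
      · rw [h3 n hn, zero_smul]; exact Submodule.zero_mem _
    have h5 : x - ∑ n, φ n x • e n = 0 := by
      refine h0 _ (Submodule.sub_mem _ hxe (hSe h4)) fun m => ?_
      rw [map_sub, map_sum, Finset.sum_eq_single m (fun n _ hn => by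
        rw [map_smul, ho m n hn.symm, smul_zero]) (fun h => (h (Finset.mem_univ m)).elim),
        map_smul, hd, smul_eq_mul, mul_one, sub_self]
    rw [sub_eq_zero.1 h5]
    exact h4
  have hroot : rootSpace A μ ≤ S := by
    refine iSup_le fun k => ?_
    induction k with
    | zero => exact bot_le
    | succ k ih =>
      rintro x ⟨hx, h⟩
      exact key x hx (ih h)
  have h1 : eigenspace A μ = S := le_antisymm ((eigenspace_le_rootSpace A μ).trans hroot) hSe
  exact ⟨h1, le_antisymm (h1 ▸ hroot) (eigenspace_le_rootSpace A μ)⟩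

end Accounting

/-- A solution of `(-Δ + V - l) u = f` is controlled by `f` off the kernel of `-Δ + V - l`. -/
theorem exists_norm_sub_starProjection_le {V : LinfR} (hV : MemLp V 2 volume) {l : ℝ}
    (hl : l < 0) [FiniteDimensional ℝ (realEig V l)] :
    ∃ C, 0 ≤ C ∧ ∀ u f, HasSch V u (l • u + f) →
      ‖u - (realEig V l).starProjection u‖ ≤ C * ‖f‖ := by
  obtain ⟨A, -, hA, -⟩ := exists_reduced_resolvent hV hl (realEig V l) fun u => mem_realEig
  refine ⟨‖resR 1 one_pos ∘L A‖, norm_nonneg _, fun u f h => ?_⟩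
  set P := (realEig V l).starProjection with hP
  have h1 : HasSch V (u - P u) (f + l • (u - P u) - P (u - P u)) := by
    have h2 : HasSch V (P u) (l • P u) := (realEig V l).starProjection_apply_mem u
    have h3 : P (P u) = P u :=
      Submodule.starProjection_eq_self_iff.2 ((realEig V l).starProjection_apply_mem u)
    have h4 : P (u - P u) = 0 := by rw [map_sub, h3, sub_self]
    rw [h4]
    convert h.sub h2 using 1
    module
  conv_lhs => rw [hA _ _ h1]
  exact (resR 1 one_pos ∘L A).le_opNorm f

theorem norm_starProjection_le_sum {K : Submodule ℝ L2R} [FiniteDimensional ℝ K] {N : ℕ}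
    (hN : Module.finrank ℝ K = N) {ζ : Fin N → L2R} (hζ : ∀ n, ζ n ∈ K)
    (hon : ∀ m n, inner ℝ (ζ m) (ζ n) = if m = n then (1 : ℝ) else 0) (p : L2R) :
    ‖K.starProjection p‖ ≤ ∑ n, |inner ℝ (ζ n) p| := by
  let z : Fin N → K := fun n => ⟨ζ n, hζ n⟩
  have hz : Orthonormal ℝ z := orthonormal_iff_ite.2 hon
  have hsp : ⊤ ≤ Submodule.span ℝ (Set.range z) :=
    (hz.linearIndependent.span_eq_top_of_card_eq_finrank' (by simpa using hN.symm)).ge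
  let b := OrthonormalBasis.mk hz hsp
  have hb : ∀ n, (b n : L2R) = ζ n := fun n => by
    simp only [b, OrthonormalBasis.coe_mk, z]
  have h1 : ∀ n, ‖ζ n‖ = 1 := fun n => hz.1 n
  have h2 : K.starProjection p = ∑ n, inner ℝ (ζ n) p • ζ n := by
    have h3 := congrArg Subtype.val (b.orthogonalProjectionOnto_apply_eq_sum p)
    rw [Submodule.coe_sum] at h3
    refine Eq.trans h3 (Finset.sum_congr rfl fun n _ => ?_)
    rw [Submodule.coe_smul, hb]
  rw [h2]
  refine (norm_sum_le _ _).trans (Finset.sum_le_sum fun n _ => ?_)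
  rw [norm_smul, h1, mul_one, Real.norm_eq_abs]

/-- Quantitative uniqueness for the linearized equation near the unperturbed eigenvalue: a solution
which is Krein-orthogonal to the modes is controlled by the defects. -/
theorem exists_mode_bound {V : LinfR} (hV : MemLp V 2 volume) {E₀ E₁ : ℝ} (h01 : E₀ < E₁)
    (hE₁ : E₁ < 0) {N : ℕ} [FiniteDimensional ℝ (realEig V E₁)]
    (hN : Module.finrank ℝ (realEig V E₁) = N)
    (h2 : ∀ u, HasSch V u ((2 * E₀ - E₁) • u) → u = 0) {ζ : Fin N → L2R}
    (hζ : ∀ n, ζ n ∈ realEig V E₁)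
    (hon : ∀ m n, inner ℝ (ζ m) (ζ n) = if m = n then (1 : ℝ) else 0) :
    ∃ C, 0 < C ∧ ∀ (t τ : ℝ) (F : L2R →L[ℝ] L2R) (ξ η : Fin N → L2R) (u v r s : L2R),
      |t| ≤ τ → ‖F‖ ≤ τ → (∀ n, ‖ξ n - ζ n‖ ≤ τ) → (∀ n, ‖η n - ζ n‖ ≤ τ) →
      HasSch V u ((E₀ + t) • u - (3 : ℝ) • F u + ((E₁ - E₀) • v + r)) →
      HasSch V v ((E₀ + t) • v - F v + ((E₁ - E₀) • u + s)) →
      (∀ n, inner ℝ (ξ n) v + inner ℝ (η n) u = 0) →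
      ‖u‖ + ‖v‖ ≤ C * (τ * (‖u‖ + ‖v‖) + ‖r‖ + ‖s‖) := by
  obtain ⟨C₁, hC₁, hp⟩ := exists_norm_sub_starProjection_le hV hE₁
  have hbot : realEig V (2 * E₀ - E₁) = ⊥ :=
    (Submodule.eq_bot_iff _).2 fun u hu => h2 u hu
  have : FiniteDimensional ℝ (realEig V (2 * E₀ - E₁)) := by rw [hbot]; infer_instance
  obtain ⟨C₂, hC₂, hq⟩ := exists_norm_sub_starProjection_le (V := V) (l := 2 * E₀ - E₁) hV
    (by linarith)
  have hq' : ∀ u f, HasSch V u ((2 * E₀ - E₁) • u + f) → ‖u‖ ≤ C₂ * ‖f‖ := fun u f h => by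
    have h3 : (realEig V (2 * E₀ - E₁)).starProjection u = 0 := by
      have := (realEig V (2 * E₀ - E₁)).starProjection_apply_mem u
      exact h2 _ this
    simpa [h3] using hq u f h
  refine ⟨4 * (C₁ + C₂ + 1) + N, by positivity, fun t τ F ξ η u v r s ht hF hξ hη hu hv ho => ?_⟩
  have hτ : 0 ≤ τ := (abs_nonneg t).trans ht
  have hp1 : HasSch V (u + v) (E₁ • (u + v) + (t • (u + v) - (3 : ℝ) • F u - F v + r + s)) := by
    convert hu.add hv using 1
    module
  have hq1 : HasSch V (u - v)
      ((2 * E₀ - E₁) • (u - v) + (t • (u - v) - (3 : ℝ) • F u + F v + r - s)) := by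
    convert hu.sub hv using 1
    module
  have b1 : ∀ w, ‖F w‖ ≤ τ * ‖w‖ := fun w => F.le_of_opNorm_le hF w
  have b2 : ∀ w : L2R, ‖t • w‖ ≤ τ * ‖w‖ := fun w => by
    rw [norm_smul, Real.norm_eq_abs]
    exact mul_le_mul_of_nonneg_right ht (norm_nonneg _)
  have b3 : ‖(3 : ℝ) • F u‖ ≤ 3 * (τ * ‖u‖) := by
    rw [norm_smul, Real.norm_of_nonneg (by norm_num)]
    exact mul_le_mul_of_nonneg_left (b1 u) (by norm_num)
  set T := ‖u‖ + ‖v‖ with hT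
  have nu := norm_nonneg u
  have nv := norm_nonneg v
  have hTu : τ * ‖u‖ + τ * ‖v‖ = τ * T := by rw [hT]; ring
  have hτu : 0 ≤ τ * ‖u‖ := by positivity
  have hτv : 0 ≤ τ * ‖v‖ := by positivity
  have f1 : ‖t • (u + v) - (3 : ℝ) • F u - F v + r + s‖ ≤ 4 * (τ * T) + ‖r‖ + ‖s‖ := by
    have e1 : ‖t • (u + v)‖ ≤ τ * T := (b2 _).trans (by gcongr; exact norm_add_le _ _)
    have e2 := norm_add_le (t • (u + v) - (3 : ℝ) • F u - F v + r) s
    have e3 := norm_add_le (t • (u + v) - (3 : ℝ) • F u - F v) r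
    have e4 := norm_sub_le (t • (u + v) - (3 : ℝ) • F u) (F v)
    have e5 := norm_sub_le (t • (u + v)) ((3 : ℝ) • F u)
    have := b1 v
    linarith
  have f2 : ‖t • (u - v) - (3 : ℝ) • F u + F v + r - s‖ ≤ 4 * (τ * T) + ‖r‖ + ‖s‖ := by
    have e1 : ‖t • (u - v)‖ ≤ τ * T := (b2 _).trans (by gcongr; exact norm_sub_le _ _)
    have e2 := norm_sub_le (t • (u - v) - (3 : ℝ) • F u + F v + r) s
    have e3 := norm_add_le (t • (u - v) - (3 : ℝ) • F u + F v) r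
    have e4 := norm_add_le (t • (u - v) - (3 : ℝ) • F u) (F v)
    have e5 := norm_sub_le (t • (u - v)) ((3 : ℝ) • F u)
    have := b1 v
    linarith
  have f3 : ‖(realEig V E₁).starProjection (u + v)‖ ≤ N * (τ * T) := by
    refine (norm_starProjection_le_sum hN hζ hon _).trans ?_
    have : ∀ n ∈ Finset.univ, |inner ℝ (ζ n) (u + v)| ≤ τ * T := fun n _ => by
      have e1 : inner ℝ (ζ n) (u + v) = -(inner ℝ (ξ n - ζ n) v + inner ℝ (η n - ζ n) u) := by
        rw [inner_sub_left, inner_sub_left, inner_add_right]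
        linarith [ho n]
      rw [e1, abs_neg]
      refine (abs_add_le _ _).trans ?_
      have e2 := (abs_real_inner_le_norm (ξ n - ζ n) v).trans
        (mul_le_mul_of_nonneg_right (hξ n) nv)
      have e3 := (abs_real_inner_le_norm (η n - ζ n) u).trans
        (mul_le_mul_of_nonneg_right (hη n) nu)
      linarith
    refine (Finset.sum_le_sum this).trans (le_of_eq ?_)
    rw [Finset.sum_const, Finset.card_univ, Fintype.card_fin, nsmul_eq_mul]
  have g1 : ‖u + v‖ ≤ C₁ * (4 * (τ * T) + ‖r‖ + ‖s‖) + N * (τ * T) := by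
    have e1 := (hp _ _ hp1).trans (mul_le_mul_of_nonneg_left f1 hC₁)
    have e2 := norm_add_le (u + v - (realEig V E₁).starProjection (u + v))
      ((realEig V E₁).starProjection (u + v))
    rw [sub_add_cancel] at e2
    linarith
  have g2 := (hq' _ _ hq1).trans (mul_le_mul_of_nonneg_left f2 hC₂)
  have g3 : T ≤ ‖u + v‖ + ‖u - v‖ := by
    have e1 : (2 : ℝ) * ‖u‖ ≤ ‖u + v‖ + ‖u - v‖ := by
      have := norm_add_le (u + v) (u - v)
      rwa [show u + v + (u - v) = (2 : ℝ) • u by module, norm_smul,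
        Real.norm_of_nonneg (by norm_num)] at this
    have e2 : (2 : ℝ) * ‖v‖ ≤ ‖u + v‖ + ‖u - v‖ := by
      have := norm_sub_le (u + v) (u - v)
      rwa [show u + v - (u - v) = (2 : ℝ) • v by module, norm_smul,
        Real.norm_of_nonneg (by norm_num)] at this
    linarith
  have nr := norm_nonneg r
  have ns := norm_nonneg s
  have hτT : 0 ≤ τ * T := by positivity
  have k1 : (C₁ + C₂) * (4 * (τ * T) + ‖r‖ + ‖s‖) ≤ 4 * (C₁ + C₂) * (τ * T + ‖r‖ + ‖s‖) := by
    have : 0 ≤ (C₁ + C₂) * (‖r‖ + ‖s‖) := by positivity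
    linarith
  have k2 : (N : ℝ) * (τ * T) ≤ N * (τ * T + ‖r‖ + ‖s‖) := by gcongr; linarith
  calc T ≤ (C₁ + C₂) * (4 * (τ * T) + ‖r‖ + ‖s‖) + N * (τ * T) := by linarith
    _ ≤ 4 * (C₁ + C₂) * (τ * T + ‖r‖ + ‖s‖) + N * (τ * T + ‖r‖ + ‖s‖) := add_le_add k1 k2
    _ ≤ _ := by
      have : 0 ≤ 4 * (τ * T + ‖r‖ + ‖s‖) := by positivity
      linarith

/-! ### The linearized operator on real and imaginary parts -/

/-- The potential `-E + V + k φ²`, `φ = resR 1 y`, with all but `V` moved to the right-hand side. -/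
theorem hasSch_potential_iff {V : 𝓢(Space, ℝ)} {E k : ℝ} {y : L2R}
    (hW : MemLp (fun x => -E + V x + k * (resR 1 one_pos y x) ^ 2) ∞ volume) (u f : L2R) :
    HasSch hW.toLp u f ↔ HasSch (schwPot V) u (f + E • u - k • mulR y (mulR y u)) := by
  have key : mulL ℝ (schwPot V - hW.toLp) u = E • u - k • mulR y (mulR y u) := by
    apply Lp.ext
    filter_upwards [Lp.coeFn_sub (E • u) (k • mulR y (mulR y u)), Lp.coeFn_smul E u,
      Lp.coeFn_smul k (mulR y (mulR y u)), coeFn_mulR y (mulR y u), coeFn_mulR y u,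
      coeFn_mulL (schwPot V - hW.toLp) u, Lp.coeFn_sub (schwPot V) hW.toLp, hW.coeFn_toLp,
      coeFn_schwPot V] with x h1 h2 h3 h4 h5 h6 h7 h8 h9
    rw [h6, h7, Pi.sub_apply, h8, h9, h1, Pi.sub_apply, h2, h3, Pi.smul_apply, Pi.smul_apply, h4,
      h5, smul_eq_mul, smul_eq_mul]
    ring
  have key' : mulL ℝ (hW.toLp - schwPot V) u = -(E • u - k • mulR y (mulR y u)) := by
    rw [← key, ← neg_sub, map_neg]; rfl
  constructor
  · intro h
    have h1 := h.change (schwPot V)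
    rw [key] at h1
    convert h1 using 1
    abel
  · intro h
    have h1 := h.change hW.toLp
    rw [key'] at h1
    convert h1 using 1
    abel

theorem memLp_top_potential (V : 𝓢(Space, ℝ)) (E k : ℝ) (y : L2R) :
    MemLp (fun x => -E + V x + k * (resR 1 one_pos y x) ^ 2) ∞ volume := by
  have hsq : MemLp (fun x => (resR 1 one_pos y x) ^ 2) ∞ volume := by
    have := (memLp_top_resR y).mul (memLp_top_resR y) (r := ∞)
    simp only [pow_two]
    exact this
  exact ((memLp_top_const (-E)).add (V.memLp_top volume)).add (hsq.const_mul k)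

theorem schrodinger_potential_iff (V : 𝓢(Space, ℝ)) (E k : ℝ) (y : L2R) (u f : L2C) :
    (∃ h : u ∈ (schrodinger fun x => -E + V x + k * (resR 1 one_pos y x) ^ 2).domain,
      schrodinger (fun x => -E + V x + k * (resR 1 one_pos y x) ^ 2) ⟨u, h⟩ = f) ↔
    HasSch (schwPot V) (reL u) (reL f + E • reL u - k • mulR y (mulR y (reL u))) ∧
      HasSch (schwPot V) (imL u) (imL f + E • imL u - k • mulR y (mulR y (imL u))) := by
  rw [schrodinger_iff (memLp_top_potential V E k y), hasSchC_iff, hasSch_potential_iff,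
    hasSch_potential_iff]

/-- The graph of the linearized operator, in terms of real and imaginary parts. -/
theorem linearizedOp_iff {V : 𝓢(Space, ℝ)} {g E : ℝ} {y : L2R} {F : L2R →L[ℝ] L2R}
    (hF : ∀ w, F w = g • mulR y (mulR y w)) (w z : L2C × L2C) :
    (∃ h : w ∈ (linearizedOp V g E (resR 1 one_pos y)).domain,
      linearizedOp V g E (resR 1 one_pos y) ⟨w, h⟩ = z) ↔
    (HasSch (schwPot V) (reL w.1) (E • reL w.1 - (3 : ℝ) • F (reL w.1) - reL z.2) ∧
      HasSch (schwPot V) (imL w.1) (E • imL w.1 - (3 : ℝ) • F (imL w.1) - imL z.2)) ∧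
    (HasSch (schwPot V) (reL w.2) (E • reL w.2 - F (reL w.2) + reL z.1) ∧
      HasSch (schwPot V) (imL w.2) (E • imL w.2 - F (imL w.2) + imL z.1)) := by
  have h1 := schrodinger_potential_iff V E (3 * g) y w.1 (-z.2)
  have h2 := schrodinger_potential_iff V E g y w.2 z.1
  have e1 : ∀ a b : L2R, -b + E • a - (3 * g) • mulR y (mulR y a) =
      E • a - (3 : ℝ) • F a - b := fun a b => by rw [hF]; module
  have e2 : ∀ a b : L2R, b + E • a - g • mulR y (mulR y a) = E • a - F a + b := fun a b => by
    rw [hF]; module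
  rw [map_neg, map_neg, e1, e1] at h1
  rw [e2, e2] at h2
  rw [← h1, ← h2]
  constructor
  · rintro ⟨h, rfl⟩
    exact ⟨⟨h.1, (neg_neg _).symm⟩, ⟨h.2, rfl⟩⟩
  · rintro ⟨⟨a, ha⟩, ⟨b, hb⟩⟩
    exact ⟨⟨a, b⟩, Prod.ext hb (neg_eq_iff_eq_neg.2 ha)⟩

/-- The functional dual to the mode `(ξ, σ i η)` for the Krein pairing. -/
def modeDual (σ : ℝ) (ξ η : L2R) : (L2C × L2C) →ₗ[ℂ] ℂ :=
  (1 / 2 : ℂ) • ((innerSL ℂ (toC η) : L2C →ₗ[ℂ] ℂ) ∘ₗ LinearMap.fst ℂ L2C L2C -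
    (σ * Complex.I) • (innerSL ℂ (toC ξ) : L2C →ₗ[ℂ] ℂ) ∘ₗ LinearMap.snd ℂ L2C L2C)

theorem modeDual_apply (σ : ℝ) (ξ η : L2R) (w : L2C × L2C) : modeDual σ ξ η w =
    (1 / 2 : ℂ) * (inner ℂ (toC η) w.1 - σ * Complex.I * inner ℂ (toC ξ) w.2) := rfl

section Mode

variable {V : 𝓢(Space, ℝ)} {g E b σ : ℝ} {y ξ η : L2R} {F : L2R →L[ℝ] L2R}

/-- Solutions of `L₊ ξ = b η`, `L₋ η = b ξ` give eigenvectors `(ξ, σ i η)` with eigenvalue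
`σ i b`. -/
theorem mem_eigenspace_of_mode (hF : ∀ w, F w = g • mulR y (mulR y w)) (hσ : σ = 1 ∨ σ = -1)
    (hξ : HasSch (schwPot V) ξ (E • ξ - (3 : ℝ) • F ξ + b • η))
    (hη : HasSch (schwPot V) η (E • η - F η + b • ξ)) :
    ((toC ξ, (σ * Complex.I) • toC η) : L2C × L2C) ∈
      eigenspace (linearizedOp V g E (resR 1 one_pos y)) (σ * Complex.I * b) := by
  have hσ2 : σ * σ = 1 := by rcases hσ with rfl | rfl <;> norm_num
  have e1 : (σ * Complex.I) • toC η = Complex.I • toC (σ • η) := by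
    rw [toC_smul, smul_smul, mul_comm]
  have e2 : ((σ : ℂ) * Complex.I * b) • toC ξ = Complex.I • toC ((σ * b) • ξ) := by
    rw [toC_smul, smul_smul]; push_cast; ring_nf
  have e3 : ((σ : ℂ) * Complex.I * b) • (σ * Complex.I) • toC η = toC (-(b • η)) := by
    rw [toC_neg, toC_smul, smul_smul, ← neg_smul]
    congr 1
    have : (σ : ℂ) * σ = 1 := by exact_mod_cast hσ2
    linear_combination (b : ℂ) * this * Complex.I ^ 2 + b * Complex.I_sq
  refine (linearizedOp_iff hF _ _).2 ?_
  simp only [Prod.smul_fst, Prod.smul_snd]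
  rw [e3, e1, e2, reL_toC, imL_toC, reL_toC, imL_toC, reL_smul_I, imL_smul_I, reL_smul_I,
    imL_smul_I, imL_toC, imL_toC, reL_toC, reL_toC]
  simp only [neg_zero, map_zero, smul_zero, sub_zero, add_zero]
  refine ⟨⟨?_, HasSch.zero⟩, HasSch.zero, ?_⟩
  · convert hξ using 1
    abel
  · convert hη.smul σ using 1
    rw [map_smul]
    module

/-- The dual functional of a mode is an eigenfunctional of the linearized operator, by the symmetry
of `L₊` and `L₋`. -/
theorem modeDual_linearizedOp (hF : ∀ w, F w = g • mulR y (mulR y w)) (hσ : σ = 1 ∨ σ = -1)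
    (hξ : HasSch (schwPot V) ξ (E • ξ - (3 : ℝ) • F ξ + b • η))
    (hη : HasSch (schwPot V) η (E • η - F η + b • ξ))
    (w : (linearizedOp V g E (resR 1 one_pos y)).domain) :
    modeDual σ ξ η (linearizedOp V g E (resR 1 one_pos y) w) =
      (σ * Complex.I * b) * modeDual σ ξ η w := by
  have hσ2 : (σ : ℂ) * σ = 1 := by rcases hσ with rfl | rfl <;> norm_num
  set z := linearizedOp V g E (resR 1 one_pos y) w with hz
  obtain ⟨⟨a1, a2⟩, a3, a4⟩ := (linearizedOp_iff hF (w : L2C × L2C) z).1 ⟨w.2, rfl⟩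
  have hFs : ∀ u v, inner ℝ (F u) v = inner ℝ u (F v) := fun u v => by
    rw [hF, hF, real_inner_smul_left, real_inner_smul_right, mulR_symm, mulR_symm]
  have s1 : ∀ p q : L2R, HasSch (schwPot V) p (E • p - (3 : ℝ) • F p - q) →
      inner ℝ ξ q = -(b * inner ℝ η p) := fun p q h => by
    have := hξ.symm h
    rw [inner_add_left, inner_sub_left, inner_sub_right, inner_sub_right, real_inner_smul_left,
      real_inner_smul_left, real_inner_smul_left, real_inner_smul_right, real_inner_smul_right,
      hFs] at this
    linarith
  have s2 : ∀ p q : L2R, HasSch (schwPot V) p (E • p - F p + q) →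
      inner ℝ η q = b * inner ℝ ξ p := fun p q h => by
    have := hη.symm h
    rw [inner_add_left, inner_sub_left, inner_add_right, inner_sub_right, real_inner_smul_left,
      real_inner_smul_left, real_inner_smul_right, hFs] at this
    linarith
  have c1 : inner ℂ (toC ξ) z.2 = -(b * inner ℂ (toC η) (w : L2C × L2C).1) := by
    apply Complex.ext
    · simp only [Complex.neg_re, Complex.re_ofReal_mul, inner_toC_left_re]; exact s1 _ _ a1
    · simp only [Complex.neg_im, Complex.im_ofReal_mul, inner_toC_left_im]; exact s1 _ _ a2
  have c2 : inner ℂ (toC η) z.1 = b * inner ℂ (toC ξ) (w : L2C × L2C).2 := by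
    apply Complex.ext
    · simp only [Complex.re_ofReal_mul, inner_toC_left_re]; exact s2 _ _ a3
    · simp only [Complex.im_ofReal_mul, inner_toC_left_im]; exact s2 _ _ a4
  rw [modeDual_apply, modeDual_apply, c1, c2]
  generalize inner ℂ (toC ξ) (w : L2C × L2C).2 = p, inner ℂ (toC η) (w : L2C × L2C).1 = q
  linear_combination ((1 / 2) * b * p * Complex.I ^ 2) * hσ2 + (1 / 2) * b * p * Complex.I_sq

theorem modeDual_mode (hσ : σ = 1 ∨ σ = -1) (ξ' η' : L2R) :
    modeDual σ ξ η (toC ξ', (σ * Complex.I) • toC η') =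
      (((1 / 2 : ℝ) * (inner ℝ η ξ' + inner ℝ ξ η') : ℝ) : ℂ) := by
  have hσ2 : (σ : ℂ) * σ = 1 := by rcases hσ with rfl | rfl <;> norm_num
  rw [modeDual_apply, inner_smul_right, inner_toC, inner_toC]
  push_cast
  linear_combination (-(1 / 2) * ((inner ℝ ξ η' : ℝ) : ℂ) * Complex.I ^ 2) * hσ2 -
    (1 / 2) * ((inner ℝ ξ η' : ℝ) : ℂ) * Complex.I_sq

end Mode

theorem norm_le_norm_reL_add (w : L2C) : ‖w‖ ≤ ‖reL w‖ + ‖imL w‖ := by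
  conv_lhs => rw [← toC_re_add_im w]
  refine (norm_add_le _ _).trans (le_of_eq ?_)
  rw [norm_smul, Complex.norm_I, one_mul, norm_toC, norm_toC]

/-- Near `± i (E₁ - E₀)` the linearized operator has no spectrum besides the modes, provided that
these are close to an orthonormal basis `ζ` of the eigenspace of `E₁` and the perturbation is
small. -/
theorem exists_spectral_accounting {V : 𝓢(Space, ℝ)} {E₀ E₁ : ℝ} (h01 : E₀ < E₁)
    (hE₁ : E₁ < 0) {N : ℕ} [FiniteDimensional ℝ (realEig (schwPot V) E₁)]
    (hN : Module.finrank ℝ (realEig (schwPot V) E₁) = N)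
    (h2 : ∀ u, HasSch (schwPot V) u ((2 * E₀ - E₁) • u) → u = 0) {ζ : Fin N → L2R}
    (hζ : ∀ n, ζ n ∈ realEig (schwPot V) E₁)
    (hon : ∀ m n, inner ℝ (ζ m) (ζ n) = if m = n then (1 : ℝ) else 0) :
    ∃ τ, 0 < τ ∧ ∀ (g E : ℝ) (y : L2R) (F : L2R →L[ℝ] L2R) (b : Fin N → ℝ)
      (ξ η : Fin N → L2R), (∀ w, F w = g • mulR y (mulR y w)) →
      |E - E₀| ≤ τ → ‖F‖ ≤ τ → (∀ n, ‖ξ n - ζ n‖ ≤ τ) → (∀ n, ‖η n - ζ n‖ ≤ τ) →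
      (∀ n, HasSch (schwPot V) (ξ n) (E • ξ n - (3 : ℝ) • F (ξ n) + b n • η n) ∧
        HasSch (schwPot V) (η n) (E • η n - F (η n) + b n • ξ n)) →
      (∀ m n, inner ℝ (ξ m) (η n) = if m = n then (1 : ℝ) else 0) →
      ∀ σ : ℝ, σ = 1 ∨ σ = -1 → ∀ μ : ℂ, ‖μ - σ * Complex.I * (E₁ - E₀)‖ < τ →
        eigenspace (linearizedOp V g E (resR 1 one_pos y)) μ =
            Submodule.span ℂ {w | ∃ n, μ = σ * Complex.I * b n ∧
              w = (toC (ξ n), (σ * Complex.I) • toC (η n))} ∧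
          rootSpace (linearizedOp V g E (resR 1 one_pos y)) μ =
            eigenspace (linearizedOp V g E (resR 1 one_pos y)) μ := by
  obtain ⟨C, hC, hbd⟩ := exists_mode_bound (memLp_schwPot V) h01 hE₁ hN h2 hζ hon
  refine ⟨1 / (4 * C), by positivity, fun g E y F b ξ η hF ht hFn hξ hη hm ho σ hσ μ hμ => ?_⟩
  obtain ⟨t, rfl⟩ : ∃ t, E = E₀ + t := ⟨E - E₀, by ring⟩
  rw [add_sub_cancel_left] at ht
  have hσ2 : (σ : ℂ) * σ = 1 := by rcases hσ with rfl | rfl <;> norm_num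
  have hσ2' : σ * σ = 1 := by rcases hσ with rfl | rfl <;> norm_num
  have hσn : ‖(σ : ℂ) * Complex.I‖ = 1 := by rcases hσ with rfl | rfl <;> simp
  refine eigenspace_eq_span_of_dual _ _ (fun n => σ * Complex.I * b n)
    (fun n => modeDual σ (ξ n) (η n)) (fun n => mem_eigenspace_of_mode hF hσ (hm n).1 (hm n).2)
    (fun n w => modeDual_linearizedOp hF hσ (hm n).1 (hm n).2 w) (fun n => ?_)
    (fun m n hmn => ?_) μ fun x hx hx0 => ?_
  · rw [modeDual_mode hσ, real_inner_comm, ho, if_pos rfl]; norm_num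
  · rw [modeDual_mode hσ, real_inner_comm, ho, ho, if_neg hmn, if_neg hmn.symm]; norm_num
  obtain ⟨a, c⟩ := x
  obtain ⟨⟨h1, h2⟩, h3, h4⟩ := (linearizedOp_iff hF _ _).1 hx
  simp only [Prod.smul_mk] at h1 h2 h3 h4
  -- in terms of `d = -σ i c` the equations are `L₊ a = l d` and `L₋ d = l a` with `μ = σ i l`
  set d : L2C := -((σ * Complex.I) • c) with hd
  set k : ℂ := -(σ * Complex.I * (μ - σ * Complex.I * (E₁ - E₀))) with hk
  have hkn : ‖k‖ < 1 / (4 * C) := by rw [hk, norm_neg, norm_mul, hσn, one_mul]; exact hμ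
  have hcd : c = (σ * Complex.I) • d := by
    rw [hd, smul_neg, smul_smul, ← neg_smul]
    have : -((σ : ℂ) * Complex.I * (σ * Complex.I)) = 1 := by
      linear_combination (-Complex.I ^ 2) * hσ2 - Complex.I_sq
    rw [this, one_smul]
  have e1 : -(μ • c) = ((E₁ - E₀ : ℝ) : ℂ) • d + k • d := by
    rw [hcd, smul_smul, ← neg_smul, ← add_smul]
    congr 1
    rw [hk]; push_cast
    linear_combination (Complex.I ^ 2 * (E₁ - E₀) : ℂ) * hσ2 * (-1) - (E₁ - E₀ : ℂ) * Complex.I_sq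
  have e2 : -((σ * Complex.I) • μ • a) = ((E₁ - E₀ : ℝ) : ℂ) • a + k • a := by
    rw [smul_smul, ← neg_smul, ← add_smul]
    congr 1
    rw [hk]; push_cast
    linear_combination (Complex.I ^ 2 * (E₁ - E₀) : ℂ) * hσ2 * (-1) - (E₁ - E₀ : ℂ) * Complex.I_sq
  have re1 : -reL (μ • c) = (E₁ - E₀) • reL d + reL (k • d) := by
    rw [← map_neg, e1, map_add, Complex.coe_smul, map_smul]
  have im1 : -imL (μ • c) = (E₁ - E₀) • imL d + imL (k • d) := by
    rw [← map_neg, e1, map_add, Complex.coe_smul, map_smul]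
  have red : ∀ w : L2C, reL (-((σ * Complex.I) • w)) = σ • imL w := fun w => by
    rw [map_neg, mul_smul, Complex.coe_smul, map_smul, reL_smul_I, smul_neg, neg_neg]
  have imd : ∀ w : L2C, imL (-((σ * Complex.I) • w)) = -(σ • reL w) := fun w => by
    rw [map_neg, mul_smul, Complex.coe_smul, map_smul, imL_smul_I]
  have re2 : σ • imL (μ • a) = (E₁ - E₀) • reL a + reL (k • a) := by
    rw [← red, e2, map_add, Complex.coe_smul, map_smul]
  have im2 : -(σ • reL (μ • a)) = (E₁ - E₀) • imL a + imL (k • a) := by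
    rw [← imd, e2, map_add, Complex.coe_smul, map_smul]
  have q1 : HasSch (schwPot V) (reL a) ((E₀ + t) • reL a - (3 : ℝ) • F (reL a) +
      ((E₁ - E₀) • reL d + reL (k • d))) := by rw [← re1, ← sub_eq_add_neg]; exact h1
  have q2 : HasSch (schwPot V) (imL a) ((E₀ + t) • imL a - (3 : ℝ) • F (imL a) +
      ((E₁ - E₀) • imL d + imL (k • d))) := by rw [← im1, ← sub_eq_add_neg]; exact h2
  have q3 : HasSch (schwPot V) (reL d) ((E₀ + t) • reL d - F (reL d) +
      ((E₁ - E₀) • reL a + reL (k • a))) := by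
    rw [← re2, hd, red, map_smul]
    convert h4.smul σ using 1
    module
  have q4 : HasSch (schwPot V) (imL d) ((E₀ + t) • imL d - F (imL d) +
      ((E₁ - E₀) • imL a + imL (k • a))) := by
    rw [← im2, hd, imd, map_neg, map_smul]
    convert (h3.smul σ).neg using 1
    module
  have hz : ∀ n, inner ℂ (toC (ξ n)) d + inner ℂ (toC (η n)) a = 0 := fun n => by
    have := hx0 n
    rw [modeDual_apply, mul_eq_zero] at this
    have := this.resolve_left (by norm_num)
    rw [hd, inner_neg_right, inner_smul_right]
    linear_combination this
  have z1 : ∀ n, inner ℝ (ξ n) (reL d) + inner ℝ (η n) (reL a) = 0 := fun n => by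
    have := congrArg Complex.re (hz n)
    rwa [Complex.add_re, inner_toC_left_re, inner_toC_left_re] at this
  have z2 : ∀ n, inner ℝ (ξ n) (imL d) + inner ℝ (η n) (imL a) = 0 := fun n => by
    have := congrArg Complex.im (hz n)
    rwa [Complex.add_im, inner_toC_left_im, inner_toC_left_im] at this
  have b1 := hbd t _ F ξ η _ _ _ _ ht hFn hξ hη q1 q3 z1
  have b2 := hbd t _ F ξ η _ _ _ _ ht hFn hξ hη q2 q4 z2
  have hkw : ∀ w : L2C, ‖reL (k • w)‖ + ‖imL (k • w)‖ ≤
      2 * (1 / (4 * C) * (‖reL w‖ + ‖imL w‖)) := fun w => by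
    have e : ‖k • w‖ ≤ 1 / (4 * C) * (‖reL w‖ + ‖imL w‖) := by
      rw [norm_smul]
      exact mul_le_mul hkn.le (norm_le_norm_reL_add w) (norm_nonneg _) (by positivity)
    linarith [norm_reL_le (k • w), norm_imL_le (k • w)]
  have ka := hkw a
  have kd := hkw d
  have n1 := norm_nonneg (reL a)
  have n2 := norm_nonneg (imL a)
  have n3 := norm_nonneg (reL d)
  have n4 := norm_nonneg (imL d)
  set T := ‖reL a‖ + ‖imL a‖ + ‖reL d‖ + ‖imL d‖ with hT
  have hCτ : C * (1 / (4 * C)) = 1 / 4 := by field_simp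
  have hTle : T ≤ C * (3 * (1 / (4 * C) * T)) := by
    calc T ≤ C * (1 / (4 * C) * (‖reL a‖ + ‖reL d‖) + ‖reL (k • d)‖ + ‖reL (k • a)‖) +
          C * (1 / (4 * C) * (‖imL a‖ + ‖imL d‖) + ‖imL (k • d)‖ + ‖imL (k • a)‖) := by linarith
      _ = C * (1 / (4 * C) * T + (‖reL (k • d)‖ + ‖imL (k • d)‖) +
          (‖reL (k • a)‖ + ‖imL (k • a)‖)) := by rw [hT]; ring
      _ ≤ C * (1 / (4 * C) * T + 2 * (1 / (4 * C) * (‖reL d‖ + ‖imL d‖)) +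
          2 * (1 / (4 * C) * (‖reL a‖ + ‖imL a‖))) := by gcongr
      _ = _ := by rw [hT]; ring
  have hT0 : T ≤ 0 := by
    have : C * (3 * (1 / (4 * C) * T)) = 3 / 4 * T := by
      rw [show C * (3 * (1 / (4 * C) * T)) = 3 * (C * (1 / (4 * C))) * T by ring, hCτ]; ring
    linarith
  have ha : a = 0 := norm_le_zero_iff.1 ((norm_le_norm_reL_add a).trans (by linarith))
  have hd0 : d = 0 := norm_le_zero_iff.1 ((norm_le_norm_reL_add d).trans (by linarith))
  rw [hcd, ha, hd0, smul_zero]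
  rfl

/-! ### The neutral modes along the branch -/

theorem isOpen_side (g E₀ : ℝ) : IsOpen {E : ℝ | 0 < g * (E - E₀)} :=
  isOpen_lt continuous_const (by fun_prop)

theorem ne_of_mem_side {g E₀ E : ℝ} (h : 0 < g * (E - E₀)) : E ≠ E₀ := fun h0 => by
  rw [h0, sub_self, mul_zero] at h; exact lt_irrefl _ h

theorem tendsto_amplitude (g E₀ : ℝ) (ψ₀ : L2R) :
    Tendsto (amplitude g E₀ ψ₀) (𝓝 E₀) (𝓝 0) := by
  have h : Continuous (amplitude g E₀ ψ₀) := by unfold amplitude; fun_prop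
  have h0 : amplitude g E₀ ψ₀ E₀ = 0 := by simp [amplitude]
  exact h0 ▸ h.tendsto E₀

theorem differentiableAt_amplitude {g E₀ E : ℝ} (ψ₀ : L2R) (h : E ≠ E₀) :
    DifferentiableAt ℝ (amplitude g E₀ ψ₀) E := by
  have h1 : E₀ - E ≠ 0 := sub_ne_zero.2 h.symm
  unfold amplitude
  have h2 : DifferentiableAt ℝ (fun E => |E₀ - E|) E :=
    DifferentiableAt.comp E (differentiableAt_abs h1) (by fun_prop)
  exact (h2.sqrt (abs_ne_zero.2 h1)).mul_const _

/-- The branch is the image under the resolvent of a family `y` whose square, as a multiplication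
operator, extends analytically through `E₀`. -/
theorem exists_branch_family {V : 𝓢(Space, ℝ)} {g E₀ : ℝ} (hg : g ≠ 0) (hE₀ : E₀ < 0)
    {ψ₀ : L2R} (hψ₀ : IsGroundState V E₀ ψ₀) {δ₀ : ℝ} (hδ₀ : 0 < δ₀) {ψ : ℝ → L2R}
    (hψ : IsBranch V g E₀ ψ₀ δ₀ ψ) :
    ∃ (y : ℝ → L2R) (F : ℝ → L2R →L[ℝ] L2R), AnalyticAt ℝ F 0 ∧ F 0 = 0 ∧
      (∀ t u v, inner ℝ (F t u) v = inner ℝ u (F t v)) ∧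
      Tendsto y (𝓝[{E | 0 < g * (E - E₀)}] E₀) (𝓝 0) ∧
      ∀ᶠ E in 𝓝[{E | 0 < g * (E - E₀)}] E₀, ψ E = resR 1 one_pos (y E) ∧
        DifferentiableAt ℝ y E ∧ (∀ w, F (E - E₀) w = g • mulR (y E) (mulR (y E) w)) ∧
        HasSch (schwPot V) (resR 1 one_pos (y E)) (E • resR 1 one_pos (y E) -
          g • mulR (y E) (mulR (y E) (resR 1 one_pos (y E)))) := by
  obtain ⟨a, ha, ha0, hprof⟩ := exists_analytic_profile hg hE₀ hψ₀ hδ₀ hψ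
  have hc : 0 < ∫ x, (ψ₀ x) ^ 4 := by
    rw [ha0, ← inner_mulR_mulR_eq]
    exact inner_mulR_mulR_pos (ha0 ▸ hψ₀.pos)
  have hta : Tendsto (fun E : ℝ => E - E₀) (𝓝[{E | 0 < g * (E - E₀)}] E₀) (𝓝 0) := by
    have : Tendsto (fun E : ℝ => E - E₀) (𝓝 E₀) (𝓝 (E₀ - E₀)) := tendsto_id.sub_const E₀
    rw [sub_self] at this
    exact this.mono_left nhdsWithin_le_nhds
  have hm : AnalyticAt ℝ (fun t => mulR (a t)) 0 := (mulR.analyticAt _).comp ha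
  have hρ := (tendsto_amplitude g E₀ ψ₀).mono_left
    (nhdsWithin_le_nhds (s := {E | 0 < g * (E - E₀)}))
  refine ⟨fun E => amplitude g E₀ ψ₀ E • a (E - E₀),
    fun t => (t * (∫ x, (ψ₀ x) ^ 4)⁻¹) • (mulR (a t) ∘L mulR (a t)), ?_, ?_, ?_, ?_, ?_⟩
  · exact (analyticAt_id.mul analyticAt_const).smul (hm.clmComp hm)
  · simp
  · intro t u v
    simp only [smul_apply, ContinuousLinearMap.comp_apply]
    rw [real_inner_smul_left, real_inner_smul_right, mulR_symm, mulR_symm]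
  · have := hρ.smul (ha.continuousAt.tendsto.comp hta)
    rwa [zero_smul] at this
  · have han : ∀ᶠ E in 𝓝[{E | 0 < g * (E - E₀)}] E₀, AnalyticAt ℝ a (E - E₀) :=
      hta.eventually ha.eventually_analyticAt
    have hδ : ∀ᶠ E in 𝓝[{E | 0 < g * (E - E₀)}] E₀, |E - E₀| < δ₀ := by
      have h1 : ∀ᶠ t : ℝ in 𝓝 0, |t| < δ₀ := by
        have := (continuous_abs.tendsto (0 : ℝ)).eventually_lt_const (u := δ₀) (by simpa using hδ₀)
        exact this
      exact hta.eventually h1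
    filter_upwards [hprof, han, hδ, self_mem_nhdsWithin] with E h1 h2 h3 h4
    have e : ψ E = resR 1 one_pos (amplitude g E₀ ψ₀ E • a (E - E₀)) := by rw [map_smul, h1]
    refine ⟨e, ?_, fun w => ?_, ?_⟩
    · exact (differentiableAt_amplitude ψ₀ (ne_of_mem_side h4)).smul
        (h2.differentiableAt.comp E (by fun_prop))
    · simp only [map_smul, smul_apply, ContinuousLinearMap.comp_apply]
      rw [smul_smul, smul_smul, ← mul_sq_amplitude hc h4]
      congr 1; ring
    · have := hψ.solves E h4 h3.le
      rw [e] at this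
      exact hasSch_of_solves this

/-- The derivative of a differentiable family satisfying the resolvent form of the cubic
equation. -/
theorem deriv_eq_of_cubic (R W : L2R →L[ℝ] L2R) (M : L2R →L[ℝ] L2R →L[ℝ] L2R) {g E : ℝ}
    {y : ℝ → L2R} {y' : L2R} (hy : HasDerivAt y y' E)
    (h : ∀ᶠ E in 𝓝 E, y E = E • R (y E) - g • M (y E) (M (y E) (R (y E))) + R (y E) -
      W (R (y E))) :
    y' = E • R y' + R (y E) - g • (M y' (M (y E) (R (y E))) + M (y E) (M y' (R (y E)) +
      M (y E) (R y'))) + R y' - W (R y') := by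
  have hR : HasDerivAt (fun E => R (y E)) (R y') E := R.hasFDerivAt.comp_hasDerivAt E hy
  have hM : HasDerivAt (fun E => M (y E)) (M y') E := M.hasFDerivAt.comp_hasDerivAt E hy
  have hW : HasDerivAt (fun E => W (R (y E))) (W (R y')) E :=
    W.hasFDerivAt.comp_hasDerivAt E hR
  have h1 := ((((hasDerivAt_id E).smul hR).sub
    ((hM.clm_apply (hM.clm_apply hR)).const_smul g)).add hR).sub hW
  have h2 := hy.unique (h1.congr_of_eventuallyEq h)
  rw [one_smul] at h2
  exact h2

/-- The derivative of the branch solves `L₊ ∂ψ = ψ`. -/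
theorem hasSch_deriv_branch {W : LinfR} {g E : ℝ} {y : ℝ → L2R} {y' : L2R}
    (hy : HasDerivAt y y' E)
    (h : ∀ᶠ E in 𝓝 E, HasSch W (resR 1 one_pos (y E)) (E • resR 1 one_pos (y E) -
      g • mulR (y E) (mulR (y E) (resR 1 one_pos (y E))))) :
    HasSch W (resR 1 one_pos y') (E • resR 1 one_pos y' -
      (3 : ℝ) • g • mulR (y E) (mulR (y E) (resR 1 one_pos y')) + resR 1 one_pos (y E)) := by
  have h2 := deriv_eq_of_cubic (resR 1 one_pos) (mulL ℝ W) mulR hy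
    (h.mono fun E hE => hE.eq_of_resR)
  refine ⟨y', rfl, ?_⟩
  have e1 : mulR y' (resR 1 one_pos (y E)) = mulR (y E) (resR 1 one_pos y') := mulR_resR _ _
  have e2 : mulR y' (mulR (y E) (resR 1 one_pos (y E))) =
      mulR (y E) (mulR (y E) (resR 1 one_pos y')) := (mulR_comm _ _ _).trans (congrArg _ e1)
  have e3 := (mulR (y E)).map_add (mulR (y E) (resR 1 one_pos y'))
    (mulR (y E) (resR 1 one_pos y'))
  have key : ∀ A B C D G Q S : L2R, A = E • B + C - g • (D + G) + B - Q → G = S + S → D = S →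
      E • B - (3 : ℝ) • g • S + C = A - B + Q := by
    rintro A B C D G Q S rfl rfl rfl
    module
  rw [e1] at h2
  exact key _ _ _ _ _ _ _ h2 e3 e2

/-- The orthogonality of a mode to the generalized kernel of the linearized operator. -/
theorem inner_mode_branch_eq_zero {W : LinfR} {E b : ℝ} {F : L2R →L[ℝ] L2R} {ξ η p p' : L2R}
    (hF : ∀ u v, inner ℝ (F u) v = inner ℝ u (F v)) (hb : b ≠ 0)
    (hξ : HasSch W ξ (E • ξ - (3 : ℝ) • F ξ + b • η)) (hη : HasSch W η (E • η - F η + b • ξ))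
    (hp : HasSch W p (E • p - F p)) (hp' : HasSch W p' (E • p' - (3 : ℝ) • F p' + p)) :
    inner ℝ ξ p = 0 ∧ inner ℝ η p' = 0 := by
  have h1 : inner ℝ ξ p = 0 := by
    have := hη.symm hp
    rw [inner_add_left, inner_sub_left, inner_sub_right, real_inner_smul_left,
      real_inner_smul_left, real_inner_smul_right, hF] at this
    exact (mul_eq_zero.1 (by linarith : b * inner ℝ ξ p = 0)).resolve_left hb
  refine ⟨h1, ?_⟩
  have := hξ.symm hp'
  rw [inner_add_left, inner_sub_left, inner_add_right, inner_sub_right, real_inner_smul_left,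
    real_inner_smul_left, real_inner_smul_left, real_inner_smul_right, real_inner_smul_right,
    hF, h1] at this
  exact (mul_eq_zero.1 (by linarith : b * inner ℝ η p' = 0)).resolve_left hb

end NLSGP

end

theorem mainTheorem7
    (V : 𝓢(NLSGP.Space, ℝ)) (g E₀ E₁ : ℝ) (hg : g ≠ 0)
    -- two eigenvalues `E₀ < E₁ < 0` of `-Δ + V`, the lowest one with a positive ground state
    (hE₀₁ : E₀ < E₁) (hE₁ : E₁ < 0)
    (hspec : ∀ μ : ℂ, NLSGP.eigenspace (NLSGP.schrodinger V) μ ≠ ⊥ ↔ μ = E₀ ∨ μ = E₁)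
    (ψ₀ : NLSGP.L2R) (hψ₀ : NLSGP.IsGroundState V E₀ ψ₀)
    -- a basis of the eigenspace of `E₁`, which has dimension `N`
    (N : ℕ) (hN : 1 ≤ N) (ξs : Fin N → NLSGP.L2C) (hξs : LinearIndependent ℂ ξs)
    (hξs_span : Submodule.span ℂ (Set.range ξs) = NLSGP.eigenspace (NLSGP.schrodinger V) E₁)
    -- resonance condition
    (hres : 0 < 2 * E₁ - E₀)
    -- the bifurcating branch of nonlinear bound states
    (δ₀ : ℝ) (hδ₀ : 0 < δ₀) (ψ : ℝ → NLSGP.L2R) (hψ : NLSGP.IsBranch V g E₀ ψ₀ δ₀ ψ) :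
    -- at `E = E₀`: eigenvalues `± i (E₁ - E₀)`, geometric and algebraic multiplicity `N`
    (∀ σ : ℝ, σ = 1 ∨ σ = -1 →
      Module.finrank ℂ (NLSGP.eigenspace (NLSGP.linearizedOp V g E₀ (ψ E₀))
        (σ * Complex.I * (E₁ - E₀))) = N ∧
      Module.finrank ℂ (NLSGP.rootSpace (NLSGP.linearizedOp V g E₀ (ψ E₀))
        (σ * Complex.I * (E₁ - E₀))) = N) ∧
    ∃ (δ ε : ℝ) (β : Fin N → ℝ → ℝ) (ξ η : Fin N → ℝ → NLSGP.L2R) (ζ : Fin N → NLSGP.L2R),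
      0 < δ ∧ δ ≤ δ₀ ∧ 0 < ε ∧
      (∀ E : ℝ, 0 < g * (E - E₀) → |E - E₀| < δ →
        -- the neutral modes `(ξ_n, ± i η_n)` with eigenvalues `± i β_n(E)`
        (∀ σ : ℝ, σ = 1 ∨ σ = -1 → ∀ n,
          ((NLSGP.toC (ξ n E), (σ * Complex.I) • NLSGP.toC (η n E)) : NLSGP.L2C × NLSGP.L2C) ∈
            NLSGP.eigenspace (NLSGP.linearizedOp V g E (ψ E)) (σ * Complex.I * β n E)) ∧
        -- they account for all the spectrum of `L(E)` near `± i (E₁ - E₀)`, with multiplicity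
        (∀ σ : ℝ, σ = 1 ∨ σ = -1 → ∀ μ : ℂ, ‖μ - σ * Complex.I * (E₁ - E₀)‖ < ε →
          NLSGP.eigenspace (NLSGP.linearizedOp V g E (ψ E)) μ =
            Submodule.span ℂ {w | ∃ n, μ = σ * Complex.I * β n E ∧
              w = (NLSGP.toC (ξ n E), (σ * Complex.I) • NLSGP.toC (η n E))} ∧
          NLSGP.rootSpace (NLSGP.linearizedOp V g E (ψ E)) μ =
            NLSGP.eigenspace (NLSGP.linearizedOp V g E (ψ E)) μ) ∧
        -- symplectic orthogonality relations
        (∀ m n, inner ℝ (ξ m E) (η n E) = if m = n then (1 : ℝ) else 0) ∧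
        (∀ m, inner ℝ (ξ m E) (ψ E) = 0) ∧
        DifferentiableAt ℝ ψ E ∧
        (∀ m, inner ℝ (η m E) (deriv ψ E) = 0) ∧
        (∀ n, 0 < 2 * β n E + E)) ∧
      (∀ n, Tendsto (β n) (𝓝[{E | 0 < g * (E - E₀)}] E₀) (𝓝 (E₁ - E₀))) ∧
      (∀ n, Tendsto (fun E => 2 * β n E + E) (𝓝[{E | 0 < g * (E - E₀)}] E₀)
        (𝓝 (2 * E₁ - E₀))) ∧
      -- `ξ_n` and `η_n` have the same nonzero limit in the eigenspace of `E₁`, in every `H^k`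
      (∀ n, ζ n ≠ 0 ∧ NLSGP.toC (ζ n) ∈ Submodule.span ℂ (Set.range ξs)) ∧
      (∀ n, ∀ k : ℝ, 0 < k →
        NLSGP.sobolevNorm k (NLSGP.toC (ζ n)) < ⊤ ∧
        Tendsto (fun E => NLSGP.sobolevNorm k (NLSGP.toC (ξ n E - ζ n)))
          (𝓝[{E | 0 < g * (E - E₀)}] E₀) (𝓝 0) ∧
        Tendsto (fun E => NLSGP.sobolevNorm k (NLSGP.toC (η n E - ζ n)))
          (𝓝[{E | 0 < g * (E - E₀)}] E₀) (𝓝 0)) := by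
  obtain ⟨hfd, hfr⟩ := NLSGP.finiteDimensional_realEig hξs hξs_span
  -- `2 E₀ - E₁` lies below the spectrum, so the second resolvent of the reduction exists
  have h2 : ∀ u, NLSGP.HasSch (NLSGP.schwPot V) u ((2 * E₀ - E₁) • u) → u = 0 := by
    have hbot : NLSGP.eigenspace (NLSGP.schrodinger V) ((2 * E₀ - E₁ : ℝ) : ℂ) = ⊥ := by
      by_contra h
      rcases (hspec _).1 h with h | h <;> rw [Complex.ofReal_inj] at h <;> linarith
    exact fun u hu => (Submodule.eq_bot_iff _).1 (NLSGP.realEig_eq_bot hbot) u hu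
  obtain ⟨y, F, hFa, hF0, hFs, hy0, hyev⟩ :=
    NLSGP.exists_branch_family hg (hE₀₁.trans hE₁) hψ₀ hδ₀ hψ
  obtain ⟨b, u, v, hcont, hmodes⟩ :=
    NLSGP.exists_modes (NLSGP.memLp_schwPot V) hE₀₁ hE₁ hfr h2 hFa hF0 hFs
  let ζ : Fin N → NLSGP.L2R := fun n => NLSGP.resR 1 one_pos (u n 0)
  have hζ : ∀ n, ζ n ∈ NLSGP.realEig (NLSGP.schwPot V) E₁ := fun n => (hcont n).2.2.2.2.2
  have huv : ∀ n, v n 0 = u n 0 := fun n => (hcont n).2.2.2.2.1.symm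
  have hon : ∀ m n, inner ℝ (ζ m) (ζ n) = if m = n then (1 : ℝ) else 0 := fun m n => by
    have := hmodes.self_of_nhds.2 m n
    rwa [huv] at this
  have hζ1 : ∀ n, ‖ζ n‖ = 1 := fun n => by
    have := hon n n
    rw [if_pos rfl, real_inner_self_eq_norm_sq] at this
    exact (pow_eq_one_iff_of_nonneg (norm_nonneg _) two_ne_zero).1 this
  obtain ⟨τ, hτ, hacc⟩ := NLSGP.exists_spectral_accounting hE₀₁ hE₁ hfr h2 hζ hon
  constructor
  -- at `E = E₀` the perturbation vanishes and the modes are `(ζ n, ± i ζ n)`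
  · intro σ hσ
    have hψ0 : ψ E₀ = NLSGP.resR 1 one_pos 0 := by rw [hψ.zero, map_zero]
    obtain ⟨h3, h4⟩ := hacc g E₀ 0 0 (fun _ => E₁ - E₀) ζ ζ (fun w => by simp) (by simpa using hτ.le)
      (by simpa using hτ.le) (fun n => by simpa using hτ.le) (fun n => by simpa using hτ.le)
      (fun n => by
        have : NLSGP.HasSch (NLSGP.schwPot V) (ζ n) (E₁ • ζ n) := hζ n
        constructor
        · convert this using 1
          rw [zero_apply]; module
        · convert this using 1
          rw [zero_apply]; module) hon σ hσ (σ * Complex.I * (E₁ - E₀)) (by simpa using hτ)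
    have hli : LinearIndependent ℂ fun n =>
        ((NLSGP.toC (ζ n), ((σ : ℂ) * Complex.I) • NLSGP.toC (ζ n)) : NLSGP.L2C × NLSGP.L2C) := by
      refine LinearIndependent.of_comp (LinearMap.fst ℂ NLSGP.L2C NLSGP.L2C) ?_
      refine Orthonormal.linearIndependent (orthonormal_iff_ite.2 fun m n => ?_)
      change inner ℂ (NLSGP.toC (ζ m)) (NLSGP.toC (ζ n)) = _
      rw [NLSGP.inner_toC, hon]
      split_ifs <;> simp
    have hset : {w : NLSGP.L2C × NLSGP.L2C | ∃ n, (σ : ℂ) * Complex.I * (E₁ - E₀) =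
        σ * Complex.I * ((E₁ - E₀ : ℝ) : ℂ) ∧
        w = (NLSGP.toC (ζ n), ((σ : ℂ) * Complex.I) • NLSGP.toC (ζ n))} =
        Set.range fun n => (NLSGP.toC (ζ n), ((σ : ℂ) * Complex.I) • NLSGP.toC (ζ n)) := by
      ext w
      constructor
      · rintro ⟨n, -, rfl⟩; exact ⟨n, rfl⟩
      · rintro ⟨n, rfl⟩; exact ⟨n, by push_cast; rfl, rfl⟩
    have hfin := finrank_span_eq_card hli
    rw [Fintype.card_fin, ← hset, ← h3] at hfin
    rw [hψ0]
    exact ⟨hfin, by rw [h4]; exact hfin⟩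
  have hl : Tendsto (fun E : ℝ => E - E₀) (𝓝[{E | 0 < g * (E - E₀)}] E₀) (𝓝 0) := by
    have : Tendsto (fun E : ℝ => E - E₀) (𝓝 E₀) (𝓝 (E₀ - E₀)) := tendsto_id.sub_const E₀
    rw [sub_self] at this
    exact this.mono_left nhdsWithin_le_nhds
  have hE : Tendsto (fun E : ℝ => E) (𝓝[{E | 0 < g * (E - E₀)}] E₀) (𝓝 E₀) :=
    tendsto_id.mono_left nhdsWithin_le_nhds
  have hbt : ∀ n, Tendsto (fun E => b n (E - E₀)) (𝓝[{E | 0 < g * (E - E₀)}] E₀)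
      (𝓝 (E₁ - E₀)) := fun n => by
    have := (hcont n).1.tendsto.comp hl
    rwa [(hcont n).2.1] at this
  have hut : ∀ n, Tendsto (fun E => u n (E - E₀)) (𝓝[{E | 0 < g * (E - E₀)}] E₀)
      (𝓝 (u n 0)) := fun n => (hcont n).2.2.1.tendsto.comp hl
  have hvt : ∀ n, Tendsto (fun E => v n (E - E₀)) (𝓝[{E | 0 < g * (E - E₀)}] E₀)
      (𝓝 (u n 0)) := fun n => by
    have := (hcont n).2.2.2.1.tendsto.comp hl
    rwa [huv] at this
  have h2b : ∀ n, Tendsto (fun E => 2 * b n (E - E₀) + E) (𝓝[{E | 0 < g * (E - E₀)}] E₀)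
      (𝓝 (2 * E₁ - E₀)) := fun n => by
    have := ((hbt n).const_mul 2).add hE
    rwa [show 2 * (E₁ - E₀) + E₀ = 2 * E₁ - E₀ by ring] at this
  have hmt : ∀ᶠ E in 𝓝[{E | 0 < g * (E - E₀)}] E₀,
      (∀ n, NLSGP.HasSch (NLSGP.schwPot V) (NLSGP.resR 1 one_pos (u n (E - E₀)))
        (E • NLSGP.resR 1 one_pos (u n (E - E₀)) -
          (3 : ℝ) • F (E - E₀) (NLSGP.resR 1 one_pos (u n (E - E₀))) +
          b n (E - E₀) • NLSGP.resR 1 one_pos (v n (E - E₀))) ∧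
        NLSGP.HasSch (NLSGP.schwPot V) (NLSGP.resR 1 one_pos (v n (E - E₀)))
        (E • NLSGP.resR 1 one_pos (v n (E - E₀)) -
          F (E - E₀) (NLSGP.resR 1 one_pos (v n (E - E₀))) +
          b n (E - E₀) • NLSGP.resR 1 one_pos (u n (E - E₀)))) ∧
      ∀ m n, inner ℝ (NLSGP.resR 1 one_pos (u m (E - E₀)))
        (NLSGP.resR 1 one_pos (v n (E - E₀))) = if m = n then (1 : ℝ) else 0 := by
    filter_upwards [hl.eventually hmodes] with E h
    simpa only [add_sub_cancel] using h
  have hnear : ∀ {w : Fin N → ℝ → NLSGP.L2R}, (∀ n, Tendsto (fun E => w n (E - E₀))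
      (𝓝[{E | 0 < g * (E - E₀)}] E₀) (𝓝 (u n 0))) → ∀ᶠ E in 𝓝[{E | 0 < g * (E - E₀)}] E₀,
        ∀ n, ‖NLSGP.resR 1 one_pos (w n (E - E₀)) - ζ n‖ ≤ τ := fun {w} hw => by
    refine eventually_all.2 fun n => ?_
    have h3 := (((NLSGP.resR 1 one_pos).continuous.tendsto _).comp (hw n)).sub_const (ζ n)
    rw [sub_self] at h3
    have h4 := h3.norm
    rw [norm_zero] at h4
    exact (h4.eventually_lt_const hτ).mono fun E h => h.le
  have hFt : ∀ᶠ E in 𝓝[{E | 0 < g * (E - E₀)}] E₀, ‖F (E - E₀)‖ ≤ τ := by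
    have h3 := (hFa.continuousAt.tendsto.comp hl).norm
    rw [hF0, norm_zero] at h3
    exact (h3.eventually_lt_const hτ).mono fun E h => h.le
  have hEt : ∀ᶠ E in 𝓝[{E | 0 < g * (E - E₀)}] E₀, |E - E₀| ≤ τ := by
    have h3 := hl.norm
    rw [norm_zero] at h3
    exact (h3.eventually_lt_const hτ).mono fun E h => h.le
  have hb0 : ∀ᶠ E in 𝓝[{E | 0 < g * (E - E₀)}] E₀, ∀ n, b n (E - E₀) ≠ 0 :=
    eventually_all.2 fun n => (hbt n).eventually_ne (by linarith)
  have hb2 : ∀ᶠ E in 𝓝[{E | 0 < g * (E - E₀)}] E₀, ∀ n, 0 < 2 * b n (E - E₀) + E :=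
    eventually_all.2 fun n => (h2b n).eventually_const_lt hres
  -- all local properties hold on a common one-sided neighbourhood, of radius `δ₁`
  obtain ⟨δ₁, hδ₁, hgood⟩ := Metric.mem_nhdsWithin_iff.1
    ((eventually_eventually_nhdsWithin.2 hyev).and (hmt.and ((hnear hut).and ((hnear hvt).and
      (hFt.and (hEt.and (hb0.and hb2)))))))
  refine ⟨min δ₁ δ₀, τ, fun n E => b n (E - E₀), fun n E => NLSGP.resR 1 one_pos (u n (E - E₀)),
    fun n E => NLSGP.resR 1 one_pos (v n (E - E₀)), ζ, lt_min hδ₁ hδ₀, min_le_right _ _, hτ,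
    fun E hEg hEδ => ?_, hbt, h2b, fun n => ⟨?_, ?_⟩, fun n k _ => ⟨?_, ?_⟩⟩
  · obtain ⟨hY, ⟨hm, ho⟩, hu, hv, hF, hEτ, hb, hpos⟩ :=
      hgood ⟨hEδ.trans_le (min_le_left _ _), hEg⟩
    -- the side is open, so the branch is described on a full neighbourhood of `E`
    rw [(NLSGP.isOpen_side g E₀).nhdsWithin_eq hEg] at hY
    obtain ⟨hψE, hdy, hFE, hsol⟩ := hY.self_of_nhds
    have hdψ : HasDerivAt ψ (NLSGP.resR 1 one_pos (deriv y E)) E :=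
      ((NLSGP.resR 1 one_pos).hasFDerivAt.comp_hasDerivAt E hdy.hasDerivAt).congr_of_eventuallyEq
        (hY.mono fun E' h => h.1)
    have hp : NLSGP.HasSch (NLSGP.schwPot V) (ψ E) (E • ψ E - F (E - E₀) (ψ E)) := by
      rw [hFE, hψE]; exact hsol
    have hp' : NLSGP.HasSch (NLSGP.schwPot V) (deriv ψ E)
        (E • deriv ψ E - (3 : ℝ) • F (E - E₀) (deriv ψ E) + ψ E) := by
      rw [hFE, hdψ.deriv, hψE]
      exact NLSGP.hasSch_deriv_branch hdy.hasDerivAt (hY.mono fun E' h => h.2.2.2)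
    have horth := fun n =>
      NLSGP.inner_mode_branch_eq_zero (hFs (E - E₀)) (hb n) (hm n).1 (hm n).2 hp hp'
    refine ⟨fun σ hσ n => ?_, fun σ hσ μ hμ => ?_, ho, fun m => (horth m).1,
      hdψ.differentiableAt, fun m => (horth m).2, hpos⟩
    · rw [hψE]
      exact NLSGP.mem_eigenspace_of_mode hFE hσ (hm n).1 (hm n).2
    · rw [hψE]
      exact hacc g E (y E) (F (E - E₀)) (fun n => b n (E - E₀)) _ _ hFE hEτ hF hu hv hm ho σ hσ μ hμ
  · intro h
    have := hζ1 n
    rw [h, norm_zero] at this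
    exact zero_ne_one this
  · rw [hξs_span]
    exact (NLSGP.toC_mem_eigenspace_iff V _ _).2 (hζ n)
  · exact NLSGP.sobolevNorm_lt_top_of_hasSch (hζ n) k
  · refine NLSGP.sobolevSmall_modes hE (hbt n) (hut n) (hvt n)
      (NLSGP.sobolevSmall_branch hE hy0 (hyev.mono fun E h => h.2.2.2)) (hζ n)
      (c := 3 * g) (c' := g) ?_ k
    filter_upwards [hmt, hyev] with E h h'
    obtain ⟨h3, h4⟩ := h.1 n
    rw [h'.2.2.1] at h3 h4
    rw [mul_smul]
    exact ⟨h3, h4⟩
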